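/- All Lie algebras and modules are real and finite dimensional. Let $\mathfrak s=\bigoplus_{p\in\mathbb Z}\mathfrak s_p$ be a $\mathbb Z$-graded Lie algebra. A graded $\mathfrak s$-module is an $\mathfrak s$-module $\mathfrak l=\bigoplus_{p\in\mathbb Z}\mathfrak l_p$ with $[\mathfrak s_p,\mathfrak l_q]\subset\mathfrak l_{p+q}$. It is called - *transitive* if $[\mathfrak s_{-1},Y]\neq\{0\}$ for all $0\ne Y\in\mathfrak l_p$, $p\ge 0$; - *nondegenerate* if $[\mathfrak s_{-1},Y]\neq\{0\}$ for all $0\ne Y\in\mathfrak l_{-1}$; - *fundamental* if $\mathfrak l_{p-1}=[\mathfrak s_{-1},\mathfrak l_p]$ for all $p<0$. A graded Lie algebra is called transitive, nondegenerate or fundamental if it is so as a module over itself via the adjoint representation. A *graded CR algebra* is a graded Lie algebra $\mathfrak s$ with a linear map $J:\mathfrak s_{-1}\to\mathfrak s_{-1}$ (the partial complex structure) such that $J^2=-\mathrm{Id}$, $[JX,JY]=[X,Y]$ for $X,Y\in\mathfrak s_{-1}$, and $[A,JX]=J[A,X]$ for $A\in\mathfrak s_0$, $X\in\mathfrak s_{-1}$.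 A *graded CR module* over it is a graded $\mathfrak s$-module $\mathfrak l$ with a linear map $J:\mathfrak l_{-1}\to\mathfrak l_{-1}$ such that the Abelian extension $\mathfrak s\oplus\mathfrak l$ (in which $[X,Y]=X\cdot Y$ for $X\in\mathfrak s$, $Y\in\mathfrak l$, and $[\mathfrak l,\mathfrak l]=0$), with the gradation $\mathfrak s_p\oplus\mathfrak l_p$ and the map $J\oplus J$ on $\mathfrak s_{-1}\oplus\mathfrak l_{-1}$, is a graded CR algebra. If $\mathfrak s\oplus\mathfrak l$ is fundamental and nondegenerate, the *Levi–Tanaka extension* of $\mathfrak s$ by $\mathfrak l$ is the (unique up to isomorphism) maximal finite dimensional transitive graded CR algebra $\mathfrak g$ with $\mathfrak g_-=\bigoplus_{p<0}\mathfrak g_p=\mathfrak s_-\oplus\mathfrak l_-$ as graded CR algebras: every finite dimensional transitive graded CR algebra with the same negative part embeds in $\mathfrak g$ by a degree-preserving homomorphism that is the identity on $\mathfrak s_-\oplus\mathfrak l_-$. **Theorem.** Let $\mathfrak s$ be a transitive semisimple graded CR algebra and let $\mathfrak l$ be a nondegenerate transitive graded CR $\mathfrak s$-module such that $\mathfrak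 s\oplus\mathfrak l$ is fundamental and nondegenerate, so that the Levi–Tanaka extension $\mathfrak g$ of $\mathfrak s$ by $\mathfrak l$ is defined. Then $\mathfrak g$ has the $J$ property: there is an element $J_{\mathfrak g}\in\mathfrak g$ such that $JX=[J_{\mathfrak g},X]$ for all $X\in\mathfrak g_{-1}$, where $J$ is the partial complex structure of $\mathfrak g$. -/

import Mathlib

universe u

/-- The Abelian extension `𝔰 ⊕ 𝔩` of a Lie algebra `𝔰` by an `𝔰`-module `𝔩`, as a set. -/
@[ext] structure AbelianExt (s l : Type*) where
  /-- The component in `𝔰`. -/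
  fst : s
  /-- The component in `𝔩`. -/
  snd : l

namespace AbelianExt

/-- The underlying set of `𝔰 ⊕ 𝔩` is the product. -/
def toProd (s l : Type*) : AbelianExt s l ≃ s × l where
  toFun x := (x.fst, x.snd)
  invFun x := ⟨x.1, x.2⟩
  left_inv _ := rfl
  right_inv _ := rfl

section

variable {s l : Type*} [AddCommGroup s] [AddCommGroup l]

instance : AddCommGroup (AbelianExt s l) := (toProd s l).addCommGroup

@[simp] theorem fst_zero : (0 : AbelianExt s l).fst = 0 := rfl
@[simp] theorem snd_zero : (0 : AbelianExt s l).snd = 0 := rfl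
@[simp] theorem fst_add (x y : AbelianExt s l) : (x + y).fst = x.fst + y.fst := rfl
@[simp] theorem snd_add (x y : AbelianExt s l) : (x + y).snd = x.snd + y.snd := rfl
@[simp] theorem fst_neg (x : AbelianExt s l) : (-x).fst = -x.fst := rfl
@[simp] theorem snd_neg (x : AbelianExt s l) : (-x).snd = -x.snd := rfl

end

section AddCommGroup

variable {s l : Type*} [AddCommGroup s] [Module ℝ s] [AddCommGroup l] [Module ℝ l]

instance : Module ℝ (AbelianExt s l) := (toProd s l).module ℝ

@[simp] theorem fst_smul (t : ℝ) (x : AbelianExt s l) : (t • x).fst = t • x.fst := rfl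
@[simp] theorem snd_smul (t : ℝ) (x : AbelianExt s l) : (t • x).snd = t • x.snd := rfl

/-- The inclusion of `𝔰` in `𝔰 ⊕ 𝔩`. -/
def inl : s →ₗ[ℝ] AbelianExt s l where
  toFun x := ⟨x, 0⟩
  map_add' _ _ := by ext <;> simp
  map_smul' _ _ := by ext <;> simp

/-- The inclusion of `𝔩` in `𝔰 ⊕ 𝔩`. -/
def inr : l →ₗ[ℝ] AbelianExt s l where
  toFun y := ⟨0, y⟩
  map_add' _ _ := by ext <;> simp
  map_smul' _ _ := by ext <;> simp

/-- The direct sum `V ⊕ W ⊆ 𝔰 ⊕ 𝔩` of subspaces `V ⊆ 𝔰`, `W ⊆ 𝔩`. -/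
def prodSubmodule (V : Submodule ℝ s) (W : Submodule ℝ l) : Submodule ℝ (AbelianExt s l) where
  carrier := {x | x.fst ∈ V ∧ x.snd ∈ W}
  add_mem' hx hy := ⟨V.add_mem hx.1 hy.1, W.add_mem hx.2 hy.2⟩
  zero_mem' := ⟨V.zero_mem, W.zero_mem⟩
  smul_mem' t _ hx := ⟨V.smul_mem t hx.1, W.smul_mem t hx.2⟩

@[simp] theorem mem_prodSubmodule {V : Submodule ℝ s} {W : Submodule ℝ l} {x : AbelianExt s l} :
    x ∈ prodSubmodule V W ↔ x.fst ∈ V ∧ x.snd ∈ W := Iff.rfl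

theorem isInternal_prodSubmodule {V : ℤ → Submodule ℝ s} {W : ℤ → Submodule ℝ l}
    (hV : DirectSum.IsInternal V) (hW : DirectSum.IsInternal W) :
    DirectSum.IsInternal fun p => prodSubmodule (V p) (W p) := by
  rw [DirectSum.isInternal_submodule_iff_iSupIndep_and_iSup_eq_top] at hV hW ⊢
  constructor
  · rw [iSupIndep_def]
    intro p
    rw [Submodule.disjoint_def]
    intro x hx hx'
    have hle : (⨆ (q) (_ : q ≠ p), prodSubmodule (V q) (W q)) ≤
        prodSubmodule (⨆ (q) (_ : q ≠ p), V q) (⨆ (q) (_ : q ≠ p), W q) := by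
      refine iSup₂_le fun q hq y hy => ⟨?_, ?_⟩
      · exact (le_iSup₂_of_le (f := fun q (_ : q ≠ p) => V q) q hq le_rfl) hy.1
      · exact (le_iSup₂_of_le (f := fun q (_ : q ≠ p) => W q) q hq le_rfl) hy.2
    have h := hle hx'
    ext
    · exact Submodule.disjoint_def.1 (iSupIndep_def.1 hV.1 p) _ hx.1 h.1
    · exact Submodule.disjoint_def.1 (iSupIndep_def.1 hW.1 p) _ hx.2 h.2
  · rw [eq_top_iff]
    intro x _
    have hx : x = inl x.fst + inr x.snd := by ext <;> simp [inl, inr]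
    rw [hx]
    refine Submodule.add_mem _ ?_ ?_
    · have h : x.fst ∈ ⨆ p, V p := hV.2 ▸ Submodule.mem_top
      have hle : (⨆ p, V p) ≤
          (⨆ p, prodSubmodule (V p) (W p)).comap (inl : s →ₗ[ℝ] AbelianExt s l) :=
        iSup_le fun p y hy => Submodule.mem_iSup_of_mem p ⟨hy, (W p).zero_mem⟩
      exact hle h
    · have h : x.snd ∈ ⨆ p, W p := hW.2 ▸ Submodule.mem_top
      have hle : (⨆ p, W p) ≤
          (⨆ p, prodSubmodule (V p) (W p)).comap (inr : l →ₗ[ℝ] AbelianExt s l) :=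
        iSup_le fun p y hy => Submodule.mem_iSup_of_mem p ⟨(V p).zero_mem, hy⟩
      exact hle h

/-- The direct sum of an endomorphism of `V` and an endomorphism of `W`. -/
def prodMap {V : Submodule ℝ s} {W : Submodule ℝ l} (J : V →ₗ[ℝ] V) (K : W →ₗ[ℝ] W) :
    prodSubmodule V W →ₗ[ℝ] prodSubmodule V W where
  toFun x := ⟨⟨J ⟨x.1.fst, x.2.1⟩, K ⟨x.1.snd, x.2.2⟩⟩, (J _).2, (K _).2⟩
  map_add' x y := by
    apply Subtype.ext
    ext
    · exact congrArg Subtype.val (J.map_add ⟨x.1.fst, x.2.1⟩ ⟨y.1.fst, y.2.1⟩)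
    · exact congrArg Subtype.val (K.map_add ⟨x.1.snd, x.2.2⟩ ⟨y.1.snd, y.2.2⟩)
  map_smul' t x := by
    apply Subtype.ext
    ext
    · exact congrArg Subtype.val (J.map_smul t ⟨x.1.fst, x.2.1⟩)
    · exact congrArg Subtype.val (K.map_smul t ⟨x.1.snd, x.2.2⟩)

end AddCommGroup

section Bracket

variable {s l : Type*} [LieRing s] [AddCommGroup l] [LieRingModule s l]

/-- `[X + Y, X' + Y'] = [X, X'] + X · Y' - X' · Y` for `X, X' ∈ 𝔰` and `Y, Y' ∈ 𝔩`. -/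
instance : Bracket (AbelianExt s l) (AbelianExt s l) where
  bracket x y := ⟨⁅x.fst, y.fst⁆, ⁅x.fst, y.snd⁆ - ⁅y.fst, x.snd⁆⟩

@[simp] theorem fst_lie (x y : AbelianExt s l) : ⁅x, y⁆.fst = ⁅x.fst, y.fst⁆ := rfl
@[simp] theorem snd_lie (x y : AbelianExt s l) :
    ⁅x, y⁆.snd = ⁅x.fst, y.snd⁆ - ⁅y.fst, x.snd⁆ := rfl

instance : LieRing (AbelianExt s l) where
  add_lie x y z := by ext <;> simp; abel
  lie_add x y z := by ext <;> simp; abel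
  lie_self x := by ext <;> simp
  leibniz_lie x y z := by ext <;> simp; abel

end Bracket

section Lie

variable {s l : Type*} [LieRing s] [LieAlgebra ℝ s] [AddCommGroup l] [Module ℝ l]
  [LieRingModule s l] [LieModule ℝ s l]

instance : LieAlgebra ℝ (AbelianExt s l) where
  lie_smul t x y := by ext <;> simp [smul_sub]

end Lie

end AbelianExt

/-- A `ℤ`-gradation of a real Lie algebra `L`. -/
structure LieGrading (L : Type*) [LieRing L] [LieAlgebra ℝ L] where
  /-- The homogeneous subspace of degree `p`. -/
  deg : ℤ → Submodule ℝ L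
  isInternal : DirectSum.IsInternal deg
  lie_mem : ∀ {p q : ℤ} {x y : L}, x ∈ deg p → y ∈ deg q → ⁅x, y⁆ ∈ deg (p + q)

/-- A gradation of an `L`-module `M`, for a graded Lie algebra `L`. -/
structure ModuleGrading {L : Type*} [LieRing L] [LieAlgebra ℝ L] (S : LieGrading L)
    (M : Type*) [AddCommGroup M] [Module ℝ M] [LieRingModule L M] [LieModule ℝ L M] where
  /-- The homogeneous subspace of degree `p`. -/
  deg : ℤ → Submodule ℝ M
  isInternal : DirectSum.IsInternal deg
  lie_mem : ∀ {p q : ℤ} {x : L} {y : M}, x ∈ S.deg p → y ∈ deg q → ⁅x, y⁆ ∈ deg (p + q)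

namespace ModuleGrading

variable {L : Type*} [LieRing L] [LieAlgebra ℝ L] {S : LieGrading L}
  {M : Type*} [AddCommGroup M] [Module ℝ M] [LieRingModule L M] [LieModule ℝ L M]

/-- `[L₋₁, Y] ≠ 0` for all nonzero `Y` of degree `p ≥ 0`. -/
def IsTransitive (Γ : ModuleGrading S M) : Prop :=
  ∀ p : ℤ, 0 ≤ p → ∀ Y ∈ Γ.deg p, Y ≠ 0 → ∃ X ∈ S.deg (-1), ⁅X, Y⁆ ≠ 0

/-- `[L₋₁, Y] ≠ 0` for all nonzero `Y` of degree `-1`. -/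
def IsNondegenerate (Γ : ModuleGrading S M) : Prop :=
  ∀ Y ∈ Γ.deg (-1), Y ≠ 0 → ∃ X ∈ S.deg (-1), ⁅X, Y⁆ ≠ 0

/-- `M_{p-1} = [L₋₁, M_p]` for all `p < 0`. -/
def IsFundamental (Γ : ModuleGrading S M) : Prop :=
  ∀ p : ℤ, p < 0 →
    Γ.deg (p - 1) = Submodule.span ℝ {Z | ∃ X ∈ S.deg (-1), ∃ Y ∈ Γ.deg p, ⁅X, Y⁆ = Z}

end ModuleGrading

namespace LieGrading

section

variable {L : Type*} [LieRing L] [LieAlgebra ℝ L]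

/-- A graded Lie algebra as a graded module over itself, via the adjoint representation. -/
def adjoint (S : LieGrading L) : ModuleGrading S L where
  deg := S.deg
  isInternal := S.isInternal
  lie_mem := S.lie_mem

/-- A graded Lie algebra is transitive if its adjoint representation is. -/
def IsTransitive (S : LieGrading L) : Prop := S.adjoint.IsTransitive

/-- A graded Lie algebra is nondegenerate if its adjoint representation is. -/
def IsNondegenerate (S : LieGrading L) : Prop := S.adjoint.IsNondegenerate

/-- A graded Lie algebra is fundamental if its adjoint representation is. -/
def IsFundamental (S : LieGrading L) : Prop := S.adjoint.IsFundamental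

theorem lie_mem_iSup_neg (S : LieGrading L) {x y : L}
    (hx : x ∈ ⨆ (p : ℤ) (_ : p < 0), S.deg p) (hy : y ∈ ⨆ (p : ℤ) (_ : p < 0), S.deg p) :
    ⁅x, y⁆ ∈ ⨆ (p : ℤ) (_ : p < 0), S.deg p := by
  have key : ∀ p : ℤ, p < 0 → ∀ x ∈ S.deg p, (⨆ (q : ℤ) (_ : q < 0), S.deg q) ≤
      (⨆ (q : ℤ) (_ : q < 0), S.deg q).comap (LieAlgebra.ad ℝ L x : L →ₗ[ℝ] L) := by
    intro p hp x hx
    refine iSup₂_le fun q hq z hz => ?_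
    exact Submodule.mem_iSup_of_mem (p + q)
      (Submodule.mem_iSup_of_mem (by omega) (S.lie_mem hx hz))
  have key2 : (⨆ (q : ℤ) (_ : q < 0), S.deg q) ≤
      (⨆ (q : ℤ) (_ : q < 0), S.deg q).comap (LieAlgebra.ad ℝ L y : L →ₗ[ℝ] L) := by
    refine iSup₂_le fun q hq z hz => ?_
    have h : ⁅z, y⁆ ∈ ⨆ (q : ℤ) (_ : q < 0), S.deg q := key q hq z hz hy
    change ⁅y, z⁆ ∈ ⨆ (q : ℤ) (_ : q < 0), S.deg q
    rw [← lie_skew]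
    exact Submodule.neg_mem _ h
  have h : ⁅y, x⁆ ∈ ⨆ (q : ℤ) (_ : q < 0), S.deg q := key2 hx
  rw [← lie_skew]
  exact Submodule.neg_mem _ h

/-- The subalgebra `L₋ = ⨁_{p < 0} L_p`. -/
def neg (S : LieGrading L) : LieSubalgebra ℝ L where
  toSubmodule := ⨆ (p : ℤ) (_ : p < 0), S.deg p
  lie_mem' hx hy := S.lie_mem_iSup_neg hx hy

theorem mem_neg (S : LieGrading L) {p : ℤ} (hp : p < 0) {x : L} (hx : x ∈ S.deg p) :
    x ∈ S.neg :=
  Submodule.mem_iSup_of_mem (p := fun p : ℤ => ⨆ (_ : p < 0), S.deg p) p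
    (Submodule.mem_iSup_of_mem hp hx)

/-- An element of degree `-1` as an element of `L₋`. -/
def toNeg (S : LieGrading L) (x : S.deg (-1)) : S.neg :=
  ⟨x, S.mem_neg (by norm_num) x.2⟩

/-- `J` is a partial complex structure on the graded Lie algebra `L`. -/
structure IsCRStructure (S : LieGrading L) (J : S.deg (-1) →ₗ[ℝ] S.deg (-1)) : Prop where
  sq : ∀ X, J (J X) = -X
  lie_map_map : ∀ X Y, ⁅(J X : L), (J Y : L)⁆ = ⁅(X : L), (Y : L)⁆
  /-- `J [A, X] = [A, J X]` for `A` of degree `0` (the bracket `[A, X]` is named `Z`). -/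
  map_lie : ∀ A ∈ S.deg 0, ∀ X Z : S.deg (-1), (Z : L) = ⁅A, (X : L)⁆ → (J Z : L) = ⁅A, (J X : L)⁆

end

section

variable {s : Type*} [LieRing s] [LieAlgebra ℝ s]
  {l : Type*} [AddCommGroup l] [Module ℝ l] [LieRingModule s l] [LieModule ℝ s l]

/-- The gradation `(𝔰 ⊕ 𝔩)_p = 𝔰_p ⊕ 𝔩_p` of the Abelian extension. -/
def abelianExt (S : LieGrading s) (Γ : ModuleGrading S l) : LieGrading (AbelianExt s l) where
  deg p := AbelianExt.prodSubmodule (S.deg p) (Γ.deg p)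
  isInternal := AbelianExt.isInternal_prodSubmodule S.isInternal Γ.isInternal
  lie_mem {p q _ _} hx hy := ⟨S.lie_mem hx.1 hy.1,
    Submodule.sub_mem _ (Γ.lie_mem hx.1 hy.2) (add_comm q p ▸ Γ.lie_mem hy.1 hx.2)⟩

end

end LieGrading

/-- A graded `CR` algebra structure on a real Lie algebra `L`. -/
structure GradedCRAlgebra (L : Type*) [LieRing L] [LieAlgebra ℝ L] extends LieGrading L where
  /-- The partial complex structure. -/
  J : deg (-1) →ₗ[ℝ] deg (-1)
  isCR : toLieGrading.IsCRStructure J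

/-- A graded `CR` module structure on a module `M` over a graded `CR` algebra `L`: a gradation and
a complex structure on `M₋₁` that make the Abelian extension `L ⊕ M` a graded `CR` algebra. -/
structure GradedCRModule {L : Type*} [LieRing L] [LieAlgebra ℝ L] (S : GradedCRAlgebra L)
    (M : Type*) [AddCommGroup M] [Module ℝ M] [LieRingModule L M] [LieModule ℝ L M]
    extends ModuleGrading S.toLieGrading M where
  /-- The complex structure on the subspace of degree `-1`. -/
  J : deg (-1) →ₗ[ℝ] deg (-1)
  isCR : (S.toLieGrading.abelianExt toModuleGrading).IsCRStructure (AbelianExt.prodMap S.J J)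

namespace GradedCRAlgebra

/-- The Abelian extension `𝔰 ⊕ 𝔩` of a graded `CR` algebra by a graded `CR` module. -/
def abelianExt {s : Type*} [LieRing s] [LieAlgebra ℝ s]
    {l : Type*} [AddCommGroup l] [Module ℝ l] [LieRingModule s l] [LieModule ℝ s l]
    (S : GradedCRAlgebra s) (Λ : GradedCRModule S l) : GradedCRAlgebra (AbelianExt s l) where
  toLieGrading := S.toLieGrading.abelianExt Λ.toModuleGrading
  J := AbelianExt.prodMap S.J Λ.J
  isCR := Λ.isCR

/-- The `J` property: the partial complex structure on `𝔤₋₁` is the restriction of an inner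
derivation of `𝔤`. -/
def HasJProperty {g : Type*} [LieRing g] [LieAlgebra ℝ g] (G : GradedCRAlgebra g) : Prop :=
  ∃ Jg : g, ∀ X : G.deg (-1), (G.J X : g) = ⁅Jg, (X : g)⁆

/-- `𝔤`, with the homomorphism `ι : 𝔞₋ → 𝔤`, is a transitive graded `CR` algebra with
`𝔤₋ = 𝔞₋`: via `ι`, the negative part of `𝔤` is identified with that of `𝔞`, as graded
`CR` algebras. -/
structure IsTransitiveProlongation {a : Type*} [LieRing a] [LieAlgebra ℝ a] (A : GradedCRAlgebra a)
    {g : Type*} [LieRing g] [LieAlgebra ℝ g] (G : GradedCRAlgebra g)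
    (ι : A.neg →ₗ⁅ℝ⁆ g) : Prop where
  transitive : G.IsTransitive
  injective : Function.Injective ι
  mem_deg_iff : ∀ p : ℤ, p < 0 → ∀ y : g, y ∈ G.deg p ↔ ∃ x : A.neg, (x : a) ∈ A.deg p ∧ ι x = y
  map_J : ∀ (X : A.deg (-1)) (Y : G.deg (-1)),
    (Y : g) = ι (A.toNeg X) → (G.J Y : g) = ι (A.toNeg (A.J X))

/-- `𝔤`, with `ι : 𝔞₋ → 𝔤`, is the maximal finite dimensional transitive graded `CR` algebra with
`𝔤₋ = 𝔞₋`: every other one embeds in it by a degree-preserving homomorphism that is the identity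
on `𝔞₋`. (Such a homomorphism automatically respects the partial complex structures.) If `𝔞₋` is
fundamental and nondegenerate, then `𝔤` is the Levi–Tanaka algebra of `𝔞₋`. -/
structure IsLeviTanakaProlongation {a : Type u} [LieRing a] [LieAlgebra ℝ a] (A : GradedCRAlgebra a)
    {g : Type u} [LieRing g] [LieAlgebra ℝ g] (G : GradedCRAlgebra g)
    (ι : A.neg →ₗ⁅ℝ⁆ g) : Prop where
  finiteDimensional : FiniteDimensional ℝ g
  isTransitiveProlongation : A.IsTransitiveProlongation G ι
  maximal : ∀ (g' : Type u) [LieRing g'] [LieAlgebra ℝ g'] [FiniteDimensional ℝ g']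
    (G' : GradedCRAlgebra g') (ι' : A.neg →ₗ⁅ℝ⁆ g'), A.IsTransitiveProlongation G' ι' →
    ∃ φ : g' →ₗ⁅ℝ⁆ g, Function.Injective φ ∧ (∀ p, ∀ x ∈ G'.deg p, φ x ∈ G.deg p) ∧
      ∀ x, φ (ι' x) = ι x

/-- `𝔤`, with `ι : (𝔰 ⊕ 𝔩)₋ → 𝔤`, is the Levi–Tanaka extension of `𝔰` by `𝔩`. It is defined when
`𝔰 ⊕ 𝔩` is fundamental and nondegenerate. -/
structure IsLeviTanakaExtension {s l : Type u} [LieRing s] [LieAlgebra ℝ s]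
    [AddCommGroup l] [Module ℝ l] [LieRingModule s l] [LieModule ℝ s l]
    (S : GradedCRAlgebra s) (Λ : GradedCRModule S l)
    {g : Type u} [LieRing g] [LieAlgebra ℝ g] (G : GradedCRAlgebra g)
    (ι : (S.abelianExt Λ).neg →ₗ⁅ℝ⁆ g) : Prop where
  fundamental : (S.abelianExt Λ).IsFundamental
  nondegenerate : (S.abelianExt Λ).IsNondegenerate
  isLeviTanaka : (S.abelianExt Λ).IsLeviTanakaProlongation G ι

end GradedCRAlgebra

/-!
Write `M` for `𝔰` or `𝔩`, as a graded module over the semisimple Lie algebra `𝔰`, and `J` for the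
complex structures of `𝔰₋₁` and `M₋₁`.

It is enough to extend `J` to a derivation of degree zero of `(𝔰 ⊕ 𝔩)₋`. Indeed, the semidirect sum
of `(𝔰 ⊕ 𝔩)₋` and the Lie algebra of its derivations of degree zero commuting with `J` is a
transitive graded `CR` algebra, so it embeds in the Levi–Tanaka extension `𝔤` by maximality, and the
image of the derivation is the element `J_𝔤`
(`GradedCRAlgebra.IsLeviTanakaProlongation.hasJProperty`).

Since `M_{p-1} = ⁅𝔰₋₁, M_p⁆` for `p < 0`, the extension `E` is forced by
`E ⁅x, y⁆ = ⁅J x, y⁆ + ⁅x, E y⁆` for `x ∈ 𝔰₋₁`, and only the consistency of these conditions is in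
question (`ModuleGrading.exists_extension`). They span a subspace of `M × M`, the would-be graph of
`E`, which has to contain no `(0, z)` with `z ≠ 0`. This graph is stable under `𝔰₁` as well, an
element `x ∈ 𝔰₁` acting by `(y, z) ↦ (⁅x, y⁆, ⁅D x, y⁆ + ⁅x, z⁆)` where `D` is the contragredient of
`J` for the Killing form (`ModuleGrading.lie_one_mem_extensionGraph`). So if `(0, z)` belongs to it
and `z` has degree `≤ -2`, then `⁅x, z⁆ = 0` for all `x ∈ 𝔰₁`, by induction on the degree. Such a
`z` is zero (`ModuleGrading.IsFundamental.eq_zero_of_lie_eq_zero`): as `𝔰` is generated by `𝔰₋₁`,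
`𝔰₀` and `𝔰₁` (`LieGrading.eq_top_of_deg_le`), it generates a submodule in degrees `≤ -2`, which is
a direct summand by Weyl's theorem and so vanishes, because `M₋₁` generates all of the negative
part.

The stability under `𝔰₁` rests on the identity `⁅D x, y⁆ + ⁅x, J y⁆ = 0` for `x ∈ 𝔰₁` and `y ∈ M₋₁`
(`lie_contragredient_add_lie_map_eq_zero`), which says that `𝔰₁^{1,0}` annihilates `M₋₁^{1,0}` in
the complexification. By nondegeneracy of the Killing form there is an element `H` of
`⁅𝔰₁^{1,0}, 𝔰₋₁^{0,1}⁆` acting on `𝔰₁^{1,0}` as `1` and on `𝔰₋₁^{0,1}` as `-1`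
(`exists_typeGradingElement`). The difference `F` of the degree and `H` commutes with `𝔰₁^{1,0}` and
`𝔰₋₁^{0,1}`, and has the same trace as the degree on each subspace stable under them. One such
subspace is `N = M₋₁^{0,1} ⊕ ⨁_{p ≥ 0} M_p`. On a generalized eigenspace of `F` the average degree
is therefore the same on `N` as on the complement `M₋₁^{1,0} ⊕ ⨁_{p < -1} M_p`. As degrees are
`≥ -1` on the first and `≤ -1` on the second, no nonzero element of degree `0` is obtained by
applying `𝔰₁^{1,0}` to `M₋₁^{1,0}` (`apply_eq_zero_of_trace_restrict_eq_zero`).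
-/

/-! ### Traces of operators -/

open Module Polynomial in
/-- If `z` commutes with all `x ∈ P` and is a linear combination of commutators `x * y - y * x` with
`x ∈ P`, `y ∈ Q`, then `z` is nilpotent: `w * z` has trace zero for each polynomial `w` in `z`, in
particular when `w * z` is the projection onto the part of `V` on which `z` is invertible. -/
theorem isNilpotent_of_mem_span_commutators {K V : Type*} [Field K] [CharZero K] [AddCommGroup V]
    [Module K V] [FiniteDimensional K V] {P Q : Set (End K V)} {z : End K V}
    (hP : ∀ x ∈ P, Commute z x)
    (hz : z ∈ Submodule.span K {w | ∃ x ∈ P, ∃ y ∈ Q, x * y - y * x = w}) : IsNilpotent z := by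
  have key : ∀ w : End K V, (∀ x ∈ P, Commute w x) →
      LinearMap.trace K V (w * z) = 0 := by
    intro w hwP
    have : Submodule.span K {w | ∃ x ∈ P, ∃ y ∈ Q, x * y - y * x = w} ≤
        LinearMap.ker (LinearMap.trace K V ∘ₗ LinearMap.mulLeft K w) := by
      rw [Submodule.span_le]
      rintro _ ⟨x, hx, y, -, rfl⟩
      have h1 : w * (x * y - y * x) = x * (w * y) - (w * y) * x := by
        rw [mul_sub, ← mul_assoc, (hwP x hx).eq]
        simp only [mul_assoc]
      simp [h1, LinearMap.trace_mul_comm K x (w * y)]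
    simpa using this hz
  -- Split the minimal polynomial of `z` as `X ^ n * q` with `X` prime to `q`.
  obtain ⟨q, hq, hq0⟩ := exists_eq_pow_rootMultiplicity_mul_and_not_dvd (minpoly K z)
    (minpoly.ne_zero (Algebra.IsIntegral.isIntegral z)) 0
  set n := rootMultiplicity 0 (minpoly K z)
  rw [C_0, sub_zero] at hq hq0
  have hcop : IsCoprime (X ^ (n + 1)) q :=
    ((irreducible_X.coprime_iff_not_dvd).2 hq0).pow_left
  obtain ⟨a, b, hab⟩ := hcop
  have hzq : z ^ n * aeval z q = 0 := by
    have := minpoly.aeval K z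
    rw [hq] at this
    simpa using this
  have hab' := congrArg (aeval z) hab
  simp only [map_add, map_mul, map_pow, aeval_X, map_one] at hab'
  have hcP : ∀ p : K[X], ∀ x ∈ P, Commute (aeval z p) x := by
    intro p x hx
    induction p using Polynomial.induction_on' with
    | add p q hp hq => simpa using hp.add_left hq
    | monomial k c =>
      rw [aeval_monomial]
      exact (Algebra.commute_algebraMap_left c x).mul_left ((hP x hx).pow_left k)
  -- `e` is the projection on the part on which `z` is invertible.
  set e := aeval z a * z ^ (n + 1) with he
  have hid : IsIdempotentElem e := by
    have h2 : e * (aeval z b * aeval z q) = 0 := by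
      have : (aeval z b * aeval z q) = aeval z q * aeval z b := by
        rw [← map_mul, mul_comm, map_mul]
      rw [this, he, pow_succ', mul_assoc, mul_assoc, ← mul_assoc (z ^ n), hzq]
      simp
    have := congrArg (e * ·) hab'
    simp only [mul_add, h2, add_zero, mul_one] at this
    exact this
  have htr : LinearMap.trace K V e = 0 := by
    rw [he, pow_succ, ← mul_assoc]
    have h3 : aeval z a * z ^ n = aeval z (a * X ^ n) := by simp
    rw [h3]
    exact key _ (hcP _)
  have he0 : e = 0 := LinearMap.IsIdempotentElem.eq_zero_of_trace_eq_zero hid htr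
  rw [he0, zero_add] at hab'
  refine ⟨n, ?_⟩
  calc z ^ n = z ^ n * (aeval z b * aeval z q) := by rw [hab', mul_one]
    _ = z ^ n * aeval z q * aeval z b := by rw [mul_assoc, ← map_mul, ← map_mul, mul_comm b q]
    _ = 0 := by rw [hzq, zero_mul]

open Module in
/-- A linear combination of commutators of operators preserving `W` has trace zero on `W`. -/
theorem trace_restrict_eq_zero_of_mem_span_commutators {K V : Type*} [Field K] [AddCommGroup V]
    [Module K V] [FiniteDimensional K V] {P Q : Set (End K V)} {h : End K V} (W : Submodule K V)
    (hP : ∀ x ∈ P, ∀ w ∈ W, x w ∈ W) (hQ : ∀ y ∈ Q, ∀ w ∈ W, y w ∈ W)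
    (hh : h ∈ Submodule.span K {w | ∃ x ∈ P, ∃ y ∈ Q, x * y - y * x = w}) :
    ∃ hW : ∀ w ∈ W, h w ∈ W, LinearMap.trace K W (h.restrict hW) = 0 := by
  induction hh using Submodule.span_induction with
  | mem _ hx =>
    obtain ⟨x, hx, y, hy, rfl⟩ := hx
    refine ⟨fun w hw => W.sub_mem (hP x hx _ (hQ y hy w hw)) (hQ y hy _ (hP x hx w hw)), ?_⟩
    have : (x * y - y * x).restrict
        (fun w hw => W.sub_mem (hP x hx _ (hQ y hy w hw)) (hQ y hy _ (hP x hx w hw))) =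
        (x.restrict (hP x hx)) * (y.restrict (hQ y hy)) -
          (y.restrict (hQ y hy)) * (x.restrict (hP x hx)) := rfl
    rw [this, map_sub, LinearMap.trace_mul_comm, sub_self]
  | zero => exact ⟨fun w _ => W.zero_mem, by
      rw [show (0 : End K V).restrict (fun w _ => W.zero_mem) = (0 : End K W) from rfl, map_zero]⟩
  | add a b _ _ ha hb =>
    obtain ⟨ha, ha'⟩ := ha
    obtain ⟨hb, hb'⟩ := hb
    refine ⟨fun w hw => W.add_mem (ha w hw) (hb w hw), ?_⟩
    have : (a + b).restrict (fun w hw => W.add_mem (ha w hw) (hb w hw)) =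
      a.restrict ha + b.restrict hb := rfl
    rw [this, map_add, ha', hb', add_zero]
  | smul c a _ ha =>
    obtain ⟨ha, ha'⟩ := ha
    refine ⟨fun w hw => W.smul_mem c (ha w hw), ?_⟩
    have : (c • a).restrict (fun w hw => W.smul_mem c (ha w hw)) = c • a.restrict ha := rfl
    rw [this, map_smul, ha', smul_zero]

open Module in
/-- The trace, on an invariant subspace `W`, of an operator that is diagonalizable on `W` with
eigenvalues in a set `S` of integers: `m p` is the multiplicity of `p`, which is positive for each
eigenvalue that occurs in `W`. -/
theorem exists_trace_restrict_eq_sum {K V : Type*} [Field K] [CharZero K] [AddCommGroup V]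
    [Module K V] [FiniteDimensional K V] (δ : End K V) (S : Set ℤ) (W : Submodule K V)
    (hW : ∀ w ∈ W, δ w ∈ W) (hS : W ≤ ⨆ p ∈ S, End.eigenspace δ (p : K)) :
    ∃ (s : Finset ℤ) (m : ℤ → ℕ), (∀ p ∈ s, p ∈ S) ∧
      (∀ (p : ℤ) (w : V), w ∈ W → w ≠ 0 → δ w = (p : K) • w → p ∈ s ∧ 0 < m p) ∧
      (finrank K W : K) = ∑ p ∈ s, (m p : K) ∧
      LinearMap.trace K W (δ.restrict hW) = ∑ p ∈ s, (p : K) * m p := by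
  classical
  set N : ℤ → Submodule K V := fun p => W ⊓ End.eigenspace δ (p : K) with hN
  have hinj : Function.Injective (fun p : ℤ => (p : K)) := Int.cast_injective
  have hindE : iSupIndep fun p : ℤ => End.eigenspace δ (p : K) :=
    δ.eigenspaces_iSupIndep.comp hinj
  have hindN : iSupIndep N := hindE.mono fun p => inf_le_right
  have hfin : {p | N p ≠ ⊥}.Finite := WellFoundedGT.finite_ne_bot_of_iSupIndep hindN
  have hδN : ∀ p, Set.MapsTo δ (N p) (N p) := by
    rintro p w ⟨hw, hw'⟩
    refine ⟨hW w hw, ?_⟩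
    have hw' : δ w = (p : K) • w := End.mem_eigenspace_iff.1 hw'
    rw [hw']
    exact Submodule.smul_mem _ _ (End.mem_eigenspace_iff.2 hw')
  -- Components of an element of `W` are in `W`, since `W` is invariant.
  have hsup : W = ⨆ p ∈ hfin.toFinset, N p := by
    refine le_antisymm ?_ (iSup₂_le fun p _ => inf_le_left)
    have h1 : (⨆ p ∈ S, End.eigenspace δ (p : K)) ≤ ⨆ μ, δ.genEigenspace μ 1 :=
      iSup₂_le fun p _ => le_iSup (fun μ => δ.genEigenspace μ 1) (p : K)
    have h2 := Submodule.inf_iSup_genEigenspace (p := W) hW 1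
    have h3 : W ≤ ⨆ μ, W ⊓ δ.genEigenspace μ 1 := by
      rw [← h2]; exact le_inf le_rfl (hS.trans h1)
    refine h3.trans (iSup_le fun μ => ?_)
    by_cases hμ : ∃ p ∈ S, (p : K) = μ
    · obtain ⟨p, -, rfl⟩ := hμ
      by_cases hp : N p = ⊥
      · change N p ≤ _
        rw [hp]; exact bot_le
      · exact le_iSup₂_of_le (f := fun p (_ : p ∈ hfin.toFinset) => N p) p
          (hfin.mem_toFinset.2 hp) le_rfl
    · have hdis : Disjoint (δ.eigenspace μ) (⨆ p ∈ S, End.eigenspace δ (p : K)) := by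
        refine (δ.eigenspaces_iSupIndep μ).mono_right (iSup₂_le fun p hp => ?_)
        exact le_iSup₂_of_le (f := fun j (_ : j ≠ μ) => δ.eigenspace j) (p : K)
          (fun h => hμ ⟨p, hp, h⟩) le_rfl
      have : W ⊓ δ.genEigenspace μ 1 = ⊥ := by
        rw [eq_bot_iff]
        intro w hw
        exact Submodule.disjoint_def.1 hdis w hw.2 (hS hw.1)
      rw [this]; exact bot_le
  have hind' : iSupIndep fun i : hfin.toFinset => N i :=
    hindN.comp Subtype.val_injective
  have htr : ∀ (f : End K V) (c : ℤ → K) (hf : ∀ w ∈ W, f w ∈ W)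
      (_ : ∀ p, ∀ w ∈ N p, f w = c p • w), LinearMap.trace K W (f.restrict hf) =
        ∑ p ∈ hfin.toFinset, c p * finrank K (N p) := by
    intro f c hf hfN
    have hfN' : ∀ p, Set.MapsTo f (N p) (N p) := fun p w hw => by
      rw [hfN p w hw]; exact (N p).smul_mem _ hw
    rw [LinearMap.trace_eq_sum_trace_restrict_of_eq_biSup hfin.toFinset hind' hfN' W hsup hf]
    refine Finset.sum_congr rfl fun p _ => ?_
    have : f.restrict (hfN' p) = c p • LinearMap.id := by
      ext w
      exact hfN p w w.2
    rw [this, map_smul, LinearMap.trace_id, smul_eq_mul]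
  refine ⟨hfin.toFinset, fun p => finrank K (N p), ?_, ?_, ?_, ?_⟩
  · intro p hp
    by_contra hpS
    refine (hfin.mem_toFinset.1 hp) ?_
    have hdis : Disjoint (δ.eigenspace (p : K)) (⨆ p ∈ S, End.eigenspace δ (p : K)) := by
      refine (hindE p).mono_right (iSup₂_le fun q hq => ?_)
      exact le_iSup₂_of_le (f := fun (j : ℤ) (_ : j ≠ p) => δ.eigenspace (j : K)) q
        (fun h => hpS (h ▸ hq)) le_rfl
    rw [eq_bot_iff]
    intro w hw
    exact Submodule.disjoint_def.1 hdis w hw.2 (hS hw.1)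
  · intro p w hw hw0 hδ
    have hwN : w ∈ N p := ⟨hw, End.mem_eigenspace_iff.2 hδ⟩
    have hne : N p ≠ ⊥ := fun h => hw0 (by rw [h] at hwN; exact (Submodule.mem_bot K).1 hwN)
    refine ⟨hfin.mem_toFinset.2 hne, ?_⟩
    have : Nontrivial (N p) := Submodule.nontrivial_iff_ne_bot.2 hne
    exact finrank_pos
  · have := htr LinearMap.id (fun _ => 1) (fun w hw => hw) (fun p w _ => by simp)
    rw [show (LinearMap.id : End K V).restrict (fun w hw => hw) = (LinearMap.id : End K W) from rfl,
      LinearMap.trace_id] at this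
    simpa using this
  · exact htr δ (fun p => (p : K)) hW fun p w hw => End.mem_eigenspace_iff.1 hw.2

/-! ### Elements acting as the degree, and a vanishing criterion -/

theorem ad_lie_eq_mul_sub_mul {K g : Type*} [CommRing K] [LieRing g] [LieAlgebra K g] (x y : g) :
    LieAlgebra.ad K g ⁅x, y⁆ = LieAlgebra.ad K g x * LieAlgebra.ad K g y -
      LieAlgebra.ad K g y * LieAlgebra.ad K g x := by
  ext w
  simp

open Module in
/-- Let `P` and `Q` consist of elements of degrees `1` and `-1` for a derivation `δ`, be dual to
each other for the Killing form and be stable under `⁅P, Q⁆`. Then an element of the span of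
`⁅P, Q⁆` acts on `P` as `1` and on `Q` as `-1`. It represents, on this span, the functional
`z ↦ tr (δ ∘ ad z)`, whose value on `⁅x, y⁆` is the Killing form of `x ∈ P` and `y ∈ Q`. The
functional vanishes on the radical of the span, since the elements `z` of the radical commute with
`P` and so have nilpotent `ad z`. -/
theorem exists_lie_eq_self_and_eq_neg {K g : Type*} [Field K] [CharZero K] [LieRing g]
    [LieAlgebra K g] [FiniteDimensional K g] (hB : (killingForm K g).Nondegenerate)
    (δ : End K g) (hδ : ∀ x y, δ ⁅x, y⁆ = ⁅δ x, y⁆ + ⁅x, δ y⁆) (P Q : Submodule K g)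
    (hP : ∀ x ∈ P, δ x = x) (hQ : ∀ y ∈ Q, δ y = -y)
    (hPP : ∀ x ∈ P, ∀ y ∈ Q, ∀ x' ∈ P, ⁅⁅x, y⁆, x'⁆ ∈ P)
    (hQQ : ∀ x ∈ P, ∀ y ∈ Q, ∀ y' ∈ Q, ⁅⁅x, y⁆, y'⁆ ∈ Q)
    (nP : ∀ x ∈ P, (∀ y ∈ Q, killingForm K g x y = 0) → x = 0)
    (nQ : ∀ y ∈ Q, (∀ x ∈ P, killingForm K g x y = 0) → y = 0) :
    ∃ H ∈ Submodule.span K {z | ∃ x ∈ P, ∃ y ∈ Q, ⁅x, y⁆ = z},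
      (∀ x ∈ P, ⁅H, x⁆ = x) ∧ ∀ y ∈ Q, ⁅H, y⁆ = -y := by
  set B := killingForm K g with hBdef
  have hBs : ∀ x y, B x y = B y x := LieModule.traceForm_comm K g g
  have hBi : ∀ x y z, B ⁅x, y⁆ z = B x ⁅y, z⁆ := LieModule.traceForm_apply_lie_apply K g g
  have hrefl : LinearMap.BilinForm.IsRefl B := fun x y h => by rw [hBs, h]
  set I := Submodule.span K {z | ∃ x ∈ P, ∃ y ∈ Q, ⁅x, y⁆ = z} with hI
  have hIP : ∀ z ∈ I, ∀ x ∈ P, ⁅z, x⁆ ∈ P := by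
    intro z hz x' hx'
    induction hz using Submodule.span_induction with
    | mem _ h => obtain ⟨x, hx, y, hy, rfl⟩ := h; exact hPP x hx y hy x' hx'
    | zero => simp
    | add a b _ _ ha hb => rw [add_lie]; exact P.add_mem ha hb
    | smul c a _ ha => rw [smul_lie]; exact P.smul_mem c ha
  have hIQ : ∀ z ∈ I, ∀ x ∈ Q, ⁅z, x⁆ ∈ Q := by
    intro z hz x' hx'
    induction hz using Submodule.span_induction with
    | mem _ h => obtain ⟨x, hx, y, hy, rfl⟩ := h; exact hQQ x hx y hy x' hx'
    | zero => simp
    | add a b _ _ ha hb => rw [add_lie]; exact Q.add_mem ha hb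
    | smul c a _ ha => rw [smul_lie]; exact Q.smul_mem c ha
  have hI0 : ∀ z ∈ I, δ z = 0 := by
    intro z hz
    induction hz using Submodule.span_induction with
    | mem _ h => obtain ⟨x, hx, y, hy, rfl⟩ := h; rw [hδ, hP x hx, hQ y hy, lie_neg, add_neg_cancel]
    | zero => simp
    | add a b _ _ ha hb => rw [map_add, ha, hb, add_zero]
    | smul c a _ ha => rw [map_smul, ha, smul_zero]
  -- The functional that `H` has to represent on `I`; on `⁅x, y⁆` its value is `B x y`.
  set lam : Dual K g := LinearMap.trace K g ∘ₗ LinearMap.mulLeft K δ ∘ₗ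
    (LieAlgebra.ad K g : g →ₗ[K] End K g) with hlam
  have hlam_apply : ∀ z, lam z = LinearMap.trace K g (δ * LieAlgebra.ad K g z) := fun z => rfl
  have hlam_lie : ∀ x ∈ P, ∀ y ∈ Q, lam ⁅x, y⁆ = B x y := by
    intro x hx y hy
    have h1 : δ * LieAlgebra.ad K g x = LieAlgebra.ad K g x * δ + LieAlgebra.ad K g x := by
      ext w
      simp [hδ x w, hP x hx, add_comm]
    rw [hlam_apply, ad_lie_eq_mul_sub_mul, mul_sub, map_sub, ← mul_assoc, h1, add_mul, map_add,
      ← mul_assoc, LinearMap.trace_mul_comm K (δ * LieAlgebra.ad K g y), ← mul_assoc]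
    rw [add_sub_cancel_left]
    rfl
  have hrad : ∀ z ∈ I, (∀ u ∈ I, B u z = 0) → lam z = 0 := by
    intro z hz hzI
    have hzP : ∀ x ∈ P, ⁅z, x⁆ = 0 := fun x hx => nP _ (hIP z hz x hx) fun y hy => by
      rw [hBi, hBs]; exact hzI _ (Submodule.subset_span ⟨x, hx, y, hy, rfl⟩)
    have hnil : IsNilpotent (LieAlgebra.ad K g z) := by
      refine isNilpotent_of_mem_span_commutators (P := LieAlgebra.ad K g '' (P : Set g))
        (Q := LieAlgebra.ad K g '' (Q : Set g)) ?_ ?_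
      · rintro _ ⟨x, hx, rfl⟩
        exact sub_eq_zero.1 (by rw [← ad_lie_eq_mul_sub_mul, hzP x hx, map_zero])
      · have : I ≤ (Submodule.span K {w | ∃ x ∈ LieAlgebra.ad K g '' (P : Set g),
            ∃ y ∈ LieAlgebra.ad K g '' (Q : Set g), x * y - y * x = w}).comap
            (LieAlgebra.ad K g : g →ₗ[K] End K g) := by
          rw [hI, Submodule.span_le]
          rintro _ ⟨x, hx, y, hy, rfl⟩
          refine Submodule.subset_span ⟨_, ⟨x, hx, rfl⟩, _, ⟨y, hy, rfl⟩, ?_⟩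
          exact (ad_lie_eq_mul_sub_mul x y).symm
        exact this hz
    have hcomm : Commute δ (LieAlgebra.ad K g z) := by
      change δ * _ = _ * δ
      ext w
      simp [hδ, hI0 z hz]
    exact (LinearMap.isNilpotent_trace_of_isNilpotent (hcomm.isNilpotent_mul_left hnil)).eq_zero
  -- `E` represents `lam` on the whole algebra; its component `H` in `I` does so on `I`.
  obtain ⟨E, hE⟩ : ∃ E, ∀ z, B E z = lam z :=
    ⟨(LinearMap.BilinForm.toDual B hB).symm lam, fun z =>
      LinearMap.BilinForm.apply_toDual_symm_apply (hB := hB) lam z⟩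
  have hEmem : E ∈ I ⊔ LinearMap.BilinForm.orthogonal B I := by
    rw [← LinearMap.BilinForm.orthogonal_orthogonal hB hrefl
      (I ⊔ LinearMap.BilinForm.orthogonal B I)]
    intro z hz
    have hz1 : z ∈ LinearMap.BilinForm.orthogonal B I :=
      fun u hu => hz u (Submodule.mem_sup_left hu)
    have hz2 : z ∈ I := by
      rw [← LinearMap.BilinForm.orthogonal_orthogonal hB hrefl I]
      exact fun u hu => hz u (Submodule.mem_sup_right hu)
    change B z E = 0
    rw [hBs, hE]
    exact hrad z hz2 hz1
  obtain ⟨H, hH, w, hw, hHw⟩ := Submodule.mem_sup.1 hEmem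
  have hHB : ∀ x ∈ P, ∀ y ∈ Q, B H ⁅x, y⁆ = B x y := by
    intro x hx y hy
    have h1 := hE ⁅x, y⁆
    have h2 : B w ⁅x, y⁆ = 0 := by
      rw [hBs]; exact hw _ (Submodule.subset_span ⟨x, hx, y, hy, rfl⟩)
    rw [← hHw, hlam_lie x hx y hy, map_add, LinearMap.add_apply, h2, add_zero] at h1
    exact h1
  refine ⟨H, hH, fun x hx => ?_, fun y hy => ?_⟩
  · refine sub_eq_zero.1 (nP _ (P.sub_mem (hIP H hH x hx) hx) fun y hy => ?_)
    rw [map_sub, LinearMap.sub_apply, hBi, hHB x hx y hy, sub_self]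
  · rw [← add_eq_zero_iff_eq_neg]
    refine nQ _ (Q.add_mem (hIQ H hH y hy) hy) fun x hx => ?_
    have h1 : B x ⁅H, y⁆ = - B H ⁅x, y⁆ := by
      rw [← hBi, ← lie_skew, map_neg, LinearMap.neg_apply, hBi]
    rw [map_add, h1, hHB x hx y hy, neg_add_cancel]

open Module in
theorem trace_restrict_of_eq_sup {K V : Type*} [Field K] [AddCommGroup V] [Module K V]
    [FiniteDimensional K V] (f : End K V) {A B U : Submodule K V} (hAB : Disjoint A B)
    (hU : U = A ⊔ B) (hA : ∀ v ∈ A, f v ∈ A) (hB : ∀ v ∈ B, f v ∈ B) (hfU : ∀ v ∈ U, f v ∈ U) :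
    LinearMap.trace K U (f.restrict hfU) =
      LinearMap.trace K A (f.restrict hA) + LinearMap.trace K B (f.restrict hB) := by
  have hN : ∀ b : Bool, Set.MapsTo f (cond b A B : Submodule K V) (cond b A B : Submodule K V) := by
    rintro (_ | _)
    exacts [hB, hA]
  have hind : iSupIndep fun b : (Finset.univ : Finset Bool) => (cond b A B : Submodule K V) := by
    have h : iSupIndep fun b : Bool => (cond b A B : Submodule K V) := by
      rw [iSupIndep_pair (i := true) (j := false) (by simp) (by simp)]
      exact hAB
    exact h.comp Subtype.val_injective
  have hsup : U = ⨆ b ∈ (Finset.univ : Finset Bool), (cond b A B : Submodule K V) := by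
    simp [hU, iSup_bool_eq]
  have := LinearMap.trace_eq_sum_trace_restrict_of_eq_biSup Finset.univ hind hN U hsup hfU
  rw [this, Fintype.sum_bool]
  rfl

open Module in
/-- A positivity argument for operators `δ` (with integral eigenvalues) and `F` that have the same
trace on every common invariant subspace that is stable under `P`. On the generalized eigenspace
`U` of `F` for `φ`, the average of the eigenvalues of `δ` is `φ`; the same holds on the stable
subspace `N ⊓ U`, hence on its complement `C ⊓ U`. If `a ∈ C ⊓ U` has degree `d` and `x a ≠ 0`, then
the average over `C ⊓ U` is at most `d`, and that over `N ⊓ U` exceeds `d`, because `x a` has degree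
`d + 1`. -/
theorem apply_eq_zero_of_trace_restrict_eq_zero {V : Type*} [AddCommGroup V] [Module ℂ V]
    [FiniteDimensional ℂ V] (δ F : End ℂ V) (P : Set (End ℂ V)) (N C : Submodule ℂ V) (d : ℤ)
    (hNC : IsCompl N C) (hδN : ∀ v ∈ N, δ v ∈ N) (hδC : ∀ v ∈ C, δ v ∈ C)
    (hFN : ∀ v ∈ N, F v ∈ N) (hFC : ∀ v ∈ C, F v ∈ C) (hFδ : Commute F δ)
    (hN : N ≤ ⨆ p ∈ Set.Ici d, End.eigenspace δ ((p : ℤ) : ℂ))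
    (hC : C ≤ ⨆ p ∈ Set.Iic d, End.eigenspace δ ((p : ℤ) : ℂ))
    (hPF : ∀ x ∈ P, Commute F x) (hPN : ∀ x ∈ P, ∀ v ∈ N, x v ∈ N)
    (htr : ∀ (W : Submodule ℂ V) (hδW : ∀ v ∈ W, δ v ∈ W) (hFW : ∀ v ∈ W, F v ∈ W),
      (∀ x ∈ P, ∀ v ∈ W, x v ∈ W) →
      LinearMap.trace ℂ W (δ.restrict hδW) = LinearMap.trace ℂ W (F.restrict hFW))
    {x : End ℂ V} (hx : x ∈ P)
    (hxδ : ∀ v, δ v = (d : ℂ) • v → δ (x v) = ((d + 1 : ℤ) : ℂ) • x v)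
    {a : V} (haC : a ∈ C) (haδ : δ a = (d : ℂ) • a) : x a = 0 := by
  have hxN : ∀ v, δ v = (d : ℂ) • v → x v ∈ N := by
    intro v hv
    obtain ⟨n, hn, c, hc, hnc⟩ :=
      Submodule.mem_sup.1 (hNC.sup_eq_top ▸ Submodule.mem_top (x := x v))
    have h1 : (δ n - ((d + 1 : ℤ) : ℂ) • n) + (δ c - ((d + 1 : ℤ) : ℂ) • c) = 0 := by
      have := hxδ v hv
      rw [← hnc, map_add, smul_add, ← sub_eq_zero] at this
      rw [← this]; abel
    have h2 : δ c - ((d + 1 : ℤ) : ℂ) • c = 0 := by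
      refine Submodule.disjoint_def.1 hNC.disjoint _ ?_
        (C.sub_mem (hδC c hc) (C.smul_mem _ hc))
      rw [eq_neg_of_add_eq_zero_right h1]
      exact N.neg_mem (N.sub_mem (hδN n hn) (N.smul_mem _ hn))
    have hdis : Disjoint (δ.eigenspace ((d + 1 : ℤ) : ℂ))
        (⨆ p ∈ Set.Iic d, End.eigenspace δ ((p : ℤ) : ℂ)) := by
      refine (δ.eigenspaces_iSupIndep _).mono_right (iSup₂_le fun p hp => ?_)
      refine le_iSup₂_of_le (f := fun j (_ : j ≠ ((d + 1 : ℤ) : ℂ)) => δ.eigenspace j) (p : ℂ)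
        (fun h => ?_) le_rfl
      have h' : p ≤ d := hp
      rw [Int.cast_inj] at h
      omega
    have h3 : c = 0 := Submodule.disjoint_def.1 hdis c
      (End.mem_eigenspace_iff.2 (sub_eq_zero.1 h2)) (hC hc)
    rw [← hnc, h3, add_zero]
    exact hn
  -- It suffices to consider generalized eigenvectors of `F`.
  set A := C ⊓ End.eigenspace δ ((d : ℤ) : ℂ) with hA
  have hFA : ∀ v ∈ A, F v ∈ A := by
    rintro v ⟨hv, hv'⟩
    exact ⟨hFC v hv, End.mapsTo_genEigenspace_of_comm hFδ.symm _ _ hv'⟩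
  suffices h : ∀ φ : ℂ, A ⊓ F.genEigenspace φ ⊤ ≤ LinearMap.ker x by
    have h1 : A ≤ LinearMap.ker x := by
      rw [Submodule.eq_iSup_inf_genEigenspace ⊤ hFA (End.iSup_maxGenEigenspace_eq_top F)]
      exact iSup_le h
    exact h1 ⟨haC, End.mem_eigenspace_iff.2 haδ⟩
  clear haC haδ a
  rintro φ a ⟨⟨haC, haδ⟩, haφ⟩
  have haδ : δ a = (d : ℂ) • a := End.mem_eigenspace_iff.1 haδ
  rw [LinearMap.mem_ker]
  by_contra hxa
  set U := F.genEigenspace φ ⊤ with hU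
  have hUF : ∀ {g : End ℂ V}, Commute F g → ∀ v ∈ U, g v ∈ U := fun h v hv =>
    End.mapsTo_genEigenspace_of_comm h _ _ hv
  have hUδ := hUF hFδ
  have hUFF := hUF (Commute.refl F)
  have htrF : ∀ (W : Submodule ℂ V) (hFW : ∀ v ∈ W, F v ∈ W), W ≤ U →
      LinearMap.trace ℂ W (F.restrict hFW) = φ * finrank ℂ W := by
    intro W hFW hWU
    have hW' : ∀ v ∈ W, (F - algebraMap ℂ (End ℂ V) φ) v ∈ W := fun v hv =>
      W.sub_mem (hFW v hv) (W.smul_mem φ hv)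
    have hnil : IsNilpotent (F.restrict hFW - algebraMap ℂ (End ℂ W) φ) :=
      End.isNilpotent_restrict_of_le (hp := hW') hWU
        (End.isNilpotent_restrict_maxGenEigenspace_sub_algebraMap F φ)
    have h0 := (LinearMap.isNilpotent_trace_of_isNilpotent hnil).eq_zero
    rw [map_sub, sub_eq_zero] at h0
    rw [h0, Algebra.algebraMap_eq_smul_one, map_smul, LinearMap.trace_one, smul_eq_mul]
  have hUP : ∀ x ∈ P, ∀ v ∈ U, x v ∈ U := fun x hx => hUF (hPF x hx)
  have hNδ : ∀ v ∈ N ⊓ U, δ v ∈ N ⊓ U := fun v hv => ⟨hδN v hv.1, hUδ v hv.2⟩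
  have hNF : ∀ v ∈ N ⊓ U, F v ∈ N ⊓ U := fun v hv => ⟨hFN v hv.1, hUFF v hv.2⟩
  have hCδ : ∀ v ∈ C ⊓ U, δ v ∈ C ⊓ U := fun v hv => ⟨hδC v hv.1, hUδ v hv.2⟩
  have hCF : ∀ v ∈ C ⊓ U, F v ∈ C ⊓ U := fun v hv => ⟨hFC v hv.1, hUFF v hv.2⟩
  have hsplit : U = (N ⊓ U) ⊔ (C ⊓ U) := by
    refine le_antisymm (fun v hv => ?_) (sup_le inf_le_right inf_le_right)
    obtain ⟨n, hn, c, hc, rfl⟩ := Submodule.mem_sup.1 (hNC.sup_eq_top ▸ Submodule.mem_top (x := v))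
    obtain ⟨k, hk⟩ := End.mem_maxGenEigenspace F φ _ |>.1 hv
    have hst : ∀ (W : Submodule ℂ V), (∀ v ∈ W, F v ∈ W) → ∀ j : ℕ, ∀ v ∈ W,
        ((F - φ • (1 : End ℂ V)) ^ j) v ∈ W := by
      intro W hW j
      induction j with
      | zero => intro v hv; simpa using hv
      | succ j ih =>
        intro v hv
        rw [pow_succ, Module.End.mul_apply]
        exact ih _ (W.sub_mem (hW v hv) (W.smul_mem φ hv))
    rw [map_add] at hk
    have hn0 : ((F - φ • (1 : End ℂ V)) ^ k) n = 0 := by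
      refine Submodule.disjoint_def.1 hNC.disjoint _ (hst N hFN k n hn) ?_
      rw [eq_neg_of_add_eq_zero_left hk]
      exact C.neg_mem (hst C hFC k c hc)
    rw [hn0, zero_add] at hk
    exact Submodule.add_mem_sup ⟨hn, End.mem_maxGenEigenspace F φ _ |>.2 ⟨k, hn0⟩⟩
      ⟨hc, End.mem_maxGenEigenspace F φ _ |>.2 ⟨k, hk⟩⟩
  have hdisj : Disjoint (N ⊓ U) (C ⊓ U) := hNC.disjoint.mono inf_le_left inf_le_left
  have trN : LinearMap.trace ℂ _ (δ.restrict hNδ) = φ * finrank ℂ ↥(N ⊓ U) := by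
    rw [htr (N ⊓ U) hNδ hNF fun x hx v hv => ⟨hPN x hx v hv.1, hUP x hx v hv.2⟩]
    exact htrF _ hNF inf_le_right
  have trC : LinearMap.trace ℂ _ (δ.restrict hCδ) = φ * finrank ℂ ↥(C ⊓ U) := by
    have h1 := trace_restrict_of_eq_sup δ hdisj hsplit hNδ hCδ hUδ
    have h2 := trace_restrict_of_eq_sup F hdisj hsplit hNF hCF hUFF
    rw [htr U hUδ hUFF hUP, h2, trN, htrF _ hNF inf_le_right] at h1
    rw [← add_left_cancel h1, htrF _ hCF inf_le_right]
  have haU : a ∈ C ⊓ U := ⟨haC, haφ⟩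
  have ha0 : a ≠ 0 := fun h => hxa (by rw [h, map_zero])
  obtain ⟨s, m, hs, hs', hfr, htrs⟩ :=
    exists_trace_restrict_eq_sum δ (Set.Iic d) _ hCδ (inf_le_left.trans hC)
  obtain ⟨t, n, ht, ht', hfrt, htrt⟩ :=
    exists_trace_restrict_eq_sum δ (Set.Ici d) _ hNδ (inf_le_left.trans hN)
  have hs1 := hs' d a haU ha0 haδ
  have ht1 := ht' (d + 1) (x a) ⟨hxN a haδ, hUP x hx a haφ⟩ hxa (hxδ a haδ)
  rw [trC, hfr] at htrs
  rw [trN, hfrt] at htrt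
  have hre1 : φ.re * ∑ p ∈ s, (m p : ℝ) = ∑ p ∈ s, (p : ℝ) * m p := by
    have := congrArg Complex.re htrs
    have e1 : (∑ p ∈ s, (m p : ℂ)) = ((∑ p ∈ s, (m p : ℝ) : ℝ) : ℂ) := by push_cast; rfl
    have e2 : (∑ p ∈ s, (p : ℂ) * m p) = ((∑ p ∈ s, (p : ℝ) * m p : ℝ) : ℂ) := by push_cast; rfl
    rw [e1, e2, Complex.re_mul_ofReal, Complex.ofReal_re] at this
    exact this
  have hre2 : φ.re * ∑ p ∈ t, (n p : ℝ) = ∑ p ∈ t, (p : ℝ) * n p := by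
    have := congrArg Complex.re htrt
    have e1 : (∑ p ∈ t, (n p : ℂ)) = ((∑ p ∈ t, (n p : ℝ) : ℝ) : ℂ) := by push_cast; rfl
    have e2 : (∑ p ∈ t, (p : ℂ) * n p) = ((∑ p ∈ t, (p : ℝ) * n p : ℝ) : ℂ) := by push_cast; rfl
    rw [e1, e2, Complex.re_mul_ofReal, Complex.ofReal_re] at this
    exact this
  have hle : φ.re ≤ d := by
    have hpos : 0 < ∑ p ∈ s, (m p : ℝ) :=
      Finset.sum_pos' (fun _ _ => Nat.cast_nonneg _) ⟨d, hs1.1, by exact_mod_cast hs1.2⟩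
    refine le_of_mul_le_mul_right ?_ hpos
    rw [hre1, Finset.mul_sum]
    refine Finset.sum_le_sum fun p hp => mul_le_mul_of_nonneg_right ?_ (Nat.cast_nonneg _)
    exact_mod_cast hs p hp
  have hlt : (d : ℝ) < φ.re := by
    have hpos : 0 < ∑ p ∈ t, (n p : ℝ) :=
      Finset.sum_pos' (fun _ _ => Nat.cast_nonneg _) ⟨d + 1, ht1.1, by exact_mod_cast ht1.2⟩
    refine lt_of_mul_lt_mul_right ?_ hpos.le
    rw [hre2, Finset.mul_sum]
    refine Finset.sum_lt_sum (fun p hp => mul_le_mul_of_nonneg_right ?_ (Nat.cast_nonneg _))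
      ⟨d + 1, ht1.1, mul_lt_mul_of_pos_right ?_ ?_⟩
    · exact_mod_cast ht p hp
    · push_cast; linarith
    · exact_mod_cast ht1.2
  exact absurd hlt (not_lt.2 hle)

/-! ### Graded vector spaces and the Killing form of a graded Lie algebra -/

section Graded

variable {M M' : Type*} [AddCommGroup M] [Module ℝ M] [AddCommGroup M'] [Module ℝ M']
  {deg : ℤ → Submodule ℝ M}

theorem DirectSum.IsInternal.linearMap_ext (h : DirectSum.IsInternal deg) {f g : M →ₗ[ℝ] M'}
    (hfg : ∀ p, ∀ x ∈ deg p, f x = g x) : f = g := by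
  have hle : ⨆ p, deg p ≤ LinearMap.eqLocus f g := iSup_le hfg
  rw [h.submodule_iSup_eq_top] at hle
  exact LinearMap.ext fun x => hle Submodule.mem_top

theorem DirectSum.IsInternal.exists_linearMap (h : DirectSum.IsInternal deg)
    (f : ∀ p, deg p →ₗ[ℝ] M') : ∃ g : M →ₗ[ℝ] M', ∀ p (x : deg p), g x = f p x := by
  classical
  let e := LinearEquiv.ofBijective (DirectSum.coeLinearMap deg) h
  refine ⟨DirectSum.toModule ℝ ℤ M' f ∘ₗ e.symm, fun p x => ?_⟩
  have hx : e.symm x = DirectSum.lof ℝ ℤ (fun p => deg p) p x := by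
    rw [LinearEquiv.symm_apply_eq]
    exact (DirectSum.coeLinearMap_lof deg p x).symm
  rw [LinearMap.comp_apply, LinearEquiv.coe_coe, hx, DirectSum.toModule_lof]

/-- An operator acting by a scalar in each degree. -/
theorem DirectSum.IsInternal.exists_linearMap_eq_smul (h : DirectSum.IsInternal deg) (c : ℤ → ℝ) :
    ∃ g : M →ₗ[ℝ] M, ∀ p, ∀ x ∈ deg p, g x = c p • x := by
  obtain ⟨g, hg⟩ := h.exists_linearMap fun p => c p • (deg p).subtype
  exact ⟨g, fun p x hx => hg p ⟨x, hx⟩⟩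

theorem DirectSum.IsInternal.exists_proj (h : DirectSum.IsInternal deg) (p : ℤ) :
    ∃ π : M →ₗ[ℝ] M, (∀ x, π x ∈ deg p) ∧ (∀ x ∈ deg p, π x = x) ∧
      ∀ q, q ≠ p → ∀ x ∈ deg q, π x = 0 := by
  obtain ⟨π, hπ⟩ := h.exists_linearMap_eq_smul fun q => if q = p then 1 else 0
  refine ⟨π, fun x => ?_, fun x hx => by simp [hπ p x hx], fun q hq x hx => by simp [hπ q x hx, hq]⟩
  have hle : ⨆ q, deg q ≤ (deg p).comap π := iSup_le fun q x hx => by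
    rw [Submodule.mem_comap, hπ q x hx]
    split_ifs with hq
    · rw [one_smul]; exact hq ▸ hx
    · rw [zero_smul]; exact Submodule.zero_mem _
  rw [h.submodule_iSup_eq_top] at hle
  exact hle Submodule.mem_top

/-- A linear map defined on one degree extends by zero to the other ones. -/
theorem DirectSum.IsInternal.exists_extend (h : DirectSum.IsInternal deg) (p : ℤ)
    (f : deg p →ₗ[ℝ] M') : ∃ g : M →ₗ[ℝ] M', (∀ x : deg p, g x = f x) ∧
      ∀ q, q ≠ p → ∀ x ∈ deg q, g x = 0 := by
  obtain ⟨π, hπ, hπp, hπq⟩ := h.exists_proj p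
  refine ⟨f ∘ₗ π.codRestrict (deg p) hπ, fun x => ?_, fun q hq x hx => ?_⟩
  · have : π.codRestrict (deg p) hπ x = x := Subtype.ext (hπp x x.2)
    rw [LinearMap.comp_apply, this]
  · have : π.codRestrict (deg p) hπ x = 0 := Subtype.ext (hπq q hq x hx)
    rw [LinearMap.comp_apply, this, map_zero]

end Graded

namespace LieGrading

variable {L : Type*} [LieRing L] [LieAlgebra ℝ L] [FiniteDimensional ℝ L]

theorem killingForm_eq_zero (S : LieGrading L) {p q : ℤ} (hpq : p + q ≠ 0) {x y : L}
    (hx : x ∈ S.deg p) (hy : y ∈ S.deg q) : killingForm ℝ L x y = 0 := by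
  rw [killingForm_apply_apply]
  refine LinearMap.trace_eq_zero_of_mapsTo_ne S.isInternal (fun r => p + (q + r))
    (fun r hr => ?_) ?_
  · apply hpq; omega
  · intro r z hz
    exact S.lie_mem hx (S.lie_mem hy hz)

theorem eq_zero_of_killingForm_eq_zero {L : Type*} [LieRing L] [LieAlgebra ℝ L]
    [LieAlgebra.IsKilling ℝ L] {x : L} (h : ∀ y, killingForm ℝ L x y = 0) : x = 0 :=
  (LieAlgebra.IsKilling.killingForm_nondegenerate ℝ L).1 x h

variable [LieAlgebra.IsKilling ℝ L]

theorem eq_zero_of_forall_killingForm (S : LieGrading L) {p q : ℤ} (hpq : p + q = 0) {x : L}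
    (hx : x ∈ S.deg p) (h : ∀ y ∈ S.deg q, killingForm ℝ L x y = 0) : x = 0 := by
  have h0 : killingForm ℝ L x = 0 := S.isInternal.linearMap_ext fun r y hy => by
    by_cases hr : p + r = 0
    · obtain rfl : r = q := by omega
      exact h y hy
    · exact S.killingForm_eq_zero hr hx hy
  exact eq_zero_of_killingForm_eq_zero fun y => by rw [h0, LinearMap.zero_apply]

theorem mem_deg_of_killingForm_eq_zero (S : LieGrading L) {p q : ℤ} (hpq : p + q = 0) {x : L}
    (h : ∀ r, r ≠ q → ∀ y ∈ S.deg r, killingForm ℝ L x y = 0) : x ∈ S.deg p := by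
  obtain ⟨π, hπ, hπp, hπq⟩ := S.isInternal.exists_proj p
  suffices hx : x - π x = 0 by rw [sub_eq_zero.1 hx]; exact hπ x
  have h0 : killingForm ℝ L (x - π x) = 0 := S.isInternal.linearMap_ext fun r y hy => by
    rw [LinearMap.zero_apply]
    by_cases hr : r = q
    · subst hr
      have h1 : (killingForm ℝ L).flip y ∘ₗ (LinearMap.id - π) = 0 :=
        S.isInternal.linearMap_ext fun t z hz => by
          by_cases ht : t = p
          · subst ht; simp [hπp z hz]
          · have : t + r ≠ 0 := by omega
            simp [hπq t ht z hz, S.killingForm_eq_zero this hz hy]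
      simpa using LinearMap.congr_fun h1 x
    · have : p + r ≠ 0 := by omega
      rw [map_sub, LinearMap.sub_apply, h r hr y hy, S.killingForm_eq_zero this (hπ x) hy, sub_zero]
  exact eq_zero_of_killingForm_eq_zero fun y => by rw [h0, LinearMap.zero_apply]

end LieGrading

/-- The operators multiplying by the degree are compatible with the action. -/
theorem ModuleGrading.degree_lie {L : Type*} [LieRing L] [LieAlgebra ℝ L] {S : LieGrading L}
    {M : Type*} [AddCommGroup M] [Module ℝ M] [LieRingModule L M] [LieModule ℝ L M]
    (Γ : ModuleGrading S M) {δ : Module.End ℝ L} {ε : Module.End ℝ M}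
    (hδ : ∀ p, ∀ x ∈ S.deg p, δ x = (p : ℝ) • x) (hε : ∀ p, ∀ y ∈ Γ.deg p, ε y = (p : ℝ) • y)
    (x : L) (y : M) : ε ⁅x, y⁆ = ⁅δ x, y⁆ + ⁅x, ε y⁆ := by
  let ρ : L →ₗ[ℝ] M →ₗ[ℝ] M := LieModule.toEnd ℝ L M
  have h : ρ.compr₂ ε = ρ ∘ₗ δ + ρ.compl₂ ε :=
    S.isInternal.linearMap_ext fun p x hx => Γ.isInternal.linearMap_ext fun q y hy => by
      change ε ⁅x, y⁆ = ⁅δ x, y⁆ + ⁅x, ε y⁆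
      rw [hε _ _ (Γ.lie_mem hx hy), hδ p x hx, hε q y hy, smul_lie, lie_smul, ← add_smul]
      push_cast
      rfl
  exact LinearMap.congr_fun (LinearMap.congr_fun h x) y

/-- The conditions on a complex structure `J` of `M₋₁` for `L ⊕ M` to be a graded `CR` algebra,
where `K` is the complex structure of `L₋₁`, apart from those that concern `L` alone; the latter are
the case `M = L` and `J = K`. The operator `J` is extended to `M` by zero in
the other degrees. -/
structure ModuleGrading.IsCRPair {L : Type*} [LieRing L] [LieAlgebra ℝ L] {S : LieGrading L}
    {M : Type*} [AddCommGroup M] [Module ℝ M] [LieRingModule L M] [LieModule ℝ L M]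
    (Γ : ModuleGrading S M) (K : Module.End ℝ L) (J : Module.End ℝ M) : Prop where
  mem : ∀ y ∈ Γ.deg (-1), J y ∈ Γ.deg (-1)
  sq : ∀ y ∈ Γ.deg (-1), J (J y) = -y
  map_eq_zero : ∀ p, p ≠ -1 → ∀ y ∈ Γ.deg p, J y = 0
  lie_map_map : ∀ x ∈ S.deg (-1), ∀ y ∈ Γ.deg (-1), ⁅K x, J y⁆ = ⁅x, y⁆
  map_lie : ∀ a ∈ S.deg 0, ∀ y ∈ Γ.deg (-1), J ⁅a, y⁆ = ⁅a, J y⁆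
  map_lie_zero : ∀ x ∈ S.deg (-1), ∀ w ∈ Γ.deg 0, J ⁅x, w⁆ = ⁅K x, w⁆

/-- `D` acts on `L₁` as the contragredient, with respect to the Killing form, of the complex
structure `K` of `L₋₁`. -/
structure LieGrading.IsContragredient {L : Type*} [LieRing L] [LieAlgebra ℝ L] (S : LieGrading L)
    (K D : Module.End ℝ L) : Prop where
  mem : ∀ x ∈ S.deg 1, D x ∈ S.deg 1
  sq : ∀ x ∈ S.deg 1, D (D x) = -x
  map_lie : ∀ a ∈ S.deg 0, ∀ x ∈ S.deg 1, D ⁅a, x⁆ = ⁅a, D x⁆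
  lie_left : ∀ x ∈ S.deg 1, ∀ y ∈ S.deg (-1), ⁅D x, y⁆ = -⁅x, K y⁆
  killingForm_left : ∀ x y, killingForm ℝ L (D x) y = -killingForm ℝ L x (K y)

namespace LieGrading

variable {L : Type*} [LieRing L] [LieAlgebra ℝ L] [FiniteDimensional ℝ L]
  [LieAlgebra.IsKilling ℝ L]

/-- The contragredient is minus the adjoint of `K` with respect to the Killing form, under which
`L₁` and `L₋₁` are dual; the invariance of the form turns the conditions on `K` into those on it. -/
theorem exists_isContragredient (S : LieGrading L) {K : Module.End ℝ L}
    (hK : S.adjoint.IsCRPair K K) : ∃ D : Module.End ℝ L, S.IsContragredient K D := by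
  set B := killingForm ℝ L with hBdef
  have hBs : ∀ x y, B x y = B y x := LieModule.traceForm_comm ℝ L L
  have hBi : ∀ x y z, B ⁅x, y⁆ z = B x ⁅y, z⁆ := LieModule.traceForm_apply_lie_apply ℝ L L
  have hB := LieAlgebra.IsKilling.killingForm_nondegenerate ℝ L
  obtain ⟨D, hD⟩ : ∃ D : Module.End ℝ L, ∀ x y, B (D x) y = -B x (K y) := by
    refine ⟨-LinearMap.BilinForm.leftAdjointOfNondegenerate B hB K, fun x y => ?_⟩
    have := LinearMap.BilinForm.isAdjointPairLeftAdjointOfNondegenerate B hB K x y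
    rw [LinearMap.neg_apply, map_neg, LinearMap.neg_apply, this]
  have hmem : ∀ x ∈ S.deg 1, D x ∈ S.deg 1 := fun x hx =>
    S.mem_deg_of_killingForm_eq_zero (p := 1) (q := -1) (by norm_num) fun r hr y hy => by
      rw [← hBdef, hD, hK.map_eq_zero r hr y hy, map_zero, neg_zero]
  refine ⟨D, hmem, fun x hx => ?_, fun a ha x hx => ?_, fun x hx y hy => ?_, hD⟩
  · refine add_eq_zero_iff_eq_neg.1 (S.eq_zero_of_forall_killingForm (p := 1) (q := -1)
      (by norm_num) (Submodule.add_mem _ (hmem _ (hmem x hx)) hx) fun y hy => ?_)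
    rw [← hBdef, map_add, LinearMap.add_apply, hD, hD, hK.sq y hy, map_neg]
    ring
  · have hax : ⁅a, x⁆ ∈ S.deg 1 := by simpa using S.lie_mem ha hx
    have haD : ⁅a, D x⁆ ∈ S.deg 1 := by simpa using S.lie_mem ha (hmem x hx)
    refine sub_eq_zero.1 (S.eq_zero_of_forall_killingForm (p := 1) (q := -1) (by norm_num)
      (Submodule.sub_mem _ (hmem _ hax) haD) fun y hy => ?_)
    have e1 : B ⁅a, D x⁆ y = -B (D x) ⁅a, y⁆ := by
      rw [← lie_skew, map_neg, LinearMap.neg_apply, hBi]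
    have e2 : B ⁅a, x⁆ (K y) = -B x ⁅a, K y⁆ := by
      rw [← lie_skew, map_neg, LinearMap.neg_apply, hBi]
    have h1 : K ⁅a, y⁆ = ⁅a, K y⁆ := hK.map_lie a ha y hy
    rw [← hBdef, map_sub, LinearMap.sub_apply, hD, e1, e2, hD, h1]
    ring
  · refine add_eq_zero_iff_eq_neg.1 (S.eq_zero_of_forall_killingForm (p := 0) (q := 0) rfl
      (Submodule.add_mem _ ?_ ?_) fun a ha => ?_)
    · exact S.lie_mem (hmem x hx) hy
    · exact S.lie_mem hx (hK.mem y hy)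
    · have h1 : K ⁅y, a⁆ = ⁅K y, a⁆ := by
        have := hK.map_lie a ha y hy
        rw [← lie_skew, map_neg, this, lie_skew]
      rw [← hBdef, map_add, LinearMap.add_apply, hBi, hBi, hD, h1]
      ring

end LieGrading

/-! ### Types in the complexification -/

section

open TensorProduct Complex

section Complexification

variable {M : Type*} [AddCommGroup M] [Module ℝ M]

theorem complex_tmul_eq (c : ℂ) (u : M) :
    c ⊗ₜ[ℝ] u = c.re • ((1 : ℂ) ⊗ₜ[ℝ] u) + c.im • (I ⊗ₜ[ℝ] u) := by
  rw [smul_tmul', smul_tmul', ← add_tmul]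
  congr 1
  apply Complex.ext <;> simp

theorem eq_zero_of_one_tmul_add_I_tmul {a b : M}
    (h : (1 : ℂ) ⊗ₜ[ℝ] a + I ⊗ₜ[ℝ] b = 0) : a = 0 ∧ b = 0 := by
  have h1 := congrArg (TensorProduct.lid ℝ M ∘ LinearMap.rTensor M Complex.reLm) h
  have h2 := congrArg (TensorProduct.lid ℝ M ∘ LinearMap.rTensor M Complex.imLm) h
  simp at h1 h2
  exact ⟨h1, h2⟩

/-- The subspace `{u - i K u}` of the complexification of `U`, on which `K` acts as `i`, for a
complex structure `K` on `U`. -/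
def typeSubmodule (U : Submodule ℝ M) (K : Module.End ℝ M) (hK : ∀ u ∈ U, K u ∈ U)
    (hK' : ∀ u ∈ U, K (K u) = -u) : Submodule ℂ (ℂ ⊗[ℝ] M) where
  carrier := {z | ∃ u ∈ U, z = (1 : ℂ) ⊗ₜ[ℝ] u - I ⊗ₜ[ℝ] (K u)}
  zero_mem' := ⟨0, U.zero_mem, by simp⟩
  add_mem' := by
    rintro _ _ ⟨u, hu, rfl⟩ ⟨v, hv, rfl⟩
    exact ⟨u + v, U.add_mem hu hv, by rw [map_add, tmul_add, tmul_add]; abel⟩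
  smul_mem' := by
    rintro c _ ⟨u, hu, rfl⟩
    refine ⟨c.re • u + c.im • K u, U.add_mem (U.smul_mem _ hu) (U.smul_mem _ (hK u hu)), ?_⟩
    rw [smul_sub, smul_tmul', smul_tmul', smul_eq_mul, smul_eq_mul, mul_one, complex_tmul_eq c u,
      complex_tmul_eq (c * I) (K u), map_add, map_smul, map_smul, hK' u hu]
    simp only [tmul_add, tmul_smul, tmul_neg, mul_re, mul_im, I_re, I_im]
    module

/-- The subspace `{u + i K u}` of the complexification of `U`, on which `K` acts as `-i`, for a
complex structure `K` on `U`. -/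
def antitypeSubmodule (U : Submodule ℝ M) (K : Module.End ℝ M) (hK : ∀ u ∈ U, K u ∈ U)
    (hK' : ∀ u ∈ U, K (K u) = -u) : Submodule ℂ (ℂ ⊗[ℝ] M) :=
  typeSubmodule U (-K) (fun u hu => U.neg_mem (hK u hu)) fun u hu => by simp [hK' u hu]

end Complexification

variable {L : Type*} [LieRing L] [LieAlgebra ℝ L]

/-- The Killing form of the complexification is the complexification of the Killing form. -/
theorem killingForm_complexification_nondegenerate [FiniteDimensional ℝ L]
    [LieAlgebra.IsKilling ℝ L] : (killingForm ℂ (ℂ ⊗[ℝ] L)).Nondegenerate := by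
  refine (LieModule.traceForm_isSymm ℂ _ _).isRefl.nondegenerate_iff_separatingLeft.mpr ?_
  have hz : ∀ z : ℂ ⊗[ℝ] L, ∃ a b : L, z = (1 : ℂ) ⊗ₜ[ℝ] a + I ⊗ₜ[ℝ] b := by
    intro z
    induction z with
    | zero => exact ⟨0, 0, by simp⟩
    | tmul c x => exact ⟨c.re • x, c.im • x, by rw [complex_tmul_eq, tmul_smul, tmul_smul]⟩
    | add z w hz hw =>
      obtain ⟨a, b, rfl⟩ := hz
      obtain ⟨c, d, rfl⟩ := hw
      exact ⟨a + c, b + d, by rw [tmul_add, tmul_add]; abel⟩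
  intro z h
  obtain ⟨a, b, rfl⟩ := hz z
  have key : ∀ y, killingForm ℝ L a y = 0 ∧ killingForm ℝ L b y = 0 := by
    intro y
    have h1 := h (1 ⊗ₜ y)
    change LieModule.traceForm ℂ (ℂ ⊗[ℝ] L) (ℂ ⊗[ℝ] L) _ _ = 0 at h1
    rw [LieModule.traceForm_baseChange] at h1
    have h2 := congrArg Complex.re h1
    have h3 := congrArg Complex.im h1
    simp at h2 h3
    exact ⟨h2, h3⟩
  rw [LieGrading.eq_zero_of_killingForm_eq_zero fun y => (key y).1,
    LieGrading.eq_zero_of_killingForm_eq_zero fun y => (key y).2]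
  simp

variable {M : Type*} [AddCommGroup M] [Module ℝ M] [LieRingModule L M] [LieModule ℝ L M]

/-- The complexifications of operators compatible with the action are compatible with it. -/
theorem baseChange_derivation {δ : Module.End ℝ L} {ε : Module.End ℝ M}
    (h : ∀ x y, ε ⁅x, y⁆ = ⁅δ x, y⁆ + ⁅x, ε y⁆) (z : ℂ ⊗[ℝ] L) (w : ℂ ⊗[ℝ] M) :
    ε.baseChange ℂ ⁅z, w⁆ = ⁅δ.baseChange ℂ z, w⁆ + ⁅z, ε.baseChange ℂ w⁆ := by
  induction z with
  | zero => simp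
  | add z z' hz hz' => simp only [add_lie, map_add, hz, hz']; abel
  | tmul c x =>
    have : ε.baseChange ℂ ∘ₗ LieModule.toEnd ℂ (ℂ ⊗[ℝ] L) (ℂ ⊗[ℝ] M) (c ⊗ₜ[ℝ] x) =
        LieModule.toEnd ℂ (ℂ ⊗[ℝ] L) (ℂ ⊗[ℝ] M) (δ.baseChange ℂ (c ⊗ₜ[ℝ] x)) +
          LieModule.toEnd ℂ (ℂ ⊗[ℝ] L) (ℂ ⊗[ℝ] M) (c ⊗ₜ[ℝ] x) ∘ₗ ε.baseChange ℂ := by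
      ext y
      simp [LieAlgebra.ExtendScalars.bracket_tmul, h, tmul_add]
    exact LinearMap.congr_fun this w

/-- The general `lie_sub`, for the module structure of `ℂ ⊗ M` over `ℂ ⊗ L`; in this form the
instances are found when it is used for rewriting. -/
theorem complexification_lie_sub (z : ℂ ⊗[ℝ] L) (w w' : ℂ ⊗[ℝ] M) :
    ⁅z, w - w'⁆ = ⁅z, w⁆ - ⁅z, w'⁆ := lie_sub z w w'

theorem tmul_lie_mem_typeSubmodule {U : Submodule ℝ L} {W : Submodule ℝ M} {T : Module.End ℝ M}
    (h1 : ∀ u ∈ W, T u ∈ W) (h2 : ∀ u ∈ W, T (T u) = -u)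
    (h3 : ∀ a ∈ U, ∀ u ∈ W, ⁅a, u⁆ ∈ W ∧ T ⁅a, u⁆ = ⁅a, T u⁆) (c : ℂ) {a : L} (ha : a ∈ U)
    {w : ℂ ⊗[ℝ] M} (hw : w ∈ typeSubmodule W T h1 h2) :
    ⁅c ⊗ₜ[ℝ] a, w⁆ ∈ typeSubmodule W T h1 h2 := by
  obtain ⟨u, hu, rfl⟩ := hw
  have : ⁅c ⊗ₜ[ℝ] a, (1 : ℂ) ⊗ₜ[ℝ] u - I ⊗ₜ[ℝ] T u⁆ =
      c • ((1 : ℂ) ⊗ₜ[ℝ] ⁅a, u⁆ - I ⊗ₜ[ℝ] T ⁅a, u⁆) := by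
    rw [(h3 a ha u hu).2, complexification_lie_sub]
    simp [LieAlgebra.ExtendScalars.bracket_tmul, smul_sub, smul_tmul']
  rw [this]
  exact Submodule.smul_mem _ _ ⟨_, (h3 a ha u hu).1, rfl⟩

variable {S : LieGrading L} {K D : Module.End ℝ L}

/-- The subspace `L₁^{1,0} = {x - i D x}` of the complexification of `L₁`. -/
def posType (hD : S.IsContragredient K D) : Submodule ℂ (ℂ ⊗[ℝ] L) :=
  typeSubmodule (S.deg 1) D hD.mem hD.sq

/-- The subspace `L₋₁^{0,1} = {x + i K x}` of the complexification of `L₋₁`. -/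
def negType (hK : S.adjoint.IsCRPair K K) : Submodule ℂ (ℂ ⊗[ℝ] L) :=
  antitypeSubmodule (S.deg (-1)) K hK.mem hK.sq

/-- The brackets of `L₁^{1,0}` and `L₋₁^{0,1}` lie in the complexification of `L₀`. -/
theorem lie_type_antitype (hK : S.adjoint.IsCRPair K K) (hD : S.IsContragredient K D) {u v : L}
    (hu : u ∈ S.deg 1) (hv : v ∈ S.deg (-1)) :
    ⁅(1 : ℂ) ⊗ₜ[ℝ] u - I ⊗ₜ[ℝ] D u, (1 : ℂ) ⊗ₜ[ℝ] v - I ⊗ₜ[ℝ] (-K) v⁆ =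
      (1 : ℂ) ⊗ₜ[ℝ] ((2 : ℝ) • ⁅u, v⁆) + I ⊗ₜ[ℝ] ((2 : ℝ) • ⁅u, K v⁆) := by
  have h1 := hD.lie_left u hu _ (hK.mem v hv)
  rw [hK.sq v hv, lie_neg, neg_neg] at h1
  simp only [sub_lie, lie_sub, LieAlgebra.ExtendScalars.bracket_tmul, LinearMap.neg_apply,
    lie_neg, h1, hD.lie_left u hu v hv, tmul_neg, mul_one, one_mul, I_mul_I, neg_tmul]
  simp only [two_smul, tmul_add]
  abel

theorem lie_type_antitype_mem (hK : S.adjoint.IsCRPair K K) {u v : L}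
    (hu : u ∈ S.deg 1) (hv : v ∈ S.deg (-1)) : ⁅u, v⁆ ∈ S.deg 0 ∧ ⁅u, K v⁆ ∈ S.deg 0 :=
  ⟨S.lie_mem hu hv, S.lie_mem hu (hK.mem v hv)⟩

/-- There is an element `H` of `⁅L₁^{1,0}, L₋₁^{0,1}⁆` acting on `L₁^{1,0}` as `1` and on
`L₋₁^{0,1}` as `-1`. -/
theorem exists_typeGradingElement [FiniteDimensional ℝ L] [LieAlgebra.IsKilling ℝ L]
    (hK : S.adjoint.IsCRPair K K) (hD : S.IsContragredient K D) :
    ∃ H ∈ Submodule.span ℂ {z | ∃ x ∈ posType hD, ∃ y ∈ negType hK, ⁅x, y⁆ = z},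
      (∀ x ∈ posType hD, ⁅H, x⁆ = x) ∧ ∀ y ∈ negType hK, ⁅H, y⁆ = -y := by
  obtain ⟨δ, hδ⟩ := S.isInternal.exists_linearMap_eq_smul fun p => (p : ℝ)
  have hδL := S.adjoint.degree_lie hδ hδ
  have hK1 : ∀ y ∈ S.deg (-1), K y ∈ S.deg (-1) := hK.mem
  have hK2 : ∀ y ∈ S.deg (-1), K (K y) = -y := hK.sq
  have hK0 : ∀ a ∈ S.deg 0, ∀ y ∈ S.deg (-1), K ⁅a, y⁆ = ⁅a, K y⁆ := hK.map_lie
  set P := posType hD with hP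
  set Q := negType hK with hQ
  have hPd : ∀ z ∈ P, δ.baseChange ℂ z = z := by
    rintro _ ⟨u, hu, rfl⟩
    simp [hδ 1 u hu, hδ 1 _ (hD.mem u hu)]
  have hQd : ∀ z ∈ Q, δ.baseChange ℂ z = -z := by
    rintro _ ⟨u, hu, rfl⟩
    simp [hδ (-1) u hu, hδ (-1) _ (hK1 u hu), tmul_neg]
    abel
  have hPP : ∀ x ∈ P, ∀ y ∈ Q, ∀ x' ∈ P, ⁅⁅x, y⁆, x'⁆ ∈ P := by
    rintro _ ⟨u, hu, rfl⟩ _ ⟨v, hv, rfl⟩ w hw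
    have h3 : ∀ a ∈ S.deg 0, ∀ u ∈ S.deg 1, ⁅a, u⁆ ∈ S.deg 1 ∧ D ⁅a, u⁆ = ⁅a, D u⁆ :=
      fun a ha u hu => ⟨by simpa using S.lie_mem ha hu, hD.map_lie a ha u hu⟩
    rw [lie_type_antitype hK hD hu hv, add_lie]
    exact P.add_mem
      (tmul_lie_mem_typeSubmodule hD.mem hD.sq h3 _
        (Submodule.smul_mem _ _ (lie_type_antitype_mem hK hu hv).1) hw)
      (tmul_lie_mem_typeSubmodule hD.mem hD.sq h3 _
        (Submodule.smul_mem _ _ (lie_type_antitype_mem hK hu hv).2) hw)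
  have hQQ : ∀ x ∈ P, ∀ y ∈ Q, ∀ y' ∈ Q, ⁅⁅x, y⁆, y'⁆ ∈ Q := by
    rintro _ ⟨u, hu, rfl⟩ _ ⟨v, hv, rfl⟩ w hw
    have h3 : ∀ a ∈ S.deg 0, ∀ u ∈ S.deg (-1), ⁅a, u⁆ ∈ S.deg (-1) ∧ (-K) ⁅a, u⁆ = ⁅a, (-K) u⁆ :=
      fun a ha u hu => ⟨by simpa using S.lie_mem ha hu, by simp [hK0 a ha u hu]⟩
    rw [lie_type_antitype hK hD hu hv, add_lie]
    exact Q.add_mem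
      (tmul_lie_mem_typeSubmodule (fun u hu => Submodule.neg_mem _ (hK1 u hu))
        (fun u hu => by simp [hK2 u hu]) h3 _
        (Submodule.smul_mem _ _ (lie_type_antitype_mem hK hu hv).1) hw)
      (tmul_lie_mem_typeSubmodule (fun u hu => Submodule.neg_mem _ (hK1 u hu))
        (fun u hu => by simp [hK2 u hu]) h3 _
        (Submodule.smul_mem _ _ (lie_type_antitype_mem hK hu hv).2) hw)
  -- `Re B(u - i D u, v + i K v) = 2 B(u, v)`
  have hre : ∀ u ∈ S.deg 1, ∀ v ∈ S.deg (-1), killingForm ℂ (ℂ ⊗[ℝ] L)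
      ((1 : ℂ) ⊗ₜ[ℝ] u - I ⊗ₜ[ℝ] D u) ((1 : ℂ) ⊗ₜ[ℝ] v - I ⊗ₜ[ℝ] (-K) v) = 0 →
      killingForm ℝ L u v = 0 := by
    intro u hu v hv h
    change LieModule.traceForm ℂ (ℂ ⊗[ℝ] L) (ℂ ⊗[ℝ] L) _ _ = 0 at h
    rw [LieModule.traceForm_baseChange] at h
    have h2 := congrArg Complex.re h
    simp [hD.killingForm_left, hK2 v hv] at h2
    linarith
  have nP : ∀ x ∈ P, (∀ y ∈ Q, killingForm ℂ (ℂ ⊗[ℝ] L) x y = 0) → x = 0 := by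
    rintro _ ⟨u, hu, rfl⟩ h
    rw [S.eq_zero_of_forall_killingForm (p := 1) (q := -1) (by norm_num) hu fun v hv =>
      hre u hu v hv (h _ ⟨v, hv, rfl⟩)]
    simp
  have nQ : ∀ y ∈ Q, (∀ x ∈ P, killingForm ℂ (ℂ ⊗[ℝ] L) x y = 0) → y = 0 := by
    rintro _ ⟨v, hv, rfl⟩ h
    rw [S.eq_zero_of_forall_killingForm (p := -1) (q := 1) (by norm_num) hv fun u hu => by
      rw [LieModule.traceForm_comm]; exact hre u hu v hv (h _ ⟨u, hu, rfl⟩)]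
    simp
  exact exists_lie_eq_self_and_eq_neg
    killingForm_complexification_nondegenerate (δ.baseChange ℂ) (baseChange_derivation hδL)
    P Q hPd hQd hPP hQQ nP nQ

end

/-! ### Annihilation of `M₋₁^{1,0}` by `L₁^{1,0}` -/

section

open TensorProduct Complex

section ComplexGraded

variable {M W : Type*} [AddCommGroup M] [Module ℝ M] [AddCommGroup W] [Module ℂ W]
  {deg : ℤ → Submodule ℝ M}

theorem DirectSum.IsInternal.complexification_ext (h : DirectSum.IsInternal deg)
    {f g : ℂ ⊗[ℝ] M →ₗ[ℂ] W}
    (hfg : ∀ p, ∀ y ∈ deg p, f ((1 : ℂ) ⊗ₜ[ℝ] y) = g ((1 : ℂ) ⊗ₜ[ℝ] y)) : f = g := by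
  let _ : Module ℝ W := Module.compHom W (algebraMap ℝ ℂ)
  have _ : IsScalarTower ℝ ℂ W := ⟨fun a b c => by
    change (a • b) • c = (algebraMap ℝ ℂ a) • b • c
    rw [smul_smul]; rfl⟩
  refine TensorProduct.AlgebraTensorModule.ext fun c y => ?_
  have hle : (⨆ p, deg p) ≤ LinearMap.eqLocus
      (f.restrictScalars ℝ ∘ₗ TensorProduct.mk ℝ ℂ M 1)
      (g.restrictScalars ℝ ∘ₗ TensorProduct.mk ℝ ℂ M 1) := iSup_le fun p y hy => hfg p y hy
  rw [h.submodule_iSup_eq_top] at hle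
  have hy : f ((1 : ℂ) ⊗ₜ[ℝ] y) = g ((1 : ℂ) ⊗ₜ[ℝ] y) := hle (Submodule.mem_top (x := y))
  have hc : c ⊗ₜ[ℝ] y = c • ((1 : ℂ) ⊗ₜ[ℝ] y) := by rw [smul_tmul', smul_eq_mul, mul_one]
  rw [hc, map_smul, map_smul, hy]

/-- A complex subspace contains all values of `f` if it contains those on homogeneous elements. -/
theorem DirectSum.IsInternal.complexification_apply_mem (h : DirectSum.IsInternal deg)
    {f : ℂ ⊗[ℝ] M →ₗ[ℂ] W} {U : Submodule ℂ W}
    (hf : ∀ p, ∀ y ∈ deg p, f ((1 : ℂ) ⊗ₜ[ℝ] y) ∈ U) (z : ℂ ⊗[ℝ] M) : f z ∈ U := by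
  have := h.complexification_ext (f := U.mkQ ∘ₗ f) (g := 0) fun p y hy => by
    simpa using hf p y hy
  have h2 := LinearMap.congr_fun this z
  simpa using h2

end ComplexGraded

variable {L : Type*} [LieRing L] [LieAlgebra ℝ L] {S : LieGrading L}
  {M : Type*} [AddCommGroup M] [Module ℝ M] [LieRingModule L M] [LieModule ℝ L M]

theorem baseChange_degree_eigenspace {Γ : ModuleGrading S M} {ε : Module.End ℝ M}
    (hε : ∀ p, ∀ y ∈ Γ.deg p, ε y = (p : ℝ) • y) (c : ℂ) {p : ℤ} {y : M} (hy : y ∈ Γ.deg p) :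
    ε.baseChange ℂ (c ⊗ₜ[ℝ] y) = (p : ℂ) • (c ⊗ₜ[ℝ] y) := by
  rw [LinearMap.baseChange_tmul, hε p y hy, tmul_smul, ← ofReal_intCast]
  rfl

/-- The projection of the complexification of `M` onto `M₋₁^{0,1} ⊕ ⨁_{p ≥ 0} M_p` along
`M₋₁^{1,0} ⊕ ⨁_{p < -1} M_p`. -/
theorem ModuleGrading.exists_typeProjection (Γ : ModuleGrading S M) {J : Module.End ℝ M}
    (hJ : ∀ q, q ≠ -1 → ∀ y ∈ Γ.deg q, J y = 0) :
    ∃ E : Module.End ℂ (ℂ ⊗[ℝ] M),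
      (∀ p, 0 ≤ p → ∀ y ∈ Γ.deg p, ∀ c : ℂ, E (c ⊗ₜ[ℝ] y) = c ⊗ₜ[ℝ] y) ∧
      (∀ p, p < -1 → ∀ y ∈ Γ.deg p, ∀ c : ℂ, E (c ⊗ₜ[ℝ] y) = 0) ∧
      (∀ y ∈ Γ.deg (-1), ∀ c : ℂ,
        E (c ⊗ₜ[ℝ] y) = (1 / 2 : ℂ) • (c ⊗ₜ[ℝ] y + (I * c) ⊗ₜ[ℝ] J y)) := by
  obtain ⟨π, hπ⟩ := Γ.isInternal.exists_linearMap_eq_smul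
    fun p => if 0 ≤ p then 1 else if p = -1 then 1 / 2 else 0
  refine ⟨π.baseChange ℂ + (I / 2) • J.baseChange ℂ, fun p hp y hy c => ?_,
    fun p hp y hy c => ?_, fun y hy c => ?_⟩
  · simp [hπ p y hy, hp, hJ p (by omega) y hy]
  · have h1 : ¬ 0 ≤ p := by omega
    have h2 : p ≠ -1 := by omega
    simp [hπ p y hy, h1, h2, hJ p h2 y hy]
  · have : π y = (1 / 2 : ℝ) • y := by rw [hπ _ y hy]; norm_num
    rw [LinearMap.add_apply, LinearMap.smul_apply, LinearMap.baseChange_tmul,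
      LinearMap.baseChange_tmul, this, tmul_smul, smul_add]
    have e1 : (1 / 2 : ℝ) • (c ⊗ₜ[ℝ] y) = (1 / 2 : ℂ) • (c ⊗ₜ[ℝ] y) := by
      rw [smul_tmul', smul_tmul', Complex.real_smul, smul_eq_mul]; norm_num
    have e2 : (I / 2) • (c ⊗ₜ[ℝ] J y) = (1 / 2 : ℂ) • ((I * c) ⊗ₜ[ℝ] J y) := by
      rw [smul_tmul', smul_tmul', smul_eq_mul, smul_eq_mul]
      congr 1
      ring
    rw [e1, e2]

open Module in
/-- After complexification, this says that `L₁^{1,0}` annihilates `M₋₁^{1,0}`. The subspace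
`N = M₋₁^{0,1} ⊕ ⨁_{p ≥ 0} M_p` is stable under `L₁^{1,0}` and `L₋₁^{0,1}`; the difference `F` of
the degree and of the type grading element `H` commutes with both, and `H`, as a sum of commutators
of their elements, has trace zero on each subspace stable under them. So
`apply_eq_zero_of_trace_restrict_eq_zero` applies, with the complement
`C = M₋₁^{1,0} ⊕ ⨁_{p < -1} M_p` of `N`. -/
theorem lie_contragredient_add_lie_map_eq_zero [FiniteDimensional ℝ L] [LieAlgebra.IsKilling ℝ L]
    [FiniteDimensional ℝ M] {Γ : ModuleGrading S M} {K D : Module.End ℝ L} {J : Module.End ℝ M}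
    (hK : S.adjoint.IsCRPair K K) (hD : S.IsContragredient K D) (hJ : Γ.IsCRPair K J)
    {x : L} (hx : x ∈ S.deg 1) {y : M} (hy : y ∈ Γ.deg (-1)) : ⁅D x, y⁆ + ⁅x, J y⁆ = 0 := by
  obtain ⟨δ, hδ⟩ := S.isInternal.exists_linearMap_eq_smul fun p => (p : ℝ)
  obtain ⟨ε, hε⟩ := Γ.isInternal.exists_linearMap_eq_smul fun p => (p : ℝ)
  obtain ⟨E, hE0, hE2, hE1⟩ := Γ.exists_typeProjection hJ.map_eq_zero
  obtain ⟨H, hH, hHpos, hHneg⟩ := exists_typeGradingElement hK hD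
  let ρ : ℂ ⊗[ℝ] L →ₗ[ℂ] End ℂ (ℂ ⊗[ℝ] M) := LieModule.toEnd ℂ (ℂ ⊗[ℝ] L) (ℂ ⊗[ℝ] M)
  have hρ : ∀ (c d : ℂ) (a : L) (u : M), ρ (c ⊗ₜ[ℝ] a) (d ⊗ₜ[ℝ] u) = (c * d) ⊗ₜ[ℝ] ⁅a, u⁆ :=
    fun c d a u => LieAlgebra.ExtendScalars.bracket_tmul ..
  have hρlie : ∀ z w, ρ ⁅z, w⁆ = ρ z * ρ w - ρ w * ρ z := fun z w =>
    LinearMap.ext fun u => lie_lie z w u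
  have hdeg : ∀ z, ε.baseChange ℂ * ρ z = ρ (δ.baseChange ℂ z) + ρ z * ε.baseChange ℂ := fun z =>
    LinearMap.ext fun w => baseChange_derivation (Γ.degree_lie hδ hε) z w
  -- Elements of `L₀` commute with the projection `E`.
  have hE_comm : ∀ a ∈ S.deg 0, ∀ c : ℂ, Commute (ρ (c ⊗ₜ[ℝ] a)) E := by
    intro a ha c
    refine Γ.isInternal.complexification_ext fun p u hu => ?_
    have hau : ⁅a, u⁆ ∈ Γ.deg p := by simpa using Γ.lie_mem ha hu
    rw [End.mul_apply, End.mul_apply, hρ]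
    rcases lt_trichotomy p (-1) with hp | rfl | hp
    · rw [hE2 p hp u hu, map_zero, hE2 p hp _ hau]
    · rw [hE1 u hu, hE1 _ hau, map_smul, map_add, hρ, hρ, hJ.map_lie a ha u hu]
      rw [mul_one, mul_one, mul_comm c I]
    · rw [hE0 p (by omega) u hu, hE0 p (by omega) _ hau, hρ]
  have hHE : Commute (ρ H) E := by
    have hle : Submodule.span ℂ {z | ∃ x ∈ posType hD, ∃ y ∈ negType hK, ⁅x, y⁆ = z} ≤
        LinearMap.ker ((LinearMap.mulRight ℂ E - LinearMap.mulLeft ℂ E) ∘ₗ ρ) := by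
      rw [Submodule.span_le]
      rintro _ ⟨_, ⟨u, hu, rfl⟩, _, ⟨v, hv, rfl⟩, rfl⟩
      obtain ⟨h1, h2⟩ := lie_type_antitype_mem hK hu hv
      rw [lie_type_antitype hK hD hu hv]
      have h3 := (hE_comm _ (Submodule.smul_mem _ (2 : ℝ) h1) 1).add_left
        (hE_comm _ (Submodule.smul_mem _ (2 : ℝ) h2) I)
      rw [← map_add] at h3
      exact sub_eq_zero.2 h3.eq
    exact sub_eq_zero.1 (hle hH)
  -- `[δ, ρ z] = ρ z` and `[H, z] = z` for `z` of positive type, and similarly with signs.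
  have hposδ : ∀ z ∈ posType hD, δ.baseChange ℂ z = z := by
    rintro _ ⟨u, hu, rfl⟩
    simp [hδ 1 u hu, hδ 1 _ (hD.mem u hu)]
  have hnegδ : ∀ z ∈ negType hK, δ.baseChange ℂ z = -z := by
    rintro _ ⟨v, hv, rfl⟩
    have hv' : K v ∈ S.deg (-1) := hK.mem v hv
    simp [hδ (-1) v hv, hδ (-1) _ hv', tmul_neg]
    abel
  have hHδ : δ.baseChange ℂ H = 0 := by
    have hle : Submodule.span ℂ {z | ∃ x ∈ posType hD, ∃ y ∈ negType hK, ⁅x, y⁆ = z} ≤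
        LinearMap.ker (δ.baseChange ℂ) := by
      rw [Submodule.span_le]
      rintro _ ⟨u, hu, v, hv, rfl⟩
      have := baseChange_derivation (S.adjoint.degree_lie hδ hδ) u v
      rw [hposδ u hu, hnegδ v hv] at this
      exact this.trans ((congrArg (⁅u, v⁆ + ·) (lie_neg u v)).trans (add_neg_cancel _))
    exact hle hH
  set ε' := ε.baseChange ℂ with hε'
  set F := ε' - ρ H with hF
  have hFpos : ∀ z ∈ posType hD, Commute F (ρ z) := by
    intro z hz
    have h1 := hdeg z
    have h2 := hρlie H z
    rw [hposδ z hz] at h1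
    rw [hHpos z hz] at h2
    change (ε' - ρ H) * ρ z = ρ z * (ε' - ρ H)
    rw [sub_mul, mul_sub, h1, eq_add_of_sub_eq h2.symm]
    abel
  have hFneg : ∀ z ∈ negType hK, Commute F (ρ z) := by
    intro z hz
    have h1 := hdeg z
    have h2 := hρlie H z
    rw [hnegδ z hz, map_neg] at h1
    rw [hHneg z hz, map_neg] at h2
    change (ε' - ρ H) * ρ z = ρ z * (ε' - ρ H)
    rw [sub_mul, mul_sub, h1, eq_add_of_sub_eq h2.symm]
    abel
  have hFε : Commute F ε' := by
    have h1 := hdeg H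
    rw [hHδ, map_zero, zero_add] at h1
    exact (Commute.refl ε').sub_left (show Commute (ρ H) ε' from h1.symm)
  have hεE : Commute ε' E := by
    refine Γ.isInternal.complexification_ext fun p u hu => ?_
    rw [End.mul_apply, End.mul_apply, baseChange_degree_eigenspace hε 1 hu, map_smul]
    rcases lt_trichotomy p (-1) with hp | rfl | hp
    · rw [hE2 p hp u hu, map_zero, smul_zero]
    · rw [hE1 u hu, map_smul, map_add, baseChange_degree_eigenspace hε 1 hu,
        baseChange_degree_eigenspace hε _ (hJ.mem u hu), ← smul_add, smul_comm]
    · rw [hE0 p (by omega) u hu, baseChange_degree_eigenspace hε 1 hu]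
  have hFE : Commute F E := hεE.sub_left hHE
  have hEE : IsIdempotentElem E := by
    refine Γ.isInternal.complexification_ext fun p u hu => ?_
    rw [End.mul_apply]
    rcases lt_trichotomy p (-1) with hp | rfl | hp
    · rw [hE2 p hp u hu, map_zero]
    · rw [hE1 u hu, map_smul, map_add, hE1 u hu, hE1 _ (hJ.mem u hu), hJ.sq u hu, mul_one,
        I_mul_I, tmul_neg, neg_tmul, neg_neg, ← smul_add, add_comm (I ⊗ₜ[ℝ] J u), ← two_smul ℂ,
        smul_smul, smul_smul]
      norm_num
    · rw [hE0 p (by omega) u hu, hE0 p (by omega) u hu]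
  have hcommN : ∀ {f : End ℂ (ℂ ⊗[ℝ] M)}, Commute f E → ∀ v ∈ LinearMap.range E,
      f v ∈ LinearMap.range E := by
    rintro f hf _ ⟨w, rfl⟩
    exact ⟨f w, (LinearMap.congr_fun hf w).symm⟩
  have hcommC : ∀ {f : End ℂ (ℂ ⊗[ℝ] M)}, Commute f E → ∀ v ∈ LinearMap.ker E,
      f v ∈ LinearMap.ker E := by
    intro f hf v hv
    rw [LinearMap.mem_ker] at hv ⊢
    have := LinearMap.congr_fun hf v
    rw [End.mul_apply, End.mul_apply, hv, map_zero] at this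
    exact this.symm
  have heig : ∀ (c : ℂ) {p : ℤ} {u : M}, u ∈ Γ.deg p → ∀ {T : Set ℤ}, p ∈ T →
      c ⊗ₜ[ℝ] u ∈ ⨆ p ∈ T, End.eigenspace ε' ((p : ℤ) : ℂ) := fun c p u hu T hp =>
    Submodule.mem_iSup_of_mem p (Submodule.mem_iSup_of_mem hp
      (End.mem_eigenspace_iff.2 (baseChange_degree_eigenspace hε c hu)))
  have hNeig : LinearMap.range E ≤ ⨆ p ∈ Set.Ici (-1), End.eigenspace ε' ((p : ℤ) : ℂ) := by
    rintro _ ⟨w, rfl⟩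
    refine Γ.isInternal.complexification_apply_mem (fun p u hu => ?_) w
    rcases lt_trichotomy p (-1) with hp | rfl | hp
    · rw [hE2 p hp u hu]; exact Submodule.zero_mem _
    · rw [hE1 u hu]
      exact Submodule.smul_mem _ _ (Submodule.add_mem _ (heig _ hu Set.self_mem_Ici)
        (heig _ (hJ.mem u hu) Set.self_mem_Ici))
    · rw [hE0 p (by omega) u hu]
      exact heig _ hu hp.le
  have hCeig : LinearMap.ker E ≤ ⨆ p ∈ Set.Iic (-1), End.eigenspace ε' ((p : ℤ) : ℂ) := by
    intro w hw
    have h0 : (1 - E) w = w := by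
      rw [LinearMap.sub_apply, LinearMap.mem_ker.1 hw, sub_zero, End.one_apply]
    rw [← h0]
    refine Γ.isInternal.complexification_apply_mem (fun p u hu => ?_) w
    rw [LinearMap.sub_apply, End.one_apply]
    rcases lt_trichotomy p (-1) with hp | rfl | hp
    · rw [hE2 p hp u hu, sub_zero]; exact heig _ hu hp.le
    · rw [hE1 u hu]
      exact Submodule.sub_mem _ (heig _ hu Set.self_mem_Iic)
        (Submodule.smul_mem _ _ (Submodule.add_mem _ (heig _ hu Set.self_mem_Iic)
          (heig _ (hJ.mem u hu) Set.self_mem_Iic)))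
    · rw [hE0 p (by omega) u hu, sub_self]; exact Submodule.zero_mem _
  have hposN : ∀ z ∈ posType hD, ∀ v ∈ LinearMap.range E, ρ z v ∈ LinearMap.range E := by
    rintro _ ⟨u, hu, rfl⟩ _ ⟨w, rfl⟩
    have hmem : ∀ (c d : ℂ) {a : L}, a ∈ S.deg 1 → ∀ {p : ℤ}, -1 ≤ p → ∀ {v : M}, v ∈ Γ.deg p →
        ρ (c ⊗ₜ[ℝ] a) (d ⊗ₜ[ℝ] v) ∈ LinearMap.range E := by
      intro c d a ha p hp v hv
      rw [hρ]
      exact ⟨_, hE0 (1 + p) (by omega) _ (Γ.lie_mem ha hv) _⟩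
    have hmem' : ∀ (d : ℂ) {p : ℤ}, -1 ≤ p → ∀ {v : M}, v ∈ Γ.deg p →
        ρ ((1 : ℂ) ⊗ₜ[ℝ] u - I ⊗ₜ[ℝ] D u) (d ⊗ₜ[ℝ] v) ∈ LinearMap.range E := by
      intro d p hp v hv
      rw [map_sub, LinearMap.sub_apply]
      exact Submodule.sub_mem _ (hmem _ _ hu hp hv) (hmem _ _ (hD.mem u hu) hp hv)
    refine Γ.isInternal.complexification_apply_mem
      (f := ρ ((1 : ℂ) ⊗ₜ[ℝ] u - I ⊗ₜ[ℝ] D u) ∘ₗ E) (fun p v hv => ?_) w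
    rw [LinearMap.comp_apply]
    rcases lt_trichotomy p (-1) with hp | rfl | hp
    · rw [hE2 p hp v hv, map_zero]; exact Submodule.zero_mem _
    · rw [hE1 v hv, map_smul, map_add]
      exact Submodule.smul_mem _ _ (Submodule.add_mem _ (hmem' _ le_rfl hv)
        (hmem' _ le_rfl (hJ.mem v hv)))
    · rw [hE0 p (by omega) v hv]; exact hmem' _ hp.le hv
  have hnegN : ∀ z ∈ negType hK, ∀ v ∈ LinearMap.range E, ρ z v ∈ LinearMap.range E := by
    rintro _ ⟨u, hu, rfl⟩ _ ⟨w, rfl⟩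
    have hKu : K u ∈ S.deg (-1) := hK.mem u hu
    refine Γ.isInternal.complexification_apply_mem
      (f := ρ ((1 : ℂ) ⊗ₜ[ℝ] u - I ⊗ₜ[ℝ] (-K) u) ∘ₗ E) (fun p v hv => ?_) w
    rw [LinearMap.comp_apply, LinearMap.neg_apply, tmul_neg, sub_neg_eq_add, map_add]
    rcases lt_trichotomy p (-1) with hp | rfl | hp
    · rw [hE2 p hp v hv, map_zero]; exact Submodule.zero_mem _
    · -- `(u + i K u) (v + i J v) = 0`
      have h1 := hJ.lie_map_map u hu _ (hJ.mem v hv)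
      rw [hJ.sq v hv, lie_neg] at h1
      rw [hE1 v hv, map_smul]
      simp only [LinearMap.add_apply, map_add, hρ, mul_one, one_mul, hJ.lie_map_map u hu v hv,
        ← h1, I_mul_I, tmul_neg, neg_tmul]
      convert Submodule.zero_mem _ using 1
      rw [smul_eq_zero]
      right
      abel
    · rw [hE0 p (by omega) v hv, LinearMap.add_apply, hρ, hρ, mul_one, mul_one]
      rcases (show p = 0 ∨ 0 < p by omega) with rfl | hp'
      -- `(u + i K u) v = ⁅u, v⁆ + i J ⁅u, v⁆` for `v` of degree zero
      · have h1 : ⁅u, v⁆ ∈ Γ.deg (-1) := by simpa using Γ.lie_mem hu hv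
        refine ⟨(2 : ℂ) • ((1 : ℂ) ⊗ₜ[ℝ] ⁅u, v⁆), ?_⟩
        rw [map_smul, hE1 _ h1, hJ.map_lie_zero u hu v hv, smul_smul, mul_one]
        norm_num
      · exact ⟨(1 : ℂ) ⊗ₜ[ℝ] ⁅u, v⁆ + I ⊗ₜ[ℝ] ⁅K u, v⁆, by
          rw [map_add, hE0 (-1 + p) (by omega) _ (Γ.lie_mem hu hv),
            hE0 (-1 + p) (by omega) _ (Γ.lie_mem hKu hv)]⟩
  have htr : ∀ (W : Submodule ℂ (ℂ ⊗[ℝ] M)) (hδW : ∀ v ∈ W, ε' v ∈ W) (hFW : ∀ v ∈ W, F v ∈ W),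
      (∀ x ∈ ρ '' (posType hD ∪ negType hK : Set (ℂ ⊗[ℝ] L)), ∀ v ∈ W, x v ∈ W) →
      LinearMap.trace ℂ W (ε'.restrict hδW) = LinearMap.trace ℂ W (F.restrict hFW) := by
    intro W hδW hFW hW
    have hspan : ρ H ∈ Submodule.span ℂ {w | ∃ x ∈ ρ '' (posType hD : Set (ℂ ⊗[ℝ] L)),
        ∃ y ∈ ρ '' (negType hK : Set (ℂ ⊗[ℝ] L)), x * y - y * x = w} := by
      have hle : Submodule.span ℂ {z | ∃ x ∈ posType hD, ∃ y ∈ negType hK, ⁅x, y⁆ = z} ≤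
          (Submodule.span ℂ {w | ∃ x ∈ ρ '' (posType hD : Set (ℂ ⊗[ℝ] L)),
            ∃ y ∈ ρ '' (negType hK : Set (ℂ ⊗[ℝ] L)), x * y - y * x = w}).comap ρ := by
        rw [Submodule.span_le]
        rintro _ ⟨u, hu, v, hv, rfl⟩
        exact Submodule.subset_span ⟨_, ⟨u, hu, rfl⟩, _, ⟨v, hv, rfl⟩, (hρlie u v).symm⟩
      exact hle hH
    obtain ⟨hHW, h0⟩ := trace_restrict_eq_zero_of_mem_span_commutators W
      (fun x hx w hw => hW x (Set.image_mono Set.subset_union_left hx) w hw)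
      (fun x hx w hw => hW x (Set.image_mono Set.subset_union_right hx) w hw) hspan
    have : F.restrict hFW = ε'.restrict hδW - (ρ H).restrict hHW := rfl
    exact ((congrArg _ this).trans ((map_sub (LinearMap.trace ℂ W) _ _).trans
      (by rw [h0, sub_zero]))).symm
  have hkey := apply_eq_zero_of_trace_restrict_eq_zero ε' F
    (ρ '' (posType hD ∪ negType hK : Set (ℂ ⊗[ℝ] L))) (LinearMap.range E) (LinearMap.ker E) (-1)
    (LinearMap.IsIdempotentElem.isCompl hEE) (hcommN hεE) (hcommC hεE) (hcommN hFE)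
    (hcommC hFE) hFε hNeig hCeig
    (by rintro _ ⟨z, hz | hz, rfl⟩; exacts [hFpos z hz, hFneg z hz])
    (by rintro _ ⟨z, hz | hz, rfl⟩; exacts [hposN z hz, hnegN z hz])
    htr (x := ρ ((1 : ℂ) ⊗ₜ[ℝ] x - I ⊗ₜ[ℝ] D x)) ⟨_, Or.inl ⟨x, hx, rfl⟩, rfl⟩
    (fun v hv => by
      have h1 := LinearMap.congr_fun (hdeg ((1 : ℂ) ⊗ₜ[ℝ] x - I ⊗ₜ[ℝ] D x)) v
      rw [hposδ _ ⟨x, hx, rfl⟩] at h1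
      rw [LinearMap.add_apply, End.mul_apply, End.mul_apply, hv, map_smul] at h1
      rw [h1]
      push_cast
      module)
    (a := (1 : ℂ) ⊗ₜ[ℝ] y - I ⊗ₜ[ℝ] J y)
    (by
      rw [LinearMap.mem_ker, map_sub, hE1 y hy, hE1 _ (hJ.mem y hy), hJ.sq y hy, mul_one, I_mul_I,
        tmul_neg, neg_tmul, neg_neg, add_comm, sub_self])
    (by
      rw [map_sub, baseChange_degree_eigenspace hε _ hy,
        baseChange_degree_eigenspace hε _ (hJ.mem y hy), smul_sub])
  rw [map_sub, map_sub, LinearMap.sub_apply, LinearMap.sub_apply, hρ, hρ, hρ, hρ] at hkey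
  have h0 : (1 : ℂ) ⊗ₜ[ℝ] (⁅x, y⁆ + -⁅D x, J y⁆) + I ⊗ₜ[ℝ] (-(⁅D x, y⁆ + ⁅x, J y⁆)) = 0 := by
    rw [← hkey]
    simp only [mul_one, one_mul, I_mul_I, neg_tmul, tmul_neg, tmul_add]
    abel
  exact neg_eq_zero.1 (eq_zero_of_one_tmul_add_I_tmul h0).2

end

/-! ### Whitehead's lemma and Weyl's theorem -/

/-- The action of `L₁` on `⁅L₋₁, M₋₁⁆` is compatible with the extension of `J` to that subspace,
which is zero there because `⁅K u, J y⁆ = ⁅u, y⁆`. -/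
theorem map_lie_lie_eq_contragredient_lie {L : Type*} [LieRing L] [LieAlgebra ℝ L]
    {S : LieGrading L} {M : Type*} [AddCommGroup M] [Module ℝ M] [LieRingModule L M]
    [LieModule ℝ L M] [FiniteDimensional ℝ L] [LieAlgebra.IsKilling ℝ L]
    [FiniteDimensional ℝ M] {Γ : ModuleGrading S M} {K D : Module.End ℝ L} {J : Module.End ℝ M}
    (hK : S.adjoint.IsCRPair K K) (hD : S.IsContragredient K D) (hJ : Γ.IsCRPair K J)
    {x : L} (hx : x ∈ S.deg 1) {u : L} (hu : u ∈ S.deg (-1)) {y : M} (hy : y ∈ Γ.deg (-1)) :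
    J ⁅x, ⁅u, y⁆⁆ = ⁅D x, ⁅u, y⁆⁆ := by
  have h0 : ⁅x, u⁆ ∈ S.deg 0 := S.lie_mem hx hu
  have h1 : ⁅x, y⁆ ∈ Γ.deg 0 := Γ.lie_mem hx hy
  have h2 : ⁅K u, y⁆ = -⁅u, J y⁆ := by
    have := hJ.lie_map_map u hu _ (hJ.mem y hy)
    rw [hJ.sq y hy, lie_neg] at this
    rw [← this, neg_neg]
  have h3 := eq_neg_of_add_eq_zero_left (lie_contragredient_add_lie_map_eq_zero hK hD hJ hx hy)
  rw [leibniz_lie x, leibniz_lie (D x), map_add, hJ.map_lie _ h0 y hy, hJ.map_lie_zero u hu _ h1,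
    hD.lie_left x hx u hu, h3, neg_lie, lie_lie, lie_lie, h2, lie_neg, lie_neg]
  abel

namespace LieModule

open Module

variable {K L : Type*} [Field K] [LieRing L] [LieAlgebra K L]

/-- A Casimir element for the trace form `κ` of a module: dual bases, with respect to `κ`, of an
ideal complementary to the kernel of `κ`. -/
theorem exists_casimir [FiniteDimensional K L] [LieAlgebra.IsKilling K L] (M : Type*)
    [AddCommGroup M] [Module K M] [LieRingModule L M] [LieModule K L M] :
    ∃ (n : ℕ) (x y : Fin n → L), (n = 0 → traceForm K L M = 0) ∧
      (∑ i, traceForm K L M (x i) (y i) = n) ∧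
      ∀ (a : L) (β : L →ₗ[K] L →ₗ[K] M), ∑ i, (β ⁅a, x i⁆ (y i) + β (x i) ⁅a, y i⁆) = 0 := by
  classical
  set κ := traceForm K L M with hκ
  have hκs : ∀ x y, κ x y = κ y x := traceForm_comm K L M
  let R : LieIdeal K L :=
    { LinearMap.ker κ with
      lie_mem := fun {a x} hx => by
        change κ ⁅a, x⁆ = 0
        have hx : κ x = 0 := hx
        ext z
        rw [← lie_skew, map_neg, LinearMap.neg_apply, traceForm_apply_lie_apply, ← hκ, hx]
        simp }
  have hR : ∀ x, x ∈ R ↔ κ x = 0 := fun x => Iff.rfl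
  set T := R.killingCompl with hT
  have hRT : IsCompl R T := LieIdeal.isCompl_killingCompl R
  have hsplit : ∀ z : L, ∃ r ∈ R, ∃ t ∈ T, r + t = z := fun z => by
    have hz : z ∈ R ⊔ T := hRT.sup_eq_top ▸ LieSubmodule.mem_top z
    exact (LieSubmodule.mem_sup _ _ _).1 hz
  have hTz : ∀ x ∈ T, (∀ t ∈ T, κ x t = 0) → x = 0 := by
    intro x hx h
    have : x ∈ R ⊓ T := by
      refine ⟨?_, hx⟩
      refine LinearMap.ext fun z => ?_
      obtain ⟨r, hr, t, ht, rfl⟩ := hsplit z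
      rw [map_add, h t ht, hκs, (hR r).1 hr]
      simp
    rw [hRT.inf_eq_bot] at this
    exact (LieSubmodule.mem_bot x).1 this
  let B : LinearMap.BilinForm K T := κ.restrict T.toSubmodule
  have hBapp : ∀ x y : T, B x y = κ x y := fun x y => rfl
  have hBs : B.IsSymm := ⟨fun x y => hκs x y⟩
  have hB : B.Nondegenerate := by
    refine hBs.isRefl.nondegenerate_iff_separatingLeft.mpr fun x hx => ?_
    exact Subtype.ext (hTz x x.2 fun t ht => hx ⟨t, ht⟩)
  let b := finBasis K T
  let b' := B.dualBasis hB b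
  refine ⟨finrank K T, fun i => b i, fun i => b' i, fun h => ?_, ?_, fun a β => ?_⟩
  · have : Subsingleton T := finrank_zero_iff.1 h
    ext z w
    obtain ⟨r, hr, t, ht, rfl⟩ := hsplit z
    have h0 : t = 0 := congrArg Subtype.val (Subsingleton.elim (⟨t, ht⟩ : T) 0)
    rw [h0, add_zero, (hR r).1 hr]
    rfl
  · have : ∀ i, κ (b i) (b' i) = 1 := fun i => by
      rw [← hBapp, LinearMap.BilinForm.apply_dualBasis_right hB hBs, if_pos rfl]
    simp [this]
  · have e1 : ∀ t : T, (t : L) = ∑ j, κ t (b' j) • (b j : L) := by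
      intro t
      have hr : ∀ j, B t (b' j) = b.repr t j := by
        intro j
        conv_lhs => rw [← b.sum_repr t]
        rw [map_sum, LinearMap.sum_apply, Finset.sum_eq_single j]
        · rw [map_smul, LinearMap.smul_apply, LinearMap.BilinForm.apply_dualBasis_right hB hBs,
            if_pos rfl, smul_eq_mul, mul_one]
        · intro i _ hi
          rw [map_smul, LinearMap.smul_apply, LinearMap.BilinForm.apply_dualBasis_right hB hBs,
            if_neg hi, smul_zero]
        · exact fun h => absurd (Finset.mem_univ j) h
      have h1 := congrArg (T.toSubmodule.subtype) (b.sum_repr t)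
      rw [map_sum] at h1
      refine h1.symm.trans (Finset.sum_congr rfl fun j _ => ?_)
      rw [← hr, map_smul]
      rfl
    have e2 : ∀ t : T, (t : L) = ∑ j, κ t (b j) • (b' j : L) := by
      intro t
      have h1 := congrArg (T.toSubmodule.subtype) (b'.sum_repr t)
      rw [map_sum] at h1
      refine h1.symm.trans (Finset.sum_congr rfl fun j _ => ?_)
      rw [LinearMap.BilinForm.dualBasis_repr_apply, map_smul]
      rfl
    have f1 : ∀ i, β ⁅a, (b i : L)⁆ (b' i) = ∑ j, κ ⁅a, (b i : L)⁆ (b' j) • β (b j) (b' i) := by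
      intro i
      conv_lhs => rw [show ⁅a, (b i : L)⁆ = _ from e1 ⟨⁅a, (b i : L)⁆, T.lie_mem (b i).2⟩]
      simp only [map_sum, map_smul, LinearMap.sum_apply, LinearMap.smul_apply]
    have f2 : ∀ i, β (b i) ⁅a, (b' i : L)⁆ = ∑ j, κ ⁅a, (b' i : L)⁆ (b j) • β (b i) (b' j) := by
      intro i
      conv_lhs => rw [show ⁅a, (b' i : L)⁆ = _ from e2 ⟨⁅a, (b' i : L)⁆, T.lie_mem (b' i).2⟩]
      simp only [map_sum, map_smul]
    rw [Finset.sum_add_distrib]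
    simp only [f1, f2]
    rw [Finset.sum_comm (f := fun i j => κ ⁅a, (b' i : L)⁆ (b j) • β (b i) (b' j)),
      ← Finset.sum_add_distrib]
    refine Finset.sum_eq_zero fun i _ => ?_
    rw [← Finset.sum_add_distrib]
    refine Finset.sum_eq_zero fun j _ => ?_
    rw [← add_smul, traceForm_apply_lie_apply', ← hκ, hκs (b i), neg_add_cancel, zero_smul]

/-- The orthogonal complement of the derived algebra, for the Killing form, is the centre. -/
theorem lie_top_eq_top_of_isKilling [FiniteDimensional K L] [LieAlgebra.IsKilling K L] :
    ⁅(⊤ : LieIdeal K L), (⊤ : LieIdeal K L)⁆ = ⊤ := by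
  have h := LieIdeal.isCompl_killingCompl ⁅(⊤ : LieIdeal K L), (⊤ : LieIdeal K L)⁆
  have hbot : LieIdeal.killingCompl K L ⁅(⊤ : LieIdeal K L), (⊤ : LieIdeal K L)⁆ = ⊥ := by
    rw [LieSubmodule.eq_bot_iff]
    intro x hx
    rw [LieIdeal.mem_killingCompl] at hx
    have hz : ∀ z, ⁅z, x⁆ = 0 := fun z =>
      (LieAlgebra.IsKilling.killingForm_nondegenerate K L).2 _ fun y => by
        rw [← traceForm_apply_lie_apply]
        exact hx _ (LieSubmodule.lie_mem_lie (LieSubmodule.mem_top y) (LieSubmodule.mem_top z))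
    have had : LieAlgebra.ad K L x = 0 := LinearMap.ext fun z => by
      rw [LieAlgebra.ad_apply, ← lie_skew, hz, neg_zero, LinearMap.zero_apply]
    refine (LieAlgebra.IsKilling.killingForm_nondegenerate K L).1 _ fun y => ?_
    rw [killingForm_apply_apply, had, LinearMap.zero_comp, map_zero]
  rw [hbot] at h
  simpa using h.sup_eq_top

/-- A nilpotent module over a perfect Lie algebra is trivial. -/
theorem lie_eq_zero_of_isNilpotent {M : Type*} [AddCommGroup M] [Module K M] [LieRingModule L M]
    [LieModule K L M] (hL : ⁅(⊤ : LieIdeal K L), (⊤ : LieIdeal K L)⁆ = ⊤)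
    (h : LieModule.IsNilpotent L M) (x : L) (m : M) : ⁅x, m⁆ = 0 := by
  set N : LieSubmodule K L M := ⁅(⊤ : LieIdeal K L), (⊤ : LieSubmodule K L M)⁆ with hN
  have hle : N ≤ ⁅(⊤ : LieIdeal K L), N⁆ := by
    rw [hN, LieSubmodule.lie_le_iff]
    rintro x - m -
    have hx : x ∈ ⁅(⊤ : LieIdeal K L), (⊤ : LieIdeal K L)⁆ := by
      rw [hL]; exact LieSubmodule.mem_top x
    rw [← LieSubmodule.mem_toSubmodule, LieSubmodule.lieIdeal_oper_eq_linear_span'] at hx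
    induction hx using Submodule.span_induction with
    | mem _ hx =>
      obtain ⟨a, -, b, -, rfl⟩ := hx
      have hmem : ∀ c : L, ⁅c, m⁆ ∈ N := fun c =>
        LieSubmodule.lie_mem_lie (LieSubmodule.mem_top c) (LieSubmodule.mem_top m)
      rw [lie_lie]
      exact sub_mem (LieSubmodule.lie_mem_lie (LieSubmodule.mem_top a) (hmem b))
        (LieSubmodule.lie_mem_lie (LieSubmodule.mem_top b) (hmem a))
    | zero => rw [zero_lie]; exact zero_mem _
    | add a b _ _ ha hb => rw [add_lie]; exact add_mem ha hb
    | smul c a _ ha => rw [smul_lie]; exact SMulMemClass.smul_mem c ha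
  obtain ⟨k, hk⟩ := (LieModule.isNilpotent_iff K L M).1 h
  have hlcs : ∀ k, N ≤ LieModule.lowerCentralSeries K L M k := by
    intro k
    induction k with
    | zero => exact le_top
    | succ k ih =>
      rw [LieModule.lowerCentralSeries_succ]
      exact hle.trans (LieSubmodule.mono_lie_right _ ih)
  have : ⁅x, m⁆ ∈ N := LieSubmodule.lie_mem_lie (LieSubmodule.mem_top x) (LieSubmodule.mem_top m)
  have := hlcs k this
  rw [hk] at this
  exact (LieSubmodule.mem_bot _).1 this

/-- Whitehead's lemma: a one-cocycle of a semisimple Lie algebra is a coboundary. The Casimir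
operator `C` of the module makes `C ∘ c` a coboundary for each cocycle `c`, which reduces the
statement, by Fitting's lemma, to the submodule on which `C` is nilpotent. -/
theorem exists_eq_lie_of_cocycle [CharZero K] [FiniteDimensional K L] [LieAlgebra.IsKilling K L]
    {M : Type*} [AddCommGroup M] [Module K M] [LieRingModule L M] [LieModule K L M]
    [FiniteDimensional K M] (c : L →ₗ[K] M) (hc : ∀ x y, c ⁅x, y⁆ = ⁅x, c y⁆ - ⁅y, c x⁆) :
    ∃ m, ∀ x : L, c x = ⁅x, m⁆ := by
  induction hn : finrank K M using Nat.strong_induction_on generalizing M with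
  | _ d ih =>
  obtain ⟨n, x, y, hn0, htr, hinv⟩ := exists_casimir (K := K) (L := L) M
  let ρ : L →ₗ[K] End K M := (toEnd K L M : L →ₗ[K] End K M)
  set C : End K M := ∑ i, ρ (x i) * ρ (y i) with hC
  have hCapp : ∀ m, C m = ∑ i, ⁅x i, ⁅y i, m⁆⁆ := fun m => by
    rw [hC, LinearMap.sum_apply]; rfl
  have hCcomm : ∀ (a : L) m, C ⁅a, m⁆ = ⁅a, C m⁆ := by
    intro a m
    have h1 := hinv a (LinearMap.mk₂ K (fun u v => ⁅u, ⁅v, m⁆⁆) (by simp) (by simp) (by simp)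
      (by simp))
    simp only [LinearMap.mk₂_apply] at h1
    rw [hCapp, hCapp, lie_sum, ← sub_eq_zero, ← neg_eq_zero, ← h1, ← Finset.sum_sub_distrib,
      ← Finset.sum_neg_distrib]
    refine Finset.sum_congr rfl fun i _ => ?_
    rw [lie_lie, lie_lie, lie_sub]
    abel
  have hCc : ∀ a : L, ⁅a, ∑ i, ⁅x i, c (y i)⁆⁆ = C (c a) := by
    intro a
    have h1 := hinv a (LinearMap.mk₂ K (fun u v => ⁅u, c v⁆) (by simp) (by simp) (by simp)
      (by simp))
    simp only [LinearMap.mk₂_apply] at h1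
    rw [hCapp, lie_sum, ← sub_eq_zero, ← h1, ← Finset.sum_sub_distrib]
    refine Finset.sum_congr rfl fun i _ => ?_
    rw [lie_lie, hc a, lie_sub]
    abel
  -- If `C` is nilpotent, its trace `n` is zero, so the trace form is zero and `L` acts by zero.
  by_cases hnil : _root_.IsNilpotent C
  · have h0 : (n : K) = 0 := by
      rw [← htr, ← (LinearMap.isNilpotent_trace_of_isNilpotent hnil).eq_zero, hC, map_sum]
      rfl
    have hL := lie_top_eq_top_of_isKilling (K := K) (L := L)
    have h1 := isNilpotent_derivedSeries_of_traceForm_eq_zero (hn0 (by exact_mod_cast h0))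
    rw [isNilpotent_iff_forall' (R := K)] at h1
    have h2 : LieModule.IsNilpotent L M := by
      rw [isNilpotent_iff_forall' (R := K)]
      intro a
      have ha : a ∈ LieAlgebra.derivedSeries K L 1 := by
        change a ∈ ⁅(⊤ : LieIdeal K L), (⊤ : LieIdeal K L)⁆
        rw [hL]; exact LieSubmodule.mem_top a
      exact h1 ⟨a, ha⟩
    have htriv := lie_eq_zero_of_isNilpotent hL h2
    refine ⟨0, fun a => ?_⟩
    rw [lie_zero]
    have ha : a ∈ ⁅(⊤ : LieIdeal K L), (⊤ : LieIdeal K L)⁆ := by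
      rw [hL]; exact LieSubmodule.mem_top a
    rw [← LieSubmodule.mem_toSubmodule, LieSubmodule.lieIdeal_oper_eq_linear_span'] at ha
    induction ha using Submodule.span_induction with
    | mem _ ha => obtain ⟨u, -, v, -, rfl⟩ := ha; rw [hc, htriv, htriv, sub_zero]
    | zero => exact map_zero c
    | add a b _ _ ha hb => rw [map_add, ha, hb, add_zero]
    | smul t a _ ha => rw [map_smul, ha, smul_zero]
  · obtain ⟨k, hk, hk1⟩ := (C.eventually_isCompl_ker_pow_range_pow.and
      (Filter.eventually_ge_atTop 1)).exists
    have hCk : ∀ (j : ℕ) (a : L) m, (C ^ j) ⁅a, m⁆ = ⁅a, (C ^ j) m⁆ := by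
      intro j
      induction j with
      | zero => intro a m; rfl
      | succ j ihj =>
        intro a m
        rw [pow_succ', End.mul_apply, End.mul_apply, ihj, hCcomm]
    let N : LieSubmodule K L M :=
      { LinearMap.ker (C ^ k) with
        lie_mem := fun {a m} hm => by
          have hm : (C ^ k) m = 0 := hm
          change (C ^ k) ⁅a, m⁆ = 0
          rw [hCk, hm, lie_zero] }
    have hN : ∀ m, m ∈ N ↔ (C ^ k) m = 0 := fun m => Iff.rfl
    -- Subtracting the coboundary of `w` moves `c` to the part `N` of `M` where `C` is nilpotent.
    obtain ⟨m₀, hm₀, w', ⟨w, rfl⟩, hw⟩ := Submodule.mem_sup.1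
      (hk.sup_eq_top ▸ Submodule.mem_top (x := (C ^ (k - 1)) (∑ i, ⁅x i, c (y i)⁆)))
    have hcN : ∀ a, c a - ⁅a, w⁆ ∈ N := by
      intro a
      have h1 : ⁅a, (C ^ (k - 1)) (∑ i, ⁅x i, c (y i)⁆)⁆ = (C ^ k) (c a) := by
        rw [← hCk, hCc, ← End.mul_apply, ← pow_succ, Nat.sub_add_cancel hk1]
      rw [← hw, lie_add, ← hCk k a w] at h1
      rw [hN, map_sub, ← h1, add_sub_cancel_right]
      have h2 : ⁅a, m₀⁆ ∈ LinearMap.ker (C ^ k) := N.lie_mem hm₀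
      refine Submodule.disjoint_def.1 hk.disjoint _ h2 ⟨c a - ⁅a, w⁆, ?_⟩
      rw [map_sub, ← h1, add_sub_cancel_right]
    have hlt : finrank K N < d := by
      rw [← hn]
      refine Submodule.finrank_lt (s := N.toSubmodule) fun htop => hnil ⟨k, ?_⟩
      exact LinearMap.ker_eq_top.1 htop
    let c' : L →ₗ[K] N := (c - (ρ.flip w)).codRestrict N.toSubmodule hcN
    have hc' : ∀ a, (c' a : M) = c a - ⁅a, w⁆ := fun a => rfl
    obtain ⟨m, hm⟩ := ih _ hlt c' (fun a b => Subtype.ext (by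
      rw [LieSubmodule.coe_sub, LieSubmodule.coe_bracket, LieSubmodule.coe_bracket, hc', hc', hc',
        hc, lie_sub, lie_sub, lie_lie]
      abel)) rfl
    refine ⟨m + w, fun a => ?_⟩
    have := congrArg Subtype.val (hm a)
    rw [hc', LieSubmodule.coe_bracket] at this
    rw [lie_add, ← this, sub_add_cancel]

/-- Weyl's theorem: a submodule of a module over a semisimple Lie algebra is the image of an
equivariant projection. -/
theorem exists_equivariant_proj [CharZero K] [FiniteDimensional K L] [LieAlgebra.IsKilling K L]
    {M : Type*} [AddCommGroup M] [Module K M] [LieRingModule L M] [LieModule K L M]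
    [FiniteDimensional K M] (N : LieSubmodule K L M) :
    ∃ π : M →ₗ[K] M, (∀ (x : L) m, π ⁅x, m⁆ = ⁅x, π m⁆) ∧ (∀ m, π m ∈ N) ∧ ∀ m ∈ N, π m = m := by
  obtain ⟨p, hp⟩ := N.toSubmodule.exists_isCompl
  let π₀ : M →ₗ[K] M := N.toSubmodule.subtype ∘ₗ Submodule.projectionOnto _ _ hp
  have h1 : ∀ m, π₀ m ∈ N := fun m => (Submodule.projectionOnto _ _ hp m).2
  have h2 : ∀ m ∈ N, π₀ m = m := fun m hm =>
    congrArg Subtype.val (Submodule.projectionOnto_apply_left hp ⟨m, hm⟩)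
  -- `a ↦ ⁅a, π₀⁆` is a cocycle with values in the maps from `M / N` to `N`.
  let V : LieSubmodule K L (M →ₗ[K] M) :=
    { carrier := {f | (∀ m, f m ∈ N) ∧ ∀ m ∈ N, f m = 0}
      zero_mem' := ⟨fun m => zero_mem _, fun m _ => rfl⟩
      add_mem' := fun {f g} hf hg => ⟨fun m => add_mem (hf.1 m) (hg.1 m), fun m hm => by
        rw [LinearMap.add_apply, hf.2 m hm, hg.2 m hm, add_zero]⟩
      smul_mem' := fun t f hf => ⟨fun m => SMulMemClass.smul_mem t (hf.1 m), fun m hm => by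
        rw [LinearMap.smul_apply, hf.2 m hm, smul_zero]⟩
      lie_mem := fun {a f} hf => ⟨fun m => by
        rw [LieHom.lie_apply]
        exact sub_mem (N.lie_mem (hf.1 m)) (hf.1 _), fun m hm => by
        rw [LieHom.lie_apply, hf.2 m hm, hf.2 _ (N.lie_mem hm), lie_zero, sub_zero]⟩ }
  let c : L →ₗ[K] V := LinearMap.codRestrict V.toSubmodule
    ((toEnd K L (M →ₗ[K] M) : L →ₗ[K] End K (M →ₗ[K] M)).flip π₀) fun a => by
      refine ⟨fun m => ?_, fun m hm => ?_⟩
      · change ⁅a, π₀ m⁆ - π₀ ⁅a, m⁆ ∈ N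
        exact sub_mem (N.lie_mem (h1 m)) (h1 _)
      · change ⁅a, π₀ m⁆ - π₀ ⁅a, m⁆ = 0
        rw [h2 m hm, h2 _ (N.lie_mem hm), sub_self]
  have hcapp : ∀ a, (c a : M →ₗ[K] M) = ⁅a, π₀⁆ := fun a => rfl
  obtain ⟨f, hf⟩ := exists_eq_lie_of_cocycle c fun a b => Subtype.ext (by
    rw [LieSubmodule.coe_sub, LieSubmodule.coe_bracket, LieSubmodule.coe_bracket, hcapp, hcapp,
      hcapp, lie_lie])
  refine ⟨π₀ - (f : M →ₗ[K] M), fun a m => ?_, fun m => sub_mem (h1 m) (f.2.1 m), fun m hm => ?_⟩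
  · have h3 := congrArg Subtype.val (hf a)
    rw [hcapp, LieSubmodule.coe_bracket] at h3
    have h4 := LinearMap.congr_fun h3 m
    rw [LieHom.lie_apply, LieHom.lie_apply] at h4
    rw [LinearMap.sub_apply, LinearMap.sub_apply, lie_sub]
    rw [sub_eq_sub_iff_add_eq_add] at h4 ⊢
    rw [add_comm, ← h4, add_comm]
  · rw [LinearMap.sub_apply, f.2.2 m hm, sub_zero, h2 m hm]

end LieModule

/-! ### Fundamental modules over a semisimple graded Lie algebra -/

section

/-- In a fundamental module, a statement about the parts of negative degree is proved by descending
induction on the degree, starting with `-1`. -/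
theorem ModuleGrading.IsFundamental.induction {L : Type*} [LieRing L] [LieAlgebra ℝ L]
    {S : LieGrading L} {M : Type*} [AddCommGroup M] [Module ℝ M] [LieRingModule L M]
    [LieModule ℝ L M] {Γ : ModuleGrading S M} (hΓ : Γ.IsFundamental) (N : ℤ → Submodule ℝ M)
    (h1 : Γ.deg (-1) ≤ N (-1))
    (h2 : ∀ p < 0, Γ.deg p ≤ N p → ∀ x ∈ S.deg (-1), ∀ y ∈ Γ.deg p, ⁅x, y⁆ ∈ N (p - 1))
    {p : ℤ} (hp : p < 0) : Γ.deg p ≤ N p := by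
  obtain ⟨n, rfl⟩ : ∃ n : ℕ, p = -1 - n := ⟨(-1 - p).toNat, by omega⟩
  clear hp
  induction n with
  | zero => simpa using h1
  | succ n ih =>
    have e : (-1 - ((n + 1 : ℕ) : ℤ)) = (-1 - (n : ℤ)) - 1 := by push_cast; ring
    rw [e, hΓ _ (by omega), Submodule.span_le]
    rintro _ ⟨x, hx, y, hy, rfl⟩
    exact h2 _ (by omega) ih x hx y hy

namespace LieGrading

open Module

variable {L : Type*} [LieRing L] [LieAlgebra ℝ L] [FiniteDimensional ℝ L]
  [LieAlgebra.IsKilling ℝ L]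

/-- A fundamental graded semisimple Lie algebra is generated by its elements of degrees `-1`, `0`
and `1`. The orthogonal complement of the generated subalgebra lies in degrees `≤ -2`, where an
element of `⁅L₁, L₋₁⁆` multiplies by the degree, and its trace on the complement is zero. -/
theorem eq_top_of_deg_le (S : LieGrading L) (hS : S.IsFundamental) (U : LieSubalgebra ℝ L)
    (h1 : S.deg (-1) ≤ U.toSubmodule) (h2 : S.deg 0 ≤ U.toSubmodule)
    (h3 : S.deg 1 ≤ U.toSubmodule) : U = ⊤ := by
  set B := killingForm ℝ L with hBdef
  have hBs : ∀ x y, B x y = B y x := LieModule.traceForm_comm ℝ L L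
  have hBi : ∀ x y z, B ⁅x, y⁆ z = -B y ⁅x, z⁆ := LieModule.traceForm_apply_lie_apply' ℝ L L
  have hB : B.Nondegenerate := LieAlgebra.IsKilling.killingForm_nondegenerate ℝ L
  have hneg : ∀ p ≤ 1, S.deg p ≤ U.toSubmodule := by
    intro p hp
    rcases (show p = 1 ∨ p = 0 ∨ p < 0 by omega) with rfl | rfl | hp
    · exact h3
    · exact h2
    · exact ModuleGrading.IsFundamental.induction (Γ := S.adjoint) hS (fun _ => U.toSubmodule) h1
        (fun p _ ih x hx y hy => U.lie_mem (h1 hx) (ih hy)) hp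
  obtain ⟨δ, hδ⟩ := S.isInternal.exists_linearMap_eq_smul fun p => (p : ℝ)
  have hlie : ∀ {p q r : ℤ}, p + q = r → ∀ {x y}, x ∈ S.deg p → y ∈ S.deg q → ⁅x, y⁆ ∈ S.deg r :=
    fun h _ _ hx hy => h ▸ S.lie_mem hx hy
  obtain ⟨E, hE, -, hE1⟩ := exists_lie_eq_self_and_eq_neg hB δ (S.adjoint.degree_lie hδ hδ)
    (S.deg 1) (S.deg (-1)) (fun x hx => by simpa using hδ 1 x hx)
    (fun x hx => by simpa using hδ (-1) x hx)
    (fun x hx y hy z hz => hlie (by norm_num) (S.lie_mem hx hy) hz)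
    (fun x hx y hy z hz => hlie (by norm_num) (S.lie_mem hx hy) hz)
    (fun x hx h => S.eq_zero_of_forall_killingForm (by norm_num) hx h)
    (fun x hx h => S.eq_zero_of_forall_killingForm (q := 1) (by norm_num) hx fun y hy => by
      rw [← hBdef, hBs]; exact h y hy)
  have hEdeg : ∀ {p : ℤ}, p < 0 → S.deg p ≤ End.eigenspace (LieAlgebra.ad ℝ L E) (p : ℝ) := by
    refine ModuleGrading.IsFundamental.induction (Γ := S.adjoint) hS
      (fun p => End.eigenspace (LieAlgebra.ad ℝ L E) (p : ℝ)) (fun y hy => ?_)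
      (fun p _ ih x hx y hy => ?_)
    · rw [End.mem_eigenspace_iff, LieAlgebra.ad_apply, hE1 y hy]; simp
    · have := End.mem_eigenspace_iff.1 (ih hy)
      rw [LieAlgebra.ad_apply] at this
      rw [End.mem_eigenspace_iff, LieAlgebra.ad_apply, leibniz_lie, hE1 x hx, this, neg_lie,
        lie_smul]
      push_cast
      module
  set C := LinearMap.BilinForm.orthogonal B U.toSubmodule with hC
  have hCmem : ∀ z, z ∈ C ↔ ∀ u ∈ U, B z u = 0 := fun z =>
    ⟨fun h u hu => by rw [hBs]; exact h u hu, fun h u hu => by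
      change B u z = 0; rw [hBs]; exact h u hu⟩
  have hUC : ∀ u ∈ U, ∀ z ∈ C, ⁅u, z⁆ ∈ C := fun u hu z hz => (hCmem _).2 fun w hw => by
    rw [hBi, (hCmem z).1 hz _ (U.lie_mem hu hw), neg_zero]
  have hCle : C ≤ ⨆ p ∈ Set.Iic (-2), End.eigenspace (LieAlgebra.ad ℝ L E) ((p : ℤ) : ℝ) := by
    intro z hz
    obtain ⟨θ, hθ⟩ := S.isInternal.exists_linearMap_eq_smul fun p => if -1 ≤ p then 1 else 0
    -- The part of `z` in degrees `≥ -1` is orthogonal to `L`, as `U` contains all degrees `≤ 1`.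
    have hθz : θ z = 0 := by
      refine eq_zero_of_killingForm_eq_zero fun y => ?_
      suffices h : B (θ z) = 0 by rw [← hBdef, h, LinearMap.zero_apply]
      refine S.isInternal.linearMap_ext fun q y hy => ?_
      rw [LinearMap.zero_apply]
      rw [hBs]
      by_cases hq : q ≤ 1
      · have : B y ∘ₗ θ = B y := S.isInternal.linearMap_ext fun r w hw => by
          rw [LinearMap.comp_apply, hθ r w hw]
          split_ifs with hr
          · rw [one_smul]
          · rw [zero_smul, map_zero, hBdef, S.killingForm_eq_zero (by omega) hy hw]
        rw [← LinearMap.comp_apply, this, hBs]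
        exact (hCmem z).1 hz y (hneg q hq hy)
      · have : B y ∘ₗ θ = 0 := S.isInternal.linearMap_ext fun r w hw => by
          rw [LinearMap.comp_apply, hθ r w hw, LinearMap.zero_apply]
          split_ifs with hr
          · rw [one_smul, hBdef, S.killingForm_eq_zero (by omega) hy hw]
          · rw [zero_smul, map_zero]
        rw [← LinearMap.comp_apply, this, LinearMap.zero_apply]
    have hle : ⨆ q, S.deg q ≤ (⨆ p ∈ Set.Iic (-2),
        End.eigenspace (LieAlgebra.ad ℝ L E) ((p : ℤ) : ℝ)).comap (LinearMap.id - θ) := by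
      refine iSup_le fun q y hy => ?_
      rw [Submodule.mem_comap, LinearMap.sub_apply, LinearMap.id_apply, hθ q y hy]
      split_ifs with hq
      · rw [one_smul, sub_self]; exact Submodule.zero_mem _
      · rw [zero_smul, sub_zero]
        exact Submodule.mem_iSup_of_mem q (Submodule.mem_iSup_of_mem
          (Set.mem_Iic.2 (by omega)) (hEdeg (by omega) hy))
    rw [S.isInternal.submodule_iSup_eq_top] at hle
    have h5 := hle (Submodule.mem_top (x := z))
    rwa [Submodule.mem_comap, LinearMap.sub_apply, hθz, sub_zero, LinearMap.id_apply] at h5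
  have hspan : LieAlgebra.ad ℝ L E ∈ Submodule.span ℝ
      {w | ∃ x ∈ LieAlgebra.ad ℝ L '' (S.deg 1 : Set L),
        ∃ y ∈ LieAlgebra.ad ℝ L '' (S.deg (-1) : Set L), x * y - y * x = w} := by
    have hle : Submodule.span ℝ {z | ∃ x ∈ S.deg 1, ∃ y ∈ S.deg (-1), ⁅x, y⁆ = z} ≤
        (Submodule.span ℝ {w | ∃ x ∈ LieAlgebra.ad ℝ L '' (S.deg 1 : Set L),
          ∃ y ∈ LieAlgebra.ad ℝ L '' (S.deg (-1) : Set L), x * y - y * x = w}).comap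
          (LieAlgebra.ad ℝ L : L →ₗ[ℝ] End ℝ L) := by
      rw [Submodule.span_le]
      rintro _ ⟨u, hu, v, hv, rfl⟩
      exact Submodule.subset_span
        ⟨_, ⟨u, hu, rfl⟩, _, ⟨v, hv, rfl⟩, (ad_lie_eq_mul_sub_mul u v).symm⟩
    exact hle hE
  obtain ⟨hEC, htr⟩ := trace_restrict_eq_zero_of_mem_span_commutators C
    (by rintro _ ⟨x, hx, rfl⟩ w hw; exact hUC x (h3 hx) w hw)
    (by rintro _ ⟨x, hx, rfl⟩ w hw; exact hUC x (h1 hx) w hw) hspan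
  obtain ⟨s, m, hs, -, hfr, htr'⟩ := exists_trace_restrict_eq_sum _ (Set.Iic (-2)) C hEC hCle
  have hfr0 : (finrank ℝ C : ℝ) ≤ 0 := by
    have : ∑ p ∈ s, (p : ℝ) * m p ≤ ∑ p ∈ s, (-2) * (m p : ℝ) :=
      Finset.sum_le_sum fun p hp => mul_le_mul_of_nonneg_right
        (by exact_mod_cast hs p hp) (Nat.cast_nonneg _)
    rw [← htr', htr, ← Finset.mul_sum, ← hfr] at this
    linarith
  have hC0 : C = ⊥ :=
    Submodule.finrank_eq_zero.1 (by exact_mod_cast le_antisymm hfr0 (by positivity))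
  have htop : U.toSubmodule = ⊤ := by
    have hrefl : LinearMap.BilinForm.IsRefl B := fun x y h => by rw [hBs, h]
    rw [← LinearMap.BilinForm.orthogonal_orthogonal hB hrefl U.toSubmodule, ← hC, hC0]
    exact LinearMap.BilinForm.orthogonal_bot ..
  exact LieSubalgebra.toSubmodule_injective htop

end LieGrading

variable {L : Type*} [LieRing L] [LieAlgebra ℝ L] {S : LieGrading L}
  {M : Type*} [AddCommGroup M] [Module ℝ M] [LieRingModule L M] [LieModule ℝ L M]

/-- The subspaces `⁅L₋₁, ⁅L₋₁, …, K⁆⁆` with `n` factors, where `K` is the kernel of `L₁` in degree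
`p`. -/
def ModuleGrading.descent (Γ : ModuleGrading S M) (p : ℤ) : ℕ → Submodule ℝ M
  | 0 => { carrier := {y | y ∈ Γ.deg p ∧ ∀ x ∈ S.deg 1, ⁅x, y⁆ = 0}
           zero_mem' := ⟨zero_mem _, fun x _ => lie_zero x⟩
           add_mem' := fun ha hb => ⟨add_mem ha.1 hb.1, fun x hx => by
            rw [lie_add, ha.2 x hx, hb.2 x hx, add_zero]⟩
           smul_mem' := fun c _ ha => ⟨Submodule.smul_mem _ c ha.1, fun x hx => by
            rw [lie_smul, ha.2 x hx, smul_zero]⟩ }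
  | n + 1 => Submodule.span ℝ {z | ∃ x ∈ S.deg (-1), ∃ y ∈ Γ.descent p n, ⁅x, y⁆ = z}

theorem ModuleGrading.descent_le (Γ : ModuleGrading S M) (p : ℤ) (n : ℕ) :
    Γ.descent p n ≤ Γ.deg (p - n) := by
  induction n with
  | zero => intro y hy; simpa using hy.1
  | succ n ih =>
    rw [ModuleGrading.descent, Submodule.span_le]
    rintro _ ⟨x, hx, y, hy, rfl⟩
    have : -1 + (p - (n : ℤ)) = p - ((n + 1 : ℕ) : ℤ) := by push_cast; ring
    exact this ▸ Γ.lie_mem hx (ih hy)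

theorem ModuleGrading.lie_mem_descent (Γ : ModuleGrading S M) {p : ℤ} {n : ℕ} {a : L}
    (ha : a ∈ S.deg 0) {y : M} (hy : y ∈ Γ.descent p n) : ⁅a, y⁆ ∈ Γ.descent p n := by
  induction n generalizing y with
  | zero =>
    refine ⟨by simpa using Γ.lie_mem ha hy.1, fun x hx => ?_⟩
    have h1 : ⁅x, a⁆ ∈ S.deg 1 := by simpa using S.lie_mem hx ha
    rw [leibniz_lie, hy.2 x hx, hy.2 _ h1, lie_zero, add_zero]
  | succ n ih =>
    rw [ModuleGrading.descent] at hy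
    induction hy using Submodule.span_induction with
    | mem _ h =>
      obtain ⟨x, hx, y, hy, rfl⟩ := h
      rw [leibniz_lie]
      have h1 : ⁅a, x⁆ ∈ S.deg (-1) := by simpa using S.lie_mem ha hx
      exact add_mem (Submodule.subset_span ⟨_, h1, y, hy, rfl⟩)
        (Submodule.subset_span ⟨x, hx, _, ih hy, rfl⟩)
    | zero => rw [lie_zero]; exact zero_mem _
    | add a b _ _ ha hb => rw [lie_add]; exact add_mem ha hb
    | smul c a _ ha => rw [lie_smul]; exact Submodule.smul_mem _ c ha

theorem ModuleGrading.lie_mem_descent_of_succ (Γ : ModuleGrading S M) {p : ℤ} {n : ℕ} {x : L}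
    (hx : x ∈ S.deg 1) {y : M} (hy : y ∈ Γ.descent p (n + 1)) : ⁅x, y⁆ ∈ Γ.descent p n := by
  induction n generalizing y with
  | zero =>
    rw [ModuleGrading.descent] at hy
    induction hy using Submodule.span_induction with
    | mem _ h =>
      obtain ⟨u, hu, y, hy, rfl⟩ := h
      rw [leibniz_lie, hy.2 x hx, lie_zero, add_zero]
      exact Γ.lie_mem_descent (S.lie_mem hx hu) hy
    | zero => rw [lie_zero]; exact zero_mem _
    | add a b _ _ ha hb => rw [lie_add]; exact add_mem ha hb
    | smul c a _ ha => rw [lie_smul]; exact Submodule.smul_mem _ c ha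
  | succ n ih =>
    rw [ModuleGrading.descent] at hy
    induction hy using Submodule.span_induction with
    | mem _ h =>
      obtain ⟨u, hu, y, hy, rfl⟩ := h
      rw [leibniz_lie]
      exact add_mem (Γ.lie_mem_descent (S.lie_mem hx hu) hy)
        (Submodule.subset_span ⟨u, hu, _, ih hy, rfl⟩)
    | zero => rw [lie_zero]; exact zero_mem _
    | add a b _ _ ha hb => rw [lie_add]; exact add_mem ha hb
    | smul c a _ ha => rw [lie_smul]; exact Submodule.smul_mem _ c ha

/-- On a fundamental graded module, elements of degree `≤ -2` are determined by the action of
`L₁`: those killed by `L₁` generate a submodule in degrees `≤ -2`, and the degree zero part of an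
equivariant projection onto it vanishes on `M₋₁`, hence on `⨁_{p < 0} M_p`. -/
theorem ModuleGrading.IsFundamental.eq_zero_of_lie_eq_zero [FiniteDimensional ℝ L]
    [LieAlgebra.IsKilling ℝ L] [FiniteDimensional ℝ M] (hS : S.IsFundamental)
    {Γ : ModuleGrading S M} (hΓ : Γ.IsFundamental) {p : ℤ} (hp : p ≤ -2) {y : M}
    (hy : y ∈ Γ.deg p) (h : ∀ x ∈ S.deg 1, ⁅x, y⁆ = 0) : y = 0 := by
  set N := ⨆ n, Γ.descent p n with hN
  have hstab : ∀ {a : L}, (∀ n, ∀ y ∈ Γ.descent p n, ⁅a, y⁆ ∈ N) → ∀ y ∈ N, ⁅a, y⁆ ∈ N := by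
    intro a ha y hy
    have : N ≤ N.comap (LieModule.toEnd ℝ L M a) := iSup_le fun n y hy => ha n y hy
    exact this hy
  have hle : ∀ n, Γ.descent p n ≤ N := le_iSup (Γ.descent p)
  let U : LieSubalgebra ℝ L :=
    { carrier := {a | ∀ y ∈ N, ⁅a, y⁆ ∈ N}
      zero_mem' := fun y _ => by rw [zero_lie]; exact zero_mem _
      add_mem' := fun ha hb y hy => by rw [add_lie]; exact add_mem (ha y hy) (hb y hy)
      smul_mem' := fun c _ ha y hy => by rw [smul_lie]; exact Submodule.smul_mem _ c (ha y hy)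
      lie_mem' := fun ha hb y hy => by
        rw [lie_lie]; exact sub_mem (ha _ (hb y hy)) (hb _ (ha y hy)) }
  have hU : U = ⊤ := by
    refine S.eq_top_of_deg_le hS U (fun x hx => hstab fun n y hy => ?_)
      (fun x hx => hstab fun n y hy => ?_) (fun x hx => hstab fun n y hy => ?_)
    · exact hle (n + 1) (Submodule.subset_span ⟨x, hx, y, hy, rfl⟩)
    · exact hle n (Γ.lie_mem_descent hx hy)
    · cases n with
      | zero => rw [hy.2 x hx]; exact zero_mem _
      | succ n => exact hle n (Γ.lie_mem_descent_of_succ hx hy)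
  let N' : LieSubmodule ℝ L M :=
    { N with
      lie_mem := fun {a y} hy => by
        have ha : a ∈ U := by rw [hU]; exact LieSubalgebra.mem_top a
        exact ha y hy }
  obtain ⟨π, hπ, hπN, hπ'⟩ := LieModule.exists_equivariant_proj N'
  choose pr hpr hpr1 hpr0 using Γ.isInternal.exists_proj
  have hlie : ∀ q, ∀ x ∈ S.deg (-1), ∀ v, pr (q - 1) ⁅x, v⁆ = ⁅x, pr q v⁆ := by
    intro q x hx v
    have : pr (q - 1) ∘ₗ LieModule.toEnd ℝ L M x = LieModule.toEnd ℝ L M x ∘ₗ pr q :=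
      Γ.isInternal.linearMap_ext fun r w hw => by
        change pr (q - 1) ⁅x, w⁆ = ⁅x, pr q w⁆
        have hxw := Γ.lie_mem hx hw
        by_cases hr : r = q
        · subst hr
          rw [hpr1 r w hw, hpr1 _ _ (by convert hxw using 2; ring)]
        · rw [hpr0 q r hr w hw, hpr0 (q - 1) (-1 + r) (by omega) _ hxw, lie_zero]
    exact LinearMap.congr_fun this v
  have hvan : ∀ {q : ℤ}, q < 0 → Γ.deg q ≤ LinearMap.ker (pr q ∘ₗ π) := by
    intro q
    refine hΓ.induction (fun q => LinearMap.ker (pr q ∘ₗ π)) (fun w _ => ?_)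
      fun q _ ih x hx w hw => ?_
    -- `N` lies in degrees `≤ p ≤ -2`, so its elements have no component of degree `-1`.
    · have : N ≤ LinearMap.ker (pr (-1)) := iSup_le fun n v hv =>
        hpr0 (-1) (p - n) (by omega) v (Γ.descent_le p n hv)
      exact this (hπN w)
    · have := ih hw
      rw [LinearMap.mem_ker, LinearMap.comp_apply] at this ⊢
      rw [hπ, hlie q x hx, this, lie_zero]
  have hyN : y ∈ N := hle 0 ⟨hy, h⟩
  have := hvan (by omega : p < 0) hy
  rwa [LinearMap.mem_ker, LinearMap.comp_apply, hπ' y hyN, hpr1 p y hy] at this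

end

/-! ### Extension of the complex structure to negative degrees -/

namespace ModuleGrading

variable {L : Type*} [LieRing L] [LieAlgebra ℝ L] {S : LieGrading L}
  {M : Type*} [AddCommGroup M] [Module ℝ M] [LieRingModule L M] [LieModule ℝ L M]

/-- The graph, in degree `-1 - n`, of the operator `E` with `E = J` on `M₋₁` and
`E ⁅x, y⁆ = ⁅K x, y⁆ + ⁅x, E y⁆` for `x ∈ L₋₁`: the subspace of `M × M` spanned by the pairs that
these conditions force to belong to the graph. -/
def extensionGraph (Γ : ModuleGrading S M) (K : Module.End ℝ L) (J : Module.End ℝ M) :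
    ℕ → Submodule ℝ (M × M)
  | 0 => (Γ.deg (-1)).map (LinearMap.id.prod J)
  | n + 1 => Submodule.span ℝ {z | ∃ x ∈ S.deg (-1), ∃ y ∈ Γ.extensionGraph K J n,
      (⁅x, y.1⁆, ⁅K x, y.1⁆ + ⁅x, y.2⁆) = z}

variable {Γ : ModuleGrading S M} {K D : Module.End ℝ L} {J : Module.End ℝ M}

theorem mem_extensionGraph_zero {y z : M} :
    (y, z) ∈ Γ.extensionGraph K J 0 ↔ y ∈ Γ.deg (-1) ∧ J y = z := by
  constructor
  · rintro ⟨w, hw, h⟩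
    obtain ⟨rfl, rfl⟩ := Prod.mk.inj h
    exact ⟨hw, rfl⟩
  · rintro ⟨hy, rfl⟩
    exact ⟨y, hy, rfl⟩

theorem lie_mem_extensionGraph {n : ℕ} {x : L} (hx : x ∈ S.deg (-1)) {y z : M}
    (h : (y, z) ∈ Γ.extensionGraph K J n) :
    (⁅x, y⁆, ⁅K x, y⁆ + ⁅x, z⁆) ∈ Γ.extensionGraph K J (n + 1) :=
  Submodule.subset_span ⟨x, hx, _, h, rfl⟩

theorem extensionGraph_le (hK : S.adjoint.IsCRPair K K) (hJ : Γ.IsCRPair K J) (n : ℕ) :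
    Γ.extensionGraph K J n ≤ (Γ.deg (-1 - n)).prod (Γ.deg (-1 - n)) := by
  induction n with
  | zero =>
    rintro _ ⟨y, hy, rfl⟩
    simpa using ⟨hy, hJ.mem y hy⟩
  | succ n ih =>
    rw [extensionGraph, Submodule.span_le]
    rintro _ ⟨x, hx, y, hy, rfl⟩
    obtain ⟨h1, h2⟩ := ih hy
    have e : (-1 - ((n + 1 : ℕ) : ℤ)) = -1 + (-1 - (n : ℤ)) := by push_cast; ring
    rw [e]
    exact ⟨Γ.lie_mem hx h1, add_mem (Γ.lie_mem (hK.mem x hx) h1) (Γ.lie_mem hx h2)⟩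

/-- The extension of `J` commutes with the action of `L₀`. -/
theorem lie_zero_mem_extensionGraph (hK : S.adjoint.IsCRPair K K) (hJ : Γ.IsCRPair K J) {a : L}
    (ha : a ∈ S.deg 0) {n : ℕ} {y : M × M} (hy : y ∈ Γ.extensionGraph K J n) :
    (⁅a, y.1⁆, ⁅a, y.2⁆) ∈ Γ.extensionGraph K J n := by
  induction n generalizing y with
  | zero =>
    obtain ⟨w, hw, rfl⟩ := hy
    exact mem_extensionGraph_zero.2 ⟨by simpa using Γ.lie_mem ha hw, hJ.map_lie a ha w hw⟩
  | succ n ih =>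
    rw [extensionGraph] at hy
    induction hy using Submodule.span_induction with
    | mem _ h =>
      obtain ⟨x, hx, y, hy, rfl⟩ := h
      have h1 : ⁅a, x⁆ ∈ S.deg (-1) := by simpa using S.lie_mem ha hx
      have h2 := add_mem (lie_mem_extensionGraph h1 hy) (lie_mem_extensionGraph hx (ih hy))
      have h3 : K ⁅a, x⁆ = ⁅a, K x⁆ := hK.map_lie a ha x hx
      convert h2 using 1
      rw [Prod.mk_add_mk, h3, lie_lie, lie_lie, lie_lie, lie_add]
      congr 1
      · abel
      · abel
    | zero => simp only [Prod.fst_zero, Prod.snd_zero, lie_zero]; exact zero_mem _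
    | add y z _ _ hy hz =>
      simp only [Prod.fst_add, Prod.snd_add, lie_add]
      exact add_mem hy hz
    | smul c y _ hy =>
      simp only [Prod.smul_fst, Prod.smul_snd, lie_smul]
      exact Submodule.smul_mem _ c hy

/-- The extension of `J` is compatible with the contragredient structure `D` of `L₁`. Below degree
`-2` this follows by induction from the Leibniz rule; in degree `-2` it is
`map_lie_lie_eq_contragredient_lie`. -/
theorem lie_one_mem_extensionGraph [FiniteDimensional ℝ L] [LieAlgebra.IsKilling ℝ L]
    [FiniteDimensional ℝ M] (hK : S.adjoint.IsCRPair K K) (hD : S.IsContragredient K D)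
    (hJ : Γ.IsCRPair K J) {x : L} (hx : x ∈ S.deg 1) {n : ℕ} {y : M × M}
    (hy : y ∈ Γ.extensionGraph K J (n + 1)) :
    (⁅x, y.1⁆, ⁅D x, y.1⁆ + ⁅x, y.2⁆) ∈ Γ.extensionGraph K J n := by
  induction n generalizing y with
  | zero =>
    rw [extensionGraph] at hy
    induction hy using Submodule.span_induction with
    | mem _ h =>
      obtain ⟨u, hu, _, ⟨y, hy, rfl⟩, rfl⟩ := h
      have h2 : ⁅K u, y⁆ + ⁅u, J y⁆ = 0 := by
        have := hJ.lie_map_map u hu _ (hJ.mem y hy)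
        rw [hJ.sq y hy, lie_neg] at this
        rw [← this, add_neg_cancel]
      refine mem_extensionGraph_zero.2 ⟨by simpa using Γ.lie_mem hx (Γ.lie_mem hu hy), ?_⟩
      change J ⁅x, ⁅u, y⁆⁆ = ⁅D x, ⁅u, y⁆⁆ + ⁅x, ⁅K u, y⁆ + ⁅u, J y⁆⁆
      rw [h2, lie_zero, add_zero]
      exact map_lie_lie_eq_contragredient_lie hK hD hJ hx hu hy
    | zero => simp only [Prod.fst_zero, Prod.snd_zero, lie_zero, add_zero]; exact zero_mem _
    | add y z _ _ hy hz =>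
      simp only [Prod.fst_add, Prod.snd_add, lie_add]
      rw [add_add_add_comm]
      exact add_mem hy hz
    | smul c y _ hy =>
      simp only [Prod.smul_fst, Prod.smul_snd, lie_smul]
      rw [← smul_add]
      exact Submodule.smul_mem _ c hy
  | succ n ih =>
    rw [extensionGraph] at hy
    induction hy using Submodule.span_induction with
    | mem _ h =>
      obtain ⟨u, hu, y, hy, rfl⟩ := h
      have h2 := add_mem (lie_zero_mem_extensionGraph hK hJ (S.lie_mem hx hu) hy)
        (lie_mem_extensionGraph hu (ih hy))
      convert h2 using 1
      have h3 : ⁅⁅D x, u⁆, y.1⁆ = -⁅⁅x, K u⁆, y.1⁆ := by rw [hD.lie_left x hx u hu, neg_lie]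
      rw [Prod.mk_add_mk, leibniz_lie x, leibniz_lie (D x), h3, lie_lie x (K u), lie_lie x u,
        lie_lie x u, lie_add, lie_add]
      congr 1
      abel
    | zero => simp only [Prod.fst_zero, Prod.snd_zero, lie_zero, add_zero]; exact zero_mem _
    | add y z _ _ hy hz =>
      simp only [Prod.fst_add, Prod.snd_add, lie_add]
      rw [add_add_add_comm]
      exact add_mem hy hz
    | smul c y _ hy =>
      simp only [Prod.smul_fst, Prod.smul_snd, lie_smul]
      rw [← smul_add]
      exact Submodule.smul_mem _ c hy

/-- The graph is that of a well-defined operator: if it contains `(0, z)` with `z` of degree `≤ -2`,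
then it contains `(0, ⁅x, z⁆)` for `x ∈ L₁`; by induction `L₁` annihilates `z`. -/
theorem eq_zero_of_mem_extensionGraph [FiniteDimensional ℝ L] [LieAlgebra.IsKilling ℝ L]
    [FiniteDimensional ℝ M] (hS : S.IsFundamental) (hΓ : Γ.IsFundamental)
    (hK : S.adjoint.IsCRPair K K) (hD : S.IsContragredient K D) (hJ : Γ.IsCRPair K J) {n : ℕ}
    {z : M} (hz : (0, z) ∈ Γ.extensionGraph K J n) : z = 0 := by
  induction n generalizing z with
  | zero => rw [← (mem_extensionGraph_zero.1 hz).2, map_zero]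
  | succ n ih =>
    refine hΓ.eq_zero_of_lie_eq_zero hS (p := -1 - ((n + 1 : ℕ) : ℤ)) (by push_cast; omega)
      (extensionGraph_le hK hJ _ hz).2 fun x hx => ih ?_
    simpa using lie_one_mem_extensionGraph hK hD hJ hx hz

theorem exists_mem_extensionGraph (hΓ : Γ.IsFundamental) {n : ℕ} {y : M}
    (hy : y ∈ Γ.deg (-1 - n)) : ∃ z, (y, z) ∈ Γ.extensionGraph K J n := by
  induction n generalizing y with
  | zero => exact ⟨J y, mem_extensionGraph_zero.2 ⟨by simpa using hy, rfl⟩⟩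
  | succ n ih =>
    have e : (-1 - ((n + 1 : ℕ) : ℤ)) = (-1 - (n : ℤ)) - 1 := by push_cast; ring
    rw [e, hΓ _ (by omega)] at hy
    induction hy using Submodule.span_induction with
    | mem _ h =>
      obtain ⟨x, hx, y, hy, rfl⟩ := h
      obtain ⟨z, hz⟩ := ih hy
      exact ⟨_, lie_mem_extensionGraph hx hz⟩
    | zero => exact ⟨0, zero_mem _⟩
    | add a b _ _ ha hb =>
      obtain ⟨z, hz⟩ := ha
      obtain ⟨w, hw⟩ := hb
      exact ⟨z + w, add_mem hz hw⟩
    | smul c a _ ha =>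
      obtain ⟨z, hz⟩ := ha
      exact ⟨c • z, Submodule.smul_mem _ c hz⟩

/-- The complex structure of `M₋₁` extends to an operator on `⨁_{p < 0} M_p` that is compatible
with the complex structure of `L₋₁`. -/
theorem exists_extension [FiniteDimensional ℝ L] [LieAlgebra.IsKilling ℝ L]
    [FiniteDimensional ℝ M] (hS : S.IsFundamental) (hΓ : Γ.IsFundamental)
    (hK : S.adjoint.IsCRPair K K) (hJ : Γ.IsCRPair K J) :
    ∃ E : Module.End ℝ M, (∀ p, ∀ y ∈ Γ.deg p, E y ∈ Γ.deg p) ∧ (∀ y ∈ Γ.deg (-1), E y = J y) ∧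
      ∀ p < 0, ∀ x ∈ S.deg (-1), ∀ y ∈ Γ.deg p, E ⁅x, y⁆ = ⁅K x, y⁆ + ⁅x, E y⁆ := by
  obtain ⟨D, hD⟩ := S.exists_isContragredient hK
  have huniq : ∀ {n : ℕ} {y z w : M}, (y, z) ∈ Γ.extensionGraph K J n →
      (y, w) ∈ Γ.extensionGraph K J n → z = w := by
    intro n y z w hz hw
    have := sub_mem hz hw
    rw [Prod.mk_sub_mk, sub_self] at this
    exact sub_eq_zero.1 (eq_zero_of_mem_extensionGraph hS hΓ hK hD hJ this)
  have hf : ∀ p : ℤ, ∃ f : Γ.deg p →ₗ[ℝ] M, (∀ y : Γ.deg p, 0 ≤ p → f y = 0) ∧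
      ∀ n : ℕ, p = -1 - n → ∀ y : Γ.deg p, ((y : M), f y) ∈ Γ.extensionGraph K J n := by
    intro p
    by_cases hp : 0 ≤ p
    · exact ⟨0, fun _ _ => rfl, fun n hn => by omega⟩
    · obtain ⟨n, rfl⟩ : ∃ n : ℕ, p = -1 - n := ⟨(-1 - p).toNat, by omega⟩
      choose f hf using fun y : Γ.deg (-1 - n) =>
        exists_mem_extensionGraph (K := K) (J := J) hΓ y.2
      refine ⟨{ toFun := f, map_add' := fun y z => ?_, map_smul' := fun c y => ?_ },
        fun y h => absurd h hp, fun m hm y => ?_⟩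
      · exact huniq (hf (y + z)) (add_mem (hf y) (hf z))
      · exact huniq (hf (c • y)) (Submodule.smul_mem _ c (hf y))
      · obtain rfl : n = m := by omega
        exact hf y
  choose f hf0 hf using hf
  obtain ⟨E, hE⟩ := Γ.isInternal.exists_linearMap f
  have hE' : ∀ n : ℕ, ∀ y ∈ Γ.deg (-1 - n), (y, E y) ∈ Γ.extensionGraph K J n := by
    intro n y hy
    rw [hE _ ⟨y, hy⟩]
    exact hf _ n rfl ⟨y, hy⟩
  refine ⟨E, fun p y hy => ?_, fun y hy => ?_, fun p hp x hx y hy => ?_⟩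
  · by_cases hp : 0 ≤ p
    · rw [hE p ⟨y, hy⟩, hf0 p _ hp]; exact zero_mem _
    · obtain ⟨n, rfl⟩ : ∃ n : ℕ, p = -1 - n := ⟨(-1 - p).toNat, by omega⟩
      exact (extensionGraph_le hK hJ n (hE' n y hy)).2
  · exact ((mem_extensionGraph_zero.1 (hE' 0 y (by simpa using hy))).2).symm
  · obtain ⟨n, rfl⟩ : ∃ n : ℕ, p = -1 - n := ⟨(-1 - p).toNat, by omega⟩
    refine huniq (hE' (n + 1) _ ?_) (lie_mem_extensionGraph hx (hE' n y hy))
    have e : (-1 - ((n + 1 : ℕ) : ℤ)) = -1 + (-1 - (n : ℤ)) := by push_cast; ring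
    rw [e]
    exact Γ.lie_mem hx hy

end ModuleGrading

/-! ### Graded `CR` algebras and modules, and their abelian extensions -/

section CRPairs

/-- The partial complex structure, extended by zero to an operator on `𝔰`. -/
theorem GradedCRAlgebra.exists_isCRPair {s : Type*} [LieRing s] [LieAlgebra ℝ s]
    (S : GradedCRAlgebra s) : ∃ K : Module.End ℝ s, (∀ x : S.deg (-1), K x = S.J x) ∧
      S.adjoint.IsCRPair K K := by
  obtain ⟨K, hK, hK0⟩ := S.isInternal.exists_extend (-1) ((S.deg (-1)).subtype ∘ₗ S.J)
  have hK' : ∀ x : S.deg (-1), K x = S.J x := hK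
  have hlie : ∀ a ∈ S.deg 0, ∀ x ∈ S.deg (-1), K ⁅a, x⁆ = ⁅a, K x⁆ := by
    intro a ha x hx
    have h1 : ⁅a, x⁆ ∈ S.deg (-1) := by simpa using S.lie_mem ha hx
    rw [hK' ⟨x, hx⟩, hK' ⟨_, h1⟩]
    exact S.isCR.map_lie a ha ⟨x, hx⟩ ⟨_, h1⟩ rfl
  refine ⟨K, hK', fun x hx => ?_, fun x hx => ?_, hK0, fun x hx y hy => ?_, hlie,
    fun x hx a ha => ?_⟩
  · rw [hK' ⟨x, hx⟩]; exact (S.J ⟨x, hx⟩).2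
  · rw [hK' ⟨x, hx⟩, hK', S.isCR.sq]; rfl
  · rw [hK' ⟨x, hx⟩, hK' ⟨y, hy⟩]; exact S.isCR.lie_map_map ⟨x, hx⟩ ⟨y, hy⟩
  · rw [← lie_skew, map_neg, hlie a ha x hx, lie_skew]

/-- The partial complex structure of a module, extended by zero. The conditions on it are those for
`𝔰 ⊕ 𝔩`, applied to pairs of an element of `𝔰` and an element of `𝔩`. -/
theorem GradedCRModule.exists_isCRPair {s l : Type*} [LieRing s] [LieAlgebra ℝ s] [AddCommGroup l]
    [Module ℝ l] [LieRingModule s l] [LieModule ℝ s l] {S : GradedCRAlgebra s}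
    (Λ : GradedCRModule S l) {K : Module.End ℝ s} (hK : ∀ x : S.deg (-1), K x = S.J x) :
    ∃ J : Module.End ℝ l, (∀ y : Λ.deg (-1), J y = Λ.J y) ∧
      Λ.toModuleGrading.IsCRPair K J := by
  obtain ⟨J, hJ, hJ0⟩ := Λ.isInternal.exists_extend (-1) ((Λ.deg (-1)).subtype ∘ₗ Λ.J)
  have hJ' : ∀ x : Λ.deg (-1), J x = Λ.J x := hJ
  refine ⟨J, hJ', fun y hy => ?_, fun y hy => ?_, hJ0, fun x hx y hy => ?_, fun a ha y hy => ?_,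
    fun x hx w hw => ?_⟩
  · rw [hJ' ⟨y, hy⟩]; exact (Λ.J ⟨y, hy⟩).2
  · have h1 := Λ.isCR.sq ⟨⟨0, y⟩, zero_mem _, hy⟩
    have h2 := congrArg (AbelianExt.snd ∘ Subtype.val) h1
    rw [hJ' ⟨y, hy⟩, hJ']
    exact h2
  · have h1 := Λ.isCR.lie_map_map ⟨⟨x, 0⟩, hx, zero_mem _⟩ ⟨⟨0, y⟩, zero_mem _, hy⟩
    have h2 := congrArg AbelianExt.snd h1
    have h3 : S.J ⟨0, zero_mem _⟩ = 0 := map_zero S.J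
    change ⁅(S.J ⟨x, hx⟩ : s), (Λ.J ⟨y, hy⟩ : l)⁆ - ⁅(S.J ⟨0, zero_mem _⟩ : s), _⁆ =
      ⁅x, y⁆ - ⁅(0 : s), (0 : l)⁆ at h2
    rw [hK ⟨x, hx⟩, hJ' ⟨y, hy⟩]
    simpa [h3] using h2
  · have h1 : ⁅a, y⁆ ∈ Λ.deg (-1) := by simpa using Λ.lie_mem ha hy
    have h2 := Λ.isCR.map_lie ⟨a, 0⟩ ⟨ha, zero_mem _⟩ ⟨⟨0, y⟩, zero_mem _, hy⟩
      ⟨⟨0, ⁅a, y⁆⟩, zero_mem _, h1⟩ (by ext <;> simp)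
    have h3 := congrArg AbelianExt.snd h2
    change (Λ.J ⟨_, h1⟩ : l) = ⁅a, (Λ.J ⟨y, hy⟩ : l)⁆ - ⁅_, (0 : l)⁆ at h3
    rw [hJ' ⟨_, h1⟩, hJ' ⟨y, hy⟩]
    simpa using h3
  · have h1 : ⁅x, w⁆ ∈ Λ.deg (-1) := by simpa using Λ.lie_mem hx hw
    have h2 := Λ.isCR.map_lie ⟨0, w⟩ ⟨zero_mem _, hw⟩ ⟨⟨x, 0⟩, hx, zero_mem _⟩
      ⟨⟨0, -⁅x, w⁆⟩, zero_mem _, neg_mem h1⟩ (by ext <;> simp)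
    have h3 := congrArg AbelianExt.snd h2
    change (Λ.J ⟨-⁅x, w⁆, neg_mem h1⟩ : l) = ⁅(0 : s), _⁆ - ⁅(S.J ⟨x, hx⟩ : s), w⁆ at h3
    have h4 : (Λ.J ⟨-⁅x, w⁆, neg_mem h1⟩ : l) = -Λ.J ⟨⁅x, w⁆, h1⟩ :=
      congrArg Subtype.val (map_neg Λ.J ⟨⁅x, w⁆, h1⟩)
    rw [hJ' ⟨_, h1⟩, hK ⟨x, hx⟩, ← neg_inj, ← h4]
    simpa using h3

end CRPairs

section Fundamental

variable {s : Type*} [LieRing s] [LieAlgebra ℝ s] {S : LieGrading s}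
  {l : Type*} [AddCommGroup l] [Module ℝ l] [LieRingModule s l] [LieModule ℝ s l]
  {Γ : ModuleGrading S l}

theorem LieGrading.isFundamental_of_abelianExt (h : (S.abelianExt Γ).IsFundamental) :
    S.IsFundamental := by
  intro p hp
  refine le_antisymm (fun x hx => ?_) (Submodule.span_le.2 ?_)
  · have h1 : (⟨x, 0⟩ : AbelianExt s l) ∈ (S.abelianExt Γ).deg (p - 1) := ⟨hx, zero_mem _⟩
    rw [show (S.abelianExt Γ).deg (p - 1) = _ from h p hp] at h1
    have hle : Submodule.span ℝ {Z | ∃ X ∈ (S.abelianExt Γ).deg (-1),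
        ∃ Y ∈ (S.abelianExt Γ).deg p, ⁅X, Y⁆ = Z} ≤ AbelianExt.prodSubmodule
        (Submodule.span ℝ {Z | ∃ X ∈ S.deg (-1), ∃ Y ∈ S.deg p, ⁅X, Y⁆ = Z}) ⊤ := by
      rw [Submodule.span_le]
      rintro _ ⟨X, hX, Y, hY, rfl⟩
      exact ⟨Submodule.subset_span ⟨_, hX.1, _, hY.1, rfl⟩, Submodule.mem_top⟩
    exact (hle h1).1
  · rintro _ ⟨x, hx, y, hy, rfl⟩
    have := S.lie_mem hx hy
    rwa [show -1 + p = p - 1 by ring] at this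

/-- `⁅S_p, M_q⁆` is contained in `⁅S₋₁, M_{p + q + 1}⁆` for negative `p` and `q`. -/
theorem ModuleGrading.lie_mem_span_of_isFundamental (hS : S.IsFundamental) (Γ : ModuleGrading S l)
    {p q : ℤ} (hp : p < 0) (hq : q < 0) {x : s} (hx : x ∈ S.deg p) {y : l} (hy : y ∈ Γ.deg q) :
    ⁅x, y⁆ ∈ Submodule.span ℝ {z | ∃ x ∈ S.deg (-1), ∃ y ∈ Γ.deg (p + q + 1), ⁅x, y⁆ = z} := by
  let T : ℤ → Submodule ℝ l := fun r =>
    Submodule.span ℝ {z | ∃ x ∈ S.deg (-1), ∃ y ∈ Γ.deg r, ⁅x, y⁆ = z}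
  have key : S.deg p ≤ ⨅ (q : ℤ) (_ : q < 0) (y : Γ.deg q),
      (T (p + q + 1)).comap ((LieModule.toEnd ℝ s l : s →ₗ[ℝ] Module.End ℝ l).flip y) := by
    refine ModuleGrading.IsFundamental.induction (Γ := S.adjoint) hS (fun p =>
      ⨅ (q : ℤ) (_ : q < 0) (y : Γ.deg q), (T (p + q + 1)).comap
        ((LieModule.toEnd ℝ s l : s →ₗ[ℝ] Module.End ℝ l).flip y)) (fun x hx => ?_)
      (fun p hp ih x hx y hy => ?_) hp
    · simp only [Submodule.mem_iInf]
      intro q _ w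
      exact Submodule.subset_span ⟨x, hx, w, by simp, rfl⟩
    · have ih' := ih hy
      simp only [Submodule.mem_iInf] at ih' ⊢
      intro q hq w
      change ⁅⁅x, y⁆, (w : l)⁆ ∈ T (p - 1 + q + 1)
      rw [lie_lie]
      have e : p - 1 + q + 1 = p + q := by ring
      rw [e]
      refine sub_mem (Submodule.subset_span ⟨x, hx, _, Γ.lie_mem hy w.2, rfl⟩) ?_
      have h1 := ih' (-1 + q) (by omega) ⟨_, Γ.lie_mem hx w.2⟩
      rwa [show p + (-1 + q) + 1 = p + q by ring] at h1
  have h1 := key hx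
  simp only [Submodule.mem_iInf] at h1
  exact h1 q hq ⟨y, hy⟩

/-- The part `𝔩_{p - 1}` of `⁅(𝔰 ⊕ 𝔩)₋₁, (𝔰 ⊕ 𝔩)_p⁆` is `⁅𝔰₋₁, 𝔩_p⁆ + ⁅𝔰_p, 𝔩₋₁⁆`, and the second
term is contained in the first. -/
theorem ModuleGrading.isFundamental_of_abelianExt (h : (S.abelianExt Γ).IsFundamental) :
    Γ.IsFundamental := by
  have hS := LieGrading.isFundamental_of_abelianExt h
  intro p hp
  refine le_antisymm (fun y hy => ?_) (Submodule.span_le.2 ?_)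
  · have h1 : (⟨0, y⟩ : AbelianExt s l) ∈ (S.abelianExt Γ).deg (p - 1) := ⟨zero_mem _, hy⟩
    rw [show (S.abelianExt Γ).deg (p - 1) = _ from h p hp] at h1
    have hle : Submodule.span ℝ {Z | ∃ X ∈ (S.abelianExt Γ).deg (-1),
        ∃ Y ∈ (S.abelianExt Γ).deg p, ⁅X, Y⁆ = Z} ≤ AbelianExt.prodSubmodule ⊤
        (Submodule.span ℝ {Z | ∃ X ∈ S.deg (-1), ∃ Y ∈ Γ.deg p, ⁅X, Y⁆ = Z}) := by
      rw [Submodule.span_le]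
      rintro _ ⟨X, hX, Y, hY, rfl⟩
      refine ⟨Submodule.mem_top, sub_mem (Submodule.subset_span ⟨_, hX.1, _, hY.2, rfl⟩) ?_⟩
      have := Γ.lie_mem_span_of_isFundamental hS hp (by norm_num) hY.1 hX.2
      rwa [show p + -1 + 1 = p by ring] at this
    exact (hle h1).2
  · rintro _ ⟨x, hx, y, hy, rfl⟩
    have := Γ.lie_mem hx hy
    rwa [show -1 + p = p - 1 by ring] at this

/-- Compatibility with the action of `L₋₁` implies compatibility with that of `⨁_{p < 0} L_p`. -/
theorem ModuleGrading.map_lie_of_isFundamental (hS : S.IsFundamental) {F : Module.End ℝ s}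
    {E : Module.End ℝ l}
    (hF : ∀ p < 0, ∀ x ∈ S.deg (-1), ∀ y ∈ S.deg p, F ⁅x, y⁆ = ⁅F x, y⁆ + ⁅x, F y⁆)
    (hE : ∀ p < 0, ∀ x ∈ S.deg (-1), ∀ y ∈ Γ.deg p, E ⁅x, y⁆ = ⁅F x, y⁆ + ⁅x, E y⁆)
    {p q : ℤ} (hp : p < 0) (hq : q < 0) {x : s} (hx : x ∈ S.deg p) {y : l} (hy : y ∈ Γ.deg q) :
    E ⁅x, y⁆ = ⁅F x, y⁆ + ⁅x, E y⁆ := by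
  let ρ : s →ₗ[ℝ] Module.End ℝ l := LieModule.toEnd ℝ s l
  have key : S.deg p ≤ ⨅ (q : ℤ) (_ : q < 0) (y : Γ.deg q),
      LinearMap.ker (E ∘ₗ ρ.flip y - ρ.flip y ∘ₗ F - ρ.flip (E y)) := by
    refine ModuleGrading.IsFundamental.induction (Γ := S.adjoint) hS (fun _ =>
      ⨅ (q : ℤ) (_ : q < 0) (y : Γ.deg q),
        LinearMap.ker (E ∘ₗ ρ.flip y - ρ.flip y ∘ₗ F - ρ.flip (E y))) (fun x hx => ?_)
      (fun p hp ih x hx y hy => ?_) hp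
    · simp only [Submodule.mem_iInf]
      intro q hq w
      change E ⁅x, (w : l)⁆ - ⁅F x, (w : l)⁆ - ⁅x, E w⁆ = 0
      rw [hE q hq x hx w w.2]
      abel
    · have ih' := ih hy
      simp only [Submodule.mem_iInf] at ih' ⊢
      intro q hq w
      have h1 : ∀ q < 0, ∀ w ∈ Γ.deg q, E ⁅y, w⁆ = ⁅F y, w⁆ + ⁅y, E w⁆ := fun q hq w hw => by
        rw [← sub_eq_zero, ← ih' q hq ⟨w, hw⟩]
        change E ⁅y, w⁆ - (⁅F y, w⁆ + ⁅y, E w⁆) = E ⁅y, w⁆ - ⁅F y, w⁆ - ⁅y, E w⁆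
        abel
      change E ⁅⁅x, y⁆, (w : l)⁆ - ⁅F ⁅x, y⁆, (w : l)⁆ - ⁅⁅x, y⁆, E w⁆ = 0
      rw [hF p hp x hx y hy, lie_lie, map_sub, hE (p + q) (by omega) x hx _ (Γ.lie_mem hy w.2),
        h1 (-1 + q) (by omega) _ (Γ.lie_mem hx w.2), h1 q hq w w.2, hE q hq x hx w w.2, add_lie,
        lie_lie, lie_lie, lie_lie, lie_add, lie_add]
      abel
  have h1 := key hx
  simp only [Submodule.mem_iInf] at h1
  have h2 : E ⁅x, y⁆ - ⁅F x, y⁆ - ⁅x, E y⁆ = 0 := h1 q hq ⟨y, hy⟩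
  rw [sub_sub, sub_eq_zero] at h2
  exact h2

end Fundamental

/-! ### Prolongation by derivations of degree zero -/

namespace GradedCRAlgebra

variable {a : Type*} [LieRing a] [LieAlgebra ℝ a] (A : GradedCRAlgebra a)

/-- The Lie algebra of the derivations of `𝔞₋` that preserve the gradation and commute with the
partial complex structure. -/
def degreeZeroDerivations : LieSubalgebra ℝ (LieDerivation ℝ A.neg A.neg) where
  carrier := {D | (∀ p, ∀ x : A.neg, (x : a) ∈ A.deg p → (D x : a) ∈ A.deg p) ∧
    ∀ X Z : A.deg (-1), D (A.toNeg X) = A.toNeg Z → D (A.toNeg (A.J X)) = A.toNeg (A.J Z)}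
  zero_mem' := by
    refine ⟨fun p x _ => zero_mem (A.deg p), fun X Z h => ?_⟩
    obtain rfl : Z = 0 := Subtype.ext (congrArg (fun z : A.neg => (z : a)) h).symm
    rw [map_zero]
    rfl
  add_mem' := by
    rintro D D' ⟨h1, h2⟩ ⟨h1', h2'⟩
    refine ⟨fun p x hx => add_mem (h1 p x hx) (h1' p x hx), fun X Z h => ?_⟩
    have e1 := h2 X ⟨_, h1 (-1) (A.toNeg X) X.2⟩ rfl
    have e2 := h2' X ⟨_, h1' (-1) (A.toNeg X) X.2⟩ rfl
    obtain rfl : ⟨_, h1 (-1) (A.toNeg X) X.2⟩ + ⟨_, h1' (-1) (A.toNeg X) X.2⟩ = Z :=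
      Subtype.ext (congrArg (fun z : A.neg => (z : a)) h)
    rw [map_add, LieDerivation.add_apply, e1, e2]
    rfl
  smul_mem' := by
    rintro c D ⟨h1, h2⟩
    refine ⟨fun p x hx => Submodule.smul_mem _ c (h1 p x hx), fun X Z h => ?_⟩
    have e1 := h2 X ⟨_, h1 (-1) (A.toNeg X) X.2⟩ rfl
    obtain rfl : c • ⟨_, h1 (-1) (A.toNeg X) X.2⟩ = Z :=
      Subtype.ext (congrArg (fun z : A.neg => (z : a)) h)
    rw [map_smul, LieDerivation.smul_apply, e1]
    rfl
  lie_mem' := by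
    rintro D D' ⟨h1, h2⟩ ⟨h1', h2'⟩
    refine ⟨fun p x hx => ?_, fun X Z h => ?_⟩
    · rw [LieDerivation.lie_apply]
      exact sub_mem (h1 p _ (h1' p x hx)) (h1' p _ (h1 p x hx))
    · rw [LieDerivation.lie_apply] at h ⊢
      have e1 := h2 X ⟨_, h1 (-1) (A.toNeg X) X.2⟩ rfl
      have e2 := h2' X ⟨_, h1' (-1) (A.toNeg X) X.2⟩ rfl
      have f1 := h2 ⟨_, h1' (-1) (A.toNeg X) X.2⟩
        ⟨_, h1 (-1) _ (h1' (-1) (A.toNeg X) X.2)⟩ rfl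
      have f2 := h2' ⟨_, h1 (-1) (A.toNeg X) X.2⟩
        ⟨_, h1' (-1) _ (h1 (-1) (A.toNeg X) X.2)⟩ rfl
      obtain rfl : ⟨_, h1 (-1) _ (h1' (-1) (A.toNeg X) X.2)⟩ -
          ⟨_, h1' (-1) _ (h1 (-1) (A.toNeg X) X.2)⟩ = Z :=
        Subtype.ext (congrArg (fun z : A.neg => (z : a)) h)
      rw [map_sub, e1, e2, f1, f2]
      rfl

/-- The semidirect sum of `𝔞₋` and the Lie algebra of its derivations of degree zero that commute
with the partial complex structure. -/
abbrev DegreeZeroProlongation : Type _ :=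
  LieAlgebra.SemiDirectSum A.neg A.degreeZeroDerivations A.degreeZeroDerivations.incl

/-- The induced gradation of `𝔞₋`. -/
theorem isInternal_comap_neg :
    DirectSum.IsInternal fun p => (A.deg p).comap A.neg.toSubmodule.subtype := by
  have hA := A.isInternal
  rw [DirectSum.isInternal_submodule_iff_iSupIndep_and_iSup_eq_top] at hA ⊢
  constructor
  · rw [iSupIndep_def]
    intro p
    rw [Submodule.disjoint_def]
    intro x hx hx'
    have hle : (⨆ (q) (_ : q ≠ p), (A.deg q).comap A.neg.toSubmodule.subtype) ≤
        (⨆ (q) (_ : q ≠ p), A.deg q).comap A.neg.toSubmodule.subtype :=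
      iSup₂_le fun q hq y hy => (le_iSup₂_of_le (f := fun q (_ : q ≠ p) => A.deg q) q hq le_rfl) hy
    exact Subtype.ext (Submodule.disjoint_def.1 (iSupIndep_def.1 hA.1 p) _ hx (hle hx'))
  · rw [eq_top_iff]
    rintro ⟨x, hx⟩ -
    have hle : A.neg.toSubmodule ≤ (⨆ p, (A.deg p).comap A.neg.toSubmodule.subtype).map
        A.neg.toSubmodule.subtype :=
      iSup₂_le fun p hp y hy =>
        ⟨⟨y, A.mem_neg hp hy⟩, Submodule.mem_iSup_of_mem p hy, rfl⟩
    obtain ⟨y, hy, rfl⟩ := hle hx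
    exact hy

theorem eq_zero_of_mem_neg {p : ℤ} (hp : 0 ≤ p) {x : A.neg} (hx : (x : a) ∈ A.deg p) : x = 0 := by
  have h := (DirectSum.isInternal_submodule_iff_iSupIndep_and_iSup_eq_top _).1 A.isInternal
  refine Subtype.ext (Submodule.disjoint_def.1 (iSupIndep_def.1 h.1 p) _ hx ?_)
  have hle : A.neg.toSubmodule ≤ ⨆ (q) (_ : q ≠ p), A.deg q :=
    iSup₂_le fun q hq => le_iSup₂_of_le (f := fun q (_ : q ≠ p) => A.deg q) q (by omega) le_rfl
  exact hle x.2

/-- The part of degree `p` of `DegreeZeroProlongation`: the part of degree `p` of `𝔞₋` if `p < 0`,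
the derivations if `p = 0`, and zero if `p > 0`. -/
def degreeZeroProlongationDeg (p : ℤ) : Submodule ℝ A.DegreeZeroProlongation where
  carrier := {z | (z.left : a) ∈ A.deg p ∧ (p ≠ 0 → z.right = 0)}
  zero_mem' := ⟨zero_mem (A.deg p), fun _ => rfl⟩
  add_mem' := fun {x y} hx hy => ⟨add_mem hx.1 hy.1, fun hp => by
    rw [LieAlgebra.SemiDirectSum.add_eq_mk, hx.2 hp, hy.2 hp, add_zero]⟩
  smul_mem' := fun c x hx => ⟨Submodule.smul_mem _ c hx.1, fun hp => by
    rw [LieAlgebra.SemiDirectSum.smul_eq_mk, hx.2 hp, smul_zero]⟩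

variable {A} in
theorem mem_degreeZeroProlongationDeg {p : ℤ} {z : A.DegreeZeroProlongation} :
    z ∈ A.degreeZeroProlongationDeg p ↔
      (z.left : a) ∈ A.deg p ∧ (p ≠ 0 → z.right = 0) := Iff.rfl

/-- The gradation of `DegreeZeroProlongation`. -/
def degreeZeroProlongationGrading : LieGrading A.DegreeZeroProlongation where
  deg := A.degreeZeroProlongationDeg
  isInternal := by
    rw [DirectSum.isInternal_submodule_iff_iSupIndep_and_iSup_eq_top]
    have hA := A.isInternal_comap_neg
    rw [DirectSum.isInternal_submodule_iff_iSupIndep_and_iSup_eq_top] at hA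
    constructor
    · rw [iSupIndep_def]
      intro p
      rw [Submodule.disjoint_def]
      intro x hx hx'
      let T : Submodule ℝ A.DegreeZeroProlongation :=
        { carrier := {z | z.left ∈ ⨆ (q) (_ : q ≠ p), (A.deg q).comap A.neg.toSubmodule.subtype ∧
            (p = 0 → z.right = 0)}
          zero_mem' := ⟨zero_mem _, fun _ => rfl⟩
          add_mem' := fun {x y} hx hy => ⟨add_mem hx.1 hy.1, fun hp => by
            rw [LieAlgebra.SemiDirectSum.add_eq_mk, hx.2 hp, hy.2 hp, add_zero]⟩
          smul_mem' := fun c x hx => ⟨Submodule.smul_mem _ c hx.1, fun hp => by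
            rw [LieAlgebra.SemiDirectSum.smul_eq_mk, hx.2 hp, smul_zero]⟩ }
      have h1 : x ∈ T := by
        refine (iSup₂_le fun q hq y hy => ⟨?_, fun hp => hy.2 (by omega)⟩ :
          (⨆ (q) (_ : q ≠ p), A.degreeZeroProlongationDeg q) ≤ T) hx'
        exact (le_iSup₂_of_le
          (f := fun q (_ : q ≠ p) => (A.deg q).comap A.neg.toSubmodule.subtype) q hq le_rfl) hy.1
      have h2 : x.left = 0 := Submodule.disjoint_def.1 (iSupIndep_def.1 hA.1 p) _ hx.1 h1.1
      have h3 : x.right = 0 := by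
        by_cases hp : p = 0
        · exact h1.2 hp
        · exact hx.2 hp
      ext1
      exacts [h2, h3]
    · rw [eq_top_iff]
      intro x _
      have hx : x = ⟨x.left, 0⟩ + ⟨0, x.right⟩ := by simp
      rw [hx]
      refine add_mem ?_ (Submodule.mem_iSup_of_mem 0 ⟨zero_mem (A.deg 0), fun h => absurd rfl h⟩)
      have hle : (⨆ p, (A.deg p).comap A.neg.toSubmodule.subtype) ≤ (⨆ p,
          A.degreeZeroProlongationDeg p).comap
            (LieAlgebra.SemiDirectSum.inl A.degreeZeroDerivations.incl : _ →ₗ[ℝ] _) :=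
        iSup_le fun p y hy => Submodule.mem_iSup_of_mem p ⟨hy, fun _ => rfl⟩
      rw [hA.2] at hle
      exact hle (Submodule.mem_top (x := x.left))
  lie_mem {p q x y} hx hy := by
    rw [LieAlgebra.SemiDirectSum.lie_eq_mk]
    refine ⟨?_, fun hpq => ?_⟩
    · refine sub_mem (add_mem (A.lie_mem hx.1 hy.1) ?_) ?_
      · by_cases hp : p = 0
        · subst hp
          rw [zero_add]
          exact x.right.2.1 q _ hy.1
        · rw [hx.2 hp, map_zero]
          exact zero_mem _
      · by_cases hq : q = 0
        · subst hq
          rw [add_zero]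
          exact y.right.2.1 p _ hx.1
        · rw [hy.2 hq, map_zero]
          exact zero_mem _
    · by_cases hp : p = 0
      · rw [show y.right = 0 from hy.2 (by omega)]
        exact lie_zero x.right
      · rw [show x.right = 0 from hx.2 hp]
        exact zero_lie y.right

/-- The partial complex structure of `DegreeZeroProlongation`, which is that of `𝔞`. -/
def degreeZeroProlongationJ :
    A.degreeZeroProlongationGrading.deg (-1) →ₗ[ℝ] A.degreeZeroProlongationGrading.deg (-1) where
  toFun X := ⟨⟨A.toNeg (A.J ⟨X.1.left, (mem_degreeZeroProlongationDeg.1 X.2).1⟩), 0⟩,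
    (A.J _).2, fun _ => rfl⟩
  map_add' X Y := by
    refine Subtype.ext (LieAlgebra.SemiDirectSum.ext (Subtype.ext ?_) (add_zero _).symm)
    exact congrArg (fun z : A.deg (-1) => (z : a))
      (A.J.map_add ⟨X.1.left, (mem_degreeZeroProlongationDeg.1 X.2).1⟩
        ⟨Y.1.left, (mem_degreeZeroProlongationDeg.1 Y.2).1⟩)
  map_smul' c X := by
    refine Subtype.ext (LieAlgebra.SemiDirectSum.ext (Subtype.ext ?_) (smul_zero _).symm)
    exact congrArg (fun z : A.deg (-1) => (z : a))
      (A.J.map_smul c ⟨X.1.left, (mem_degreeZeroProlongationDeg.1 X.2).1⟩)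

variable {A} in
theorem degreeZeroProlongationJ_apply (X : A.degreeZeroProlongationGrading.deg (-1))
    (hX : (X.1.left : a) ∈ A.deg (-1)) :
    (A.degreeZeroProlongationJ X : A.DegreeZeroProlongation) =
      ⟨A.toNeg (A.J ⟨X.1.left, hX⟩), 0⟩ := rfl

/-- The graded `CR` algebra structure of `DegreeZeroProlongation`, with the partial complex
structure of `𝔞`. -/
def degreeZeroProlongation : GradedCRAlgebra A.DegreeZeroProlongation where
  toLieGrading := A.degreeZeroProlongationGrading
  J := A.degreeZeroProlongationJ
  isCR :=
    { sq := fun X => by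
        refine Subtype.ext (LieAlgebra.SemiDirectSum.ext (Subtype.ext ?_) ?_)
        · exact congrArg (fun z : A.deg (-1) => (z : a))
            (A.isCR.sq ⟨X.1.left, (mem_degreeZeroProlongationDeg.1 X.2).1⟩)
        · change 0 = -X.1.right
          rw [(mem_degreeZeroProlongationDeg.1 X.2).2 (by norm_num), neg_zero]
      lie_map_map := fun X Y => by
        have hX := mem_degreeZeroProlongationDeg.1 X.2
        have hY := mem_degreeZeroProlongationDeg.1 Y.2
        rw [LieAlgebra.SemiDirectSum.lie_eq_mk, LieAlgebra.SemiDirectSum.lie_eq_mk,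
          hX.2 (by norm_num), hY.2 (by norm_num), degreeZeroProlongationJ_apply _ hX.1,
          degreeZeroProlongationJ_apply _ hY.1]
        refine LieAlgebra.SemiDirectSum.ext ?_ rfl
        simp only [map_zero, LieDerivation.zero_apply, add_zero, sub_zero]
        exact Subtype.ext (A.isCR.lie_map_map ⟨X.1.left, hX.1⟩ ⟨Y.1.left, hY.1⟩)
      map_lie := fun D hD X Z hZ => by
        have hX := mem_degreeZeroProlongationDeg.1 X.2
        have hZ' := mem_degreeZeroProlongationDeg.1 Z.2
        have h0 : D.left = 0 :=
          A.eq_zero_of_mem_neg le_rfl (mem_degreeZeroProlongationDeg.1 hD).1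
        rw [LieAlgebra.SemiDirectSum.lie_eq_mk, hX.2 (by norm_num), h0] at hZ
        have h1 := congrArg LieAlgebra.SemiDirectSum.left hZ
        simp only [zero_lie, zero_add, map_zero, sub_zero] at h1
        rw [LieAlgebra.SemiDirectSum.lie_eq_mk, h0, degreeZeroProlongationJ_apply _ hX.1,
          degreeZeroProlongationJ_apply _ hZ'.1]
        refine LieAlgebra.SemiDirectSum.ext ?_ (lie_zero D.right).symm
        simp only [zero_lie, zero_add, map_zero, sub_zero]
        exact (D.right.2.2 ⟨X.1.left, hX.1⟩ ⟨Z.1.left, hZ'.1⟩ h1.symm).symm }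

/-- Transitivity in degree zero holds because a derivation of `𝔞₋` is determined by its values on
`𝔞₋₁`, which generates `𝔞₋`. -/
theorem isTransitiveProlongation_degreeZeroProlongation (hA : A.IsFundamental) :
    A.IsTransitiveProlongation A.degreeZeroProlongation
      (LieAlgebra.SemiDirectSum.inl A.degreeZeroDerivations.incl) where
  transitive := by
    intro p hp Y hY hY0
    by_contra! h
    refine hY0 (LieAlgebra.SemiDirectSum.ext (A.eq_zero_of_mem_neg hp hY.1) ?_)
    by_cases hp0 : p = 0
    swap
    · exact hY.2 hp0
    have h0 : Y.left = 0 := A.eq_zero_of_mem_neg hp hY.1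
    -- A derivation that vanishes on `𝔞₋₁` is zero, since `𝔞₋₁` generates `𝔞₋`.
    have h1 : ∀ x ∈ A.deg (-1), ∀ hx : x ∈ A.neg, Y.right.1 ⟨x, hx⟩ = 0 := by
      intro x hx hx'
      have h2 := h ⟨⟨x, hx'⟩, 0⟩ ⟨hx, fun _ => rfl⟩
      rw [LieAlgebra.SemiDirectSum.lie_eq_mk, h0] at h2
      have h3 := congrArg LieAlgebra.SemiDirectSum.left h2
      simp only [lie_zero, map_zero, zero_add, zero_sub] at h3
      exact neg_eq_zero.1 h3
    have h2 : ∀ {p : ℤ}, p < 0 → A.deg p ≤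
        (LinearMap.ker (Y.right.1 : A.neg →ₗ[ℝ] A.neg)).map A.neg.toSubmodule.subtype := by
      refine ModuleGrading.IsFundamental.induction (Γ := A.adjoint) hA (fun _ =>
        (LinearMap.ker (Y.right.1 : A.neg →ₗ[ℝ] A.neg)).map A.neg.toSubmodule.subtype)
        (fun x hx => ⟨⟨x, A.mem_neg (by norm_num) hx⟩, h1 x hx _, rfl⟩)
        (fun p hp ih x hx y hy => ?_)
      obtain ⟨y, hy', rfl⟩ := ih hy
      refine ⟨⁅(⟨x, A.mem_neg (by norm_num) hx⟩ : A.neg), y⁆, ?_, rfl⟩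
      have hy' : Y.right.1 y = 0 := hy'
      change Y.right.1 _ = 0
      rw [LieDerivation.apply_lie_eq_add, hy', h1 x hx, lie_zero, zero_lie, add_zero]
    have h3 : A.neg.toSubmodule ≤
        (LinearMap.ker (Y.right.1 : A.neg →ₗ[ℝ] A.neg)).map A.neg.toSubmodule.subtype :=
      iSup₂_le fun p hp => h2 hp
    refine Subtype.ext (LieDerivation.ext fun x => ?_)
    obtain ⟨y, hy, hyx⟩ := h3 x.2
    obtain rfl : y = x := Subtype.ext hyx
    exact hy
  injective := LieAlgebra.SemiDirectSum.inl_injective _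
  mem_deg_iff p hp y := by
    constructor
    · rintro ⟨h1, h2⟩
      exact ⟨y.left, h1, LieAlgebra.SemiDirectSum.ext rfl (h2 (by omega)).symm⟩
    · rintro ⟨x, hx, rfl⟩
      exact ⟨hx, fun _ => rfl⟩
  map_J X Y h := by
    have h1 : Y.1.left = A.toNeg X := congrArg LieAlgebra.SemiDirectSum.left h
    have h2 : (⟨Y.1.left, (mem_degreeZeroProlongationDeg.1 Y.2).1⟩ : A.deg (-1)) = X :=
      Subtype.ext (congrArg (fun z : A.neg => (z : a)) h1)
    rw [← h2]
    rfl

/-- If the partial complex structure of `𝔞` extends to a derivation of `𝔞₋` of degree zero, then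
the Levi–Tanaka algebra of `𝔞₋` has the `J` property. -/
theorem IsLeviTanakaProlongation.hasJProperty {a g : Type u} [LieRing a] [LieAlgebra ℝ a]
    [FiniteDimensional ℝ a] [LieRing g] [LieAlgebra ℝ g] {A : GradedCRAlgebra a}
    {G : GradedCRAlgebra g} {ι : A.neg →ₗ⁅ℝ⁆ g} (h : A.IsLeviTanakaProlongation G ι)
    (hA : A.IsFundamental) (D : LieDerivation ℝ A.neg A.neg)
    (hD : ∀ p, ∀ x : A.neg, (x : a) ∈ A.deg p → (D x : a) ∈ A.deg p)
    (hDJ : ∀ X : A.deg (-1), D (A.toNeg X) = A.toNeg (A.J X)) : G.HasJProperty := by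
  have hmem : D ∈ A.degreeZeroDerivations := by
    refine ⟨hD, fun X Z hZ => ?_⟩
    rw [hDJ] at hZ
    have hXZ : A.J X = Z := Subtype.ext (congrArg (fun z : A.neg => (z : a)) hZ)
    rw [hDJ, hXZ]
  have : FiniteDimensional ℝ A.DegreeZeroProlongation := by
    have : FiniteDimensional ℝ A.degreeZeroDerivations :=
      inferInstanceAs (FiniteDimensional ℝ A.degreeZeroDerivations.toSubmodule)
    exact Module.Finite.equiv (LieAlgebra.SemiDirectSum.toProdl A.degreeZeroDerivations.incl).symm
  -- By maximality, the prolongation by derivations embeds in the Levi–Tanaka algebra.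
  obtain ⟨φ, -, -, hφ⟩ := h.maximal _ A.degreeZeroProlongation _
    (A.isTransitiveProlongation_degreeZeroProlongation hA)
  refine ⟨φ ⟨0, ⟨D, hmem⟩⟩, fun Y => ?_⟩
  obtain ⟨x, hx, hxY⟩ := (h.isTransitiveProlongation.mem_deg_iff (-1) (by norm_num) Y).1 Y.2
  have hY : (Y : g) = ι (A.toNeg ⟨x, hx⟩) := hxY.symm
  rw [h.isTransitiveProlongation.map_J ⟨x, hx⟩ Y hY, hY, ← hφ, ← hφ, ← LieHom.map_lie,
    LieAlgebra.SemiDirectSum.lie_eq_mk, ← hDJ]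
  congr 1
  refine LieAlgebra.SemiDirectSum.ext ?_ ?_
  · change _ = ⁅(0 : A.neg), _⁆ + D (A.toNeg ⟨x, hx⟩) - (0 : LieDerivation ℝ A.neg A.neg) 0
    rw [zero_lie, zero_add, map_zero, sub_zero]
    rfl
  · exact (lie_zero _).symm

end GradedCRAlgebra

/-! ### The `J` property -/

/-- An operator of degree zero that satisfies the Leibniz rule on homogeneous elements of negative
degree restricts to a derivation of `𝔞₋`. -/
theorem LieGrading.exists_lieDerivation_neg {a : Type*} [LieRing a] [LieAlgebra ℝ a]
    (A : LieGrading a) (E : Module.End ℝ a) (hE : ∀ p, ∀ x ∈ A.deg p, E x ∈ A.deg p)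
    (hlie : ∀ p < 0, ∀ q < 0, ∀ x ∈ A.deg p, ∀ y ∈ A.deg q, E ⁅x, y⁆ = ⁅E x, y⁆ + ⁅x, E y⁆) :
    ∃ D : LieDerivation ℝ A.neg A.neg, ∀ x, (D x : a) = E x := by
  have hmem : ∀ x ∈ A.neg.toSubmodule, E x ∈ A.neg.toSubmodule := by
    have hle : A.neg.toSubmodule ≤ A.neg.toSubmodule.comap E :=
      iSup₂_le fun p hp x hx => A.mem_neg hp (hE p x hx)
    exact fun x hx => hle hx
  let ad : a →ₗ[ℝ] Module.End ℝ a := LieAlgebra.ad ℝ a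
  have h1 : ∀ p < 0, ∀ x ∈ A.deg p, ∀ y ∈ A.neg, E ⁅x, y⁆ = ⁅E x, y⁆ + ⁅x, E y⁆ := by
    intro p hp x hx y hy
    have hle : A.neg.toSubmodule ≤ LinearMap.eqLocus (E ∘ₗ ad x) (ad (E x) + ad x ∘ₗ E) :=
      iSup₂_le fun q hq y hy => hlie p hp q hq x hx y hy
    exact hle hy
  have h2 : ∀ x ∈ A.neg, ∀ y ∈ A.neg, E ⁅x, y⁆ = ⁅E x, y⁆ + ⁅x, E y⁆ := by
    intro x hx y hy
    have hle : A.neg.toSubmodule ≤ LinearMap.eqLocus (E ∘ₗ ad.flip y)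
        (ad.flip y ∘ₗ E + ad.flip (E y)) :=
      iSup₂_le fun p hp x hx => h1 p hp x hx y hy
    exact hle hx
  refine ⟨⟨E.restrict hmem, fun x y => Subtype.ext ?_⟩, fun x => rfl⟩
  change E ⁅(x : a), (y : a)⁆ = ⁅(x : a), E y⁆ - ⁅(y : a), E x⁆
  rw [h2 x x.2 y y.2, ← lie_skew (y : a)]
  abel

theorem mainTheorem1 {s l g : Type u}
    [LieRing s] [LieAlgebra ℝ s] [FiniteDimensional ℝ s] [LieAlgebra.IsSemisimple ℝ s]
    [AddCommGroup l] [Module ℝ l] [FiniteDimensional ℝ l] [LieRingModule s l] [LieModule ℝ s l]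
    [LieRing g] [LieAlgebra ℝ g]
    (S : GradedCRAlgebra s) (hS : S.IsTransitive)
    (Λ : GradedCRModule S l) (hΛ : Λ.IsTransitive) (hΛ' : Λ.IsNondegenerate)
    (G : GradedCRAlgebra g) (ι : (S.abelianExt Λ).neg →ₗ⁅ℝ⁆ g)
    (hG : S.IsLeviTanakaExtension Λ G ι) :
    G.HasJProperty := by
  have hfS : S.IsFundamental := LieGrading.isFundamental_of_abelianExt hG.fundamental
  have hfΛ : Λ.IsFundamental := ModuleGrading.isFundamental_of_abelianExt hG.fundamental
  obtain ⟨K, hKS, hK⟩ := S.exists_isCRPair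
  obtain ⟨J, hJΛ, hJ⟩ := Λ.exists_isCRPair hKS
  obtain ⟨F, hF0, hF1, hF⟩ := ModuleGrading.exists_extension hfS hfS hK hK
  obtain ⟨E, hE0, hE1, hE⟩ := ModuleGrading.exists_extension hfS hfΛ hK hJ
  have hFF : ∀ p < 0, ∀ x ∈ S.deg (-1), ∀ y ∈ S.deg p, F ⁅x, y⁆ = ⁅F x, y⁆ + ⁅x, F y⁆ :=
    fun p hp x hx y hy => by rw [hF1 x hx]; exact hF p hp x hx y hy
  have hEF : ∀ p < 0, ∀ x ∈ S.deg (-1), ∀ y ∈ Λ.deg p, E ⁅x, y⁆ = ⁅F x, y⁆ + ⁅x, E y⁆ :=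
    fun p hp x hx y hy => by rw [hF1 x hx]; exact hE p hp x hx y hy
  let T : Module.End ℝ (AbelianExt s l) :=
    { toFun := fun x => ⟨F x.fst, E x.snd⟩
      map_add' := fun x y => by ext <;> simp
      map_smul' := fun c x => by ext <;> simp }
  have : FiniteDimensional ℝ (AbelianExt s l) :=
    Module.Finite.equiv (LinearEquiv.mk (AbelianExt.inl.coprod AbelianExt.inr : s × l →ₗ[ℝ] _)
      (AbelianExt.toProd s l) (fun x => by simp [AbelianExt.toProd, AbelianExt.inl, AbelianExt.inr])
      (fun x => by ext <;> simp [AbelianExt.toProd, AbelianExt.inl, AbelianExt.inr]))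
  obtain ⟨D, hD⟩ := (S.abelianExt Λ).exists_lieDerivation_neg T
    (fun p x hx => ⟨hF0 p _ hx.1, hE0 p _ hx.2⟩) fun p hp q hq x hx y hy => by
      have e0 : F ⁅x.fst, y.fst⁆ = ⁅F x.fst, y.fst⁆ + ⁅x.fst, F y.fst⁆ :=
        ModuleGrading.map_lie_of_isFundamental (Γ := S.adjoint) hfS hFF hFF hp hq hx.1 hy.1
      have e1 := ModuleGrading.map_lie_of_isFundamental hfS hFF hEF hp hq hx.1 hy.2
      have e2 := ModuleGrading.map_lie_of_isFundamental hfS hFF hEF hq hp hy.1 hx.2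
      ext
      · exact e0
      · change E (⁅x.fst, y.snd⁆ - ⁅y.fst, x.snd⁆) =
          ⁅F x.fst, y.snd⁆ - ⁅y.fst, E x.snd⁆ + (⁅x.fst, E y.snd⁆ - ⁅F y.fst, x.snd⁆)
        rw [map_sub, e1, e2]
        abel
  refine hG.isLeviTanaka.hasJProperty hG.fundamental D (fun p x hx => ?_) fun X => Subtype.ext ?_
  · rw [hD]
    exact ⟨hF0 p _ hx.1, hE0 p _ hx.2⟩
  · rw [hD]
    ext
    · exact (hF1 _ X.2.1).trans (hKS ⟨_, X.2.1⟩)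
    · exact (hE1 _ X.2.2).trans (hJΛ ⟨_, X.2.2⟩)
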